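/- Let $d\ge 1$, let $H_0$ be a bounded self-adjoint operator on $\ell^2(\mathbb Z^d)$ that commutes with all translations of $\mathbb Z^d$, let $0<\alpha\le 1$, and let $\mu$ be a probability measure on $\mathbb R$ that is uniformly $\alpha$-Hölder continuous: there is $U$ with $\mu([x,x+s])\le U s^\alpha$ for all $x\in\mathbb R$, $s>0$. Let $\omega=(\omega_j)_{j\in\mathbb Z^d}$ be independent random variables with common law $\mu$, and let $H^\omega=H_0+\sum_{j}\omega_jP_j$ be the Anderson model, where $P_j$ is the orthogonal projection onto $\ell^2(\{j\})$. For a finite $\Lambda\subset\mathbb Z^d$ let $H^\omega_\Lambda$ be the compression of $H^\omega$ to $\ell^2(\Lambda)$. Assume localization in $[a,b]$: there are $s>0$, $C<\infty$ and $0<\gamma<\infty$ such that for all sufficiently large cubes $\Lambda\subset\mathbb Z^d$ and all $n,m\in\Lambda$, $$\sup_{\operatorname{Im}z>0,\ \operatorname{Re}z\in[a,b]}\mathbb E\big(|\langle\delta_n,(H^\omega_\Lambda-z)^{-1}\delta_m\rangle|^s\big)\le C e^{-\gamma|n-m|},$$ and let $E\in[a,b]$. Let $\mathcal N(A)=\mathbb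 E\langle\delta_0,E_{H^\omega}(A)\delta_0\rangle$ be the integrated density of states, where $E_{H^\omega}$ denotes the spectral projections of $H^\omega$, and suppose that its $\alpha$-upper derivative $$D^\alpha_{\mathcal N}(E)=\limsup_{\epsilon\downarrow0}\frac{\mathcal N((E-\epsilon,E+\epsilon))}{(2\epsilon)^\alpha}$$ satisfies $0<D^\alpha_{\mathcal N}(E)<\infty$. For $L\in\mathbb N$ put $\Lambda_L=\{-L,\dots,L\}^d$ and $\beta_L=(2L+1)^{d/\alpha}$, and for a set $I\subset\mathbb R$ let $\xi^\omega_{L,E}(I)$ be the trace of the spectral projection of $\beta_L(H^\omega_{\Lambda_L}-E)$ onto $I$, i.e. the number of its eigenvalues in $I$ counted with multiplicity. Then for every bounded open interval $I$ with $I=-I$ there is a strictly increasing sequence $(L_n)$ of natural numbers such that $\xi^\omega_{L_n,E}(I)$ converges in distribution, as $n\to\infty$, to a Poisson random variable with parameter $D^\alpha_{\mathcal N}(E)\,\mathcal L_\alpha(I)$, where $$\mathcal L_\alpha(I)=\alpha2^{\alpha-1}\int_I|y|^{\alpha-1}\,dy .$$ -/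

import Mathlib

open MeasureTheory Filter Topology
open scoped ENNReal NNReal

namespace Anderson

/-- The Hilbert space `ℓ²(ℤᵈ)`. -/
abbrev L2 (d : ℕ) : Type := lp (fun _ : Fin d → ℤ => ℂ) 2

/-- The canonical basis vector `δ_m` of `ℓ²(ℤᵈ)`. -/
noncomputable def delta {d : ℕ} (m : Fin d → ℤ) : L2 d := lp.single 2 m (1 : ℂ)

theorem memlp_translate {d : ℕ} (k : Fin d → ℤ) (f : L2 d) :
    Memℓp (fun n : Fin d → ℤ => f (n - k)) 2 := by
  have h := (memℓp_gen_iff (p := 2) (by norm_num)).1 (lp.memℓp f)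
  refine (memℓp_gen_iff (by norm_num)).2 ?_
  exact h.comp_injective (sub_left_injective (b := k))

/-- Translation by `k`: `(translate k f)(n) = f(n - k)`. -/
noncomputable def translate {d : ℕ} (k : Fin d → ℤ) (f : L2 d) : L2 d :=
  ⟨fun n => f (n - k), memlp_translate k f⟩

/-- `H₀` commutes with all lattice translations. -/
def CommutesWithTranslations {d : ℕ} (H0 : L2 d →L[ℂ] L2 d) : Prop :=
  ∀ (k : Fin d → ℤ) (f : L2 d), H0 (translate k f) = translate k (H0 f)

/-- Multiplication by the potential `ω`, i.e. `∑ⱼ ωⱼ Pⱼ`, on its maximal domain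
`{ψ ∈ ℓ² : (ωₙ ψ(n))ₙ ∈ ℓ²}`. -/
noncomputable def potential {d : ℕ} (ω : (Fin d → ℤ) → ℝ) : L2 d →ₗ.[ℂ] L2 d where
  domain :=
    { carrier := {ψ | Memℓp (fun n => (ω n : ℂ) * ψ n) 2}
      add_mem' := by
        intro f g hf hg
        have h := Memℓp.add hf hg
        have e : (fun n => (ω n : ℂ) * (f + g : L2 d) n)
            = (fun n => (ω n : ℂ) * f n) + fun n => (ω n : ℂ) * g n := by
          funext n
          simp [mul_add]
        simpa only [Set.mem_ofPred_eq, e] using h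
      zero_mem' := by
        have e : (fun n => (ω n : ℂ) * (0 : L2 d) n) = 0 := by
          funext n
          simp
        simpa only [Set.mem_ofPred_eq, e] using
          (zero_memℓp : Memℓp (0 : (Fin d → ℤ) → ℂ) 2)
      smul_mem' := by
        intro c f hf
        have h := Memℓp.const_smul hf c
        have e : (fun n => (ω n : ℂ) * (c • f : L2 d) n)
            = c • fun n => (ω n : ℂ) * f n := by
          funext n
          simp [mul_left_comm]
        simpa only [Set.mem_ofPred_eq, e] using h }
  toFun :=
    { toFun := fun ψ => ⟨fun n => (ω n : ℂ) * (ψ : L2 d) n, ψ.2⟩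
      map_add' := by
        intro f g
        ext n
        exact mul_add _ _ _
      map_smul' := by
        intro c f
        ext n
        exact mul_left_comm _ _ _ }

/-- The Anderson Hamiltonian `H^ω = H₀ + ∑ⱼ ωⱼ Pⱼ` (unbounded if `ω` is). -/
noncomputable def hamiltonian {d : ℕ} (H0 : L2 d →L[ℂ] L2 d) (ω : (Fin d → ℤ) → ℝ) : L2 d →ₗ.[ℂ] L2 d :=
  (H0 : L2 d →ₗ[ℂ] L2 d) +ᵥ potential ω

/-- The law of the potential: independent coordinates with common distribution `μ`. -/
noncomputable abbrev law (d : ℕ) (μ : Measure ℝ) : Measure ((Fin d → ℤ) → ℝ) :=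
  Measure.infinitePi fun _ : Fin d → ℤ => μ

/-- `μ` is uniformly `α`-Hölder continuous. -/
def IsUniformlyHolder (α : ℝ) (μ : Measure ℝ) : Prop :=
  ∃ U : ℝ, ∀ a s : ℝ, 0 < s → μ (Set.Icc a (a + s)) ≤ ENNReal.ofReal (U * s ^ α)

/-! ### Finite volume operators -/

/-- The cube with lower corner `c` and `ℓ` lattice points along each side. -/
noncomputable def cube {d : ℕ} (c : Fin d → ℤ) (ℓ : ℕ) : Finset (Fin d → ℤ) :=
  Fintype.piFinset fun i => Finset.Ico (c i) (c i + ℓ)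

/-- The cube `Λ_L = {-L, …, L}ᵈ`. -/
noncomputable def box (d L : ℕ) : Finset (Fin d → ℤ) := cube (fun _ => -(L : ℤ)) (2 * L + 1)

/-- The matrix of the compression `H_Λ^ω` of `H^ω` to `ℓ²(Λ)`:
its entries are `⟨δ_n, H₀ δ_m⟩ + ω_n 1_{n = m}`. -/
noncomputable def finiteVolume {d : ℕ} (H0 : L2 d →L[ℂ] L2 d) (ω : (Fin d → ℤ) → ℝ)
    (Λ : Finset (Fin d → ℤ)) : Matrix Λ Λ ℂ :=
  Matrix.of (fun n m : Λ => inner ℂ (delta (n : Fin d → ℤ)) (H0 (delta (m : Fin d → ℤ))))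
    + Matrix.diagonal fun n : Λ => (ω n : ℂ)

theorem finiteVolume_isHermitian {d : ℕ} {H0 : L2 d →L[ℂ] L2 d} (hH0 : IsSelfAdjoint H0)
    (ω : (Fin d → ℤ) → ℝ) (Λ : Finset (Fin d → ℤ)) : (finiteVolume H0 ω Λ).IsHermitian := by
  refine Matrix.IsHermitian.add ?_ ?_
  · ext n m
    rw [Matrix.conjTranspose_apply, Matrix.of_apply, Matrix.of_apply, RCLike.star_def,
      inner_conj_symm, ← ContinuousLinearMap.adjoint_inner_right,
      ContinuousLinearMap.isSelfAdjoint_iff'.1 hH0]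
  · rw [Matrix.IsHermitian, Matrix.diagonal_conjTranspose]
    congr 1
    funext n
    simp

/-- The finite volume Green function `⟨δ_n, (H_Λ^ω - z)⁻¹ δ_m⟩`. -/
noncomputable def green {d : ℕ} (H0 : L2 d →L[ℂ] L2 d) (ω : (Fin d → ℤ) → ℝ)
    (Λ : Finset (Fin d → ℤ)) (z : ℂ) (n m : Λ) : ℂ :=
  (finiteVolume H0 ω Λ - z • (1 : Matrix Λ Λ ℂ))⁻¹ n m

/-- Exponential localization in `[a, b]`: a fractional moment of the Green functions of all
sufficiently large cubes decays exponentially, uniformly in the cube and in the spectral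
parameters `z` of the upper half plane with real part in `[a, b]`. -/
def FractionalMomentDecay {d : ℕ} (H0 : L2 d →L[ℂ] L2 d) (μ : Measure ℝ) (a b : ℝ) : Prop :=
  ∃ (s C γ : ℝ) (ℓ₀ : ℕ), 0 < s ∧ 0 < γ ∧
    ∀ (c : Fin d → ℤ) (ℓ : ℕ), ℓ₀ ≤ ℓ → ∀ n m : cube c ℓ,
      ∀ z : ℂ, 0 < z.im → z.re ∈ Set.Icc a b →
        ∫⁻ ω, ENNReal.ofReal (‖green H0 ω (cube c ℓ) z n m‖ ^ s) ∂(law d μ)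
          ≤ ENNReal.ofReal
              (C * Real.exp (-γ * ‖(n : Fin d → ℤ) - (m : Fin d → ℤ)‖))

/-- The scale `β_L = (2L+1)^{d/α}`. -/
noncomputable def scale (d : ℕ) (α : ℝ) (L : ℕ) : ℝ := (2 * (L : ℝ) + 1) ^ ((d : ℝ) / α)

/-- `ξ_{L,E}^ω(I)`: the trace of the spectral projection of `β_L (H_{Λ_L}^ω - E)` onto `I`, i.e.
the number of eigenvalues `λ` of `H_{Λ_L}^ω`, counted with multiplicity, such that
`β_L (λ - E) ∈ I`. -/
noncomputable def xi {d : ℕ} {H0 : L2 d →L[ℂ] L2 d} (hH0 : IsSelfAdjoint H0) (α E : ℝ) (L : ℕ)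
    (I : Set ℝ) (ω : (Fin d → ℤ) → ℝ) : ℕ :=
  Nat.card {i : box d L //
    scale d α L * ((finiteVolume_isHermitian hH0 ω (box d L)).eigenvalues i - E) ∈ I}

/-! ### The integrated density of states -/

/-- `ν` is the spectral measure `A ↦ ⟨ψ, E_H(A) ψ⟩` of the self-adjoint operator `H` at `ψ`: the
(unique) finite Borel measure with `⟨ψ, (H - z)⁻¹ ψ⟩ = ∫ (x - z)⁻¹ dν(x)` on the upper half
plane. -/
def IsSpectralMeasure {V : Type*} [NormedAddCommGroup V] [InnerProductSpace ℂ V]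
    (H : V →ₗ.[ℂ] V) (ψ : V) (ν : Measure ℝ) : Prop :=
  IsFiniteMeasure ν ∧ ∀ z : ℂ, 0 < z.im →
    ∃ φ : H.domain, H φ - z • (φ : V) = ψ ∧ inner ℂ ψ (φ : V) = ∫ x : ℝ, ((x : ℂ) - z)⁻¹ ∂ν

open Classical in
/-- The spectral measure `A ↦ ⟨ψ, E_H(A) ψ⟩` of a self-adjoint operator `H` at `ψ`. -/
noncomputable def spectralMeasure {V : Type*} [NormedAddCommGroup V] [InnerProductSpace ℂ V]
    (H : V →ₗ.[ℂ] V) (ψ : V) : Measure ℝ :=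
  if h : ∃ ν : Measure ℝ, IsSpectralMeasure H ψ ν then h.choose else 0

/-- The integrated density of states, as a set function:
`𝒩(A) = 𝔼 ⟨δ₀, E_{H^ω}(A) δ₀⟩`. -/
noncomputable def ids {d : ℕ} (H0 : L2 d →L[ℂ] L2 d) (μ : Measure ℝ) (A : Set ℝ) : ℝ≥0∞ :=
  ∫⁻ ω, spectralMeasure (hamiltonian H0 ω) (delta 0) A ∂(law d μ)

/-- The `α`-upper derivative
`D_𝒩^α(E) = limsup_{ε ↓ 0} 𝒩((E - ε, E + ε)) / (2ε)^α`. -/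
noncomputable def upperDerivative {d : ℕ} (H0 : L2 d →L[ℂ] L2 d) (μ : Measure ℝ) (α E : ℝ) :
    ℝ≥0∞ :=
  limsup (fun ε : ℝ =>
    ids H0 μ (Set.Ioo (E - ε) (E + ε)) / ENNReal.ofReal ((2 * ε) ^ α)) (𝓝[>] (0 : ℝ))

/-- The measure `ℒ_α(I) = α 2^{α-1} ∫_I |y|^{α-1} dy`. -/
noncomputable def ell (α : ℝ) (I : Set ℝ) : ℝ≥0∞ :=
  ENNReal.ofReal (α * 2 ^ (α - 1)) * ∫⁻ y in I, ENNReal.ofReal (|y| ^ (α - 1))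

end Anderson

set_option linter.unusedSectionVars false

namespace Anderson

/-! ### A Poisson limit theorem for triangular arrays -/

section PoissonLimit

open ProbabilityTheory

/-! Near E and at scale 1/β_L, the levels of the box are essentially the union of the levels of many
independent blocks. Each block carries a level with small probability and two levels with negligible
probability, so the law of rare events gives a Poisson limit. For I = (-c, c) the count is the
number of levels in (E - c/β_L, E + c/β_L). `tendstoInDistribution_poisson_of_array` reduces the
theorem to four limits: second factorial moments and squared means, summed over the blocks, tend to
0; the box count is close in L¹ to the sum of the block counts; the total mean converges.

The first two limits rest on local estimates. As a function of one coupling ω_n, Im G(n,n) is a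
Cauchy kernel of width at least Im z (`im_green_update`). Averaged over an α-Hölder law it is at
most K (Im z)^(α-1), which yields the Wegner bound 2K|Λ|r^α for the mean number of levels in (E - r,
E + r). Changing ω_n changes the count by at most one (`eigenCount_le_add_one`), and this upgrades
Wegner to a bound by its square for the second factorial moment (`exists_wegner_minami`). With q the
integer part of √(2L+1) there are q^d blocks of q^d sites, and both sums are O(q^(-d)).

For the third limit, counts are traded for traces of imaginary parts of resolvents. The indicator of
(-c, c) is approximated by combinations of Cauchy kernels centred at 0 (`exists_cauchy_approx`),
with an error whose mean is O(κ + κ^α) uniformly in L (`cauchyError_le`). Centring at 0 keeps the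
spectral parameters of the main term on the line Re z = E, where localization is available; kernels
centred at E ± c/β_L occur only in the error, where Wegner suffices. Localization makes the Green
functions of box and block agree, at sites deep inside the block, up to a power of L times exp(-γ ·
depth), and the depth itself grows at least like L^(1/4). The remaining sites are a vanishing
fraction of the box and are handled by Wegner.

The same comparison with the infinite volume turns the total mean into (2L+1)^d 𝒩((E - c/β_L, E +
c/β_L)). The spectral measure enters only through its Cauchy transform, which is a limit of finite
volume Green functions (`tendsto_im_green`). Since the radii c/β_L tend to 0 with consecutive ratios
tending to 1, the upper derivative is a cluster point along them (`mapClusterPt_limsup_of_ratio`).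
This selects the subsequence and gives the limit D (2c)^α = D ℒ_α(I). -/

theorem tendsto_probabilityMeasure_nat_of_map_cast {ν : ℕ → ProbabilityMeasure ℕ}
    {ν₀ : ProbabilityMeasure ℕ}
    (h : ∀ t : ℝ, Tendsto (fun n => charFun ((ν n : Measure ℕ).map (Nat.cast : ℕ → ℝ)) t) atTop
      (𝓝 (charFun ((ν₀ : Measure ℕ).map (Nat.cast : ℕ → ℝ)) t))) :
    Tendsto ν atTop (𝓝 ν₀) := by
  have hm : ∀ κ : ProbabilityMeasure ℕ, AEMeasurable (Nat.cast : ℕ → ℝ) (κ : Measure ℕ) :=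
    fun κ => .of_discrete
  have key : Tendsto (fun n => (ν n).map (hm (ν n))) atTop (𝓝 (ν₀.map (hm ν₀))) :=
    ProbabilityMeasure.tendsto_of_tendsto_charFun h
  rw [ProbabilityMeasure.tendsto_iff_forall_integral_tendsto] at key ⊢
  intro f
  -- By Tietze every bounded function on ℕ extends to a test function on ℝ, so weak convergence of
  -- the pushforwards pulls back to ℕ.
  obtain ⟨g, -, hg⟩ := BoundedContinuousFunction.exists_extension_norm_eq_of_isClosedEmbedding f
    Nat.isClosedEmbedding_coe_real
  have e : ∀ κ : ProbabilityMeasure ℕ,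
      ∫ x, g x ∂(κ.map (hm κ) : ProbabilityMeasure ℝ) = ∫ x, f x ∂(κ : Measure ℕ) := by
    intro κ
    rw [ProbabilityMeasure.toMeasure_map, integral_map (hm κ) g.continuous.aestronglyMeasurable]
    exact integral_congr_ae (.of_forall fun x => congrFun hg x)
  simpa only [e] using key g

variable {Ω : Type*} [MeasurableSpace Ω] {P : Measure Ω} [IsProbabilityMeasure P]

theorem tendstoInDistribution_poissonMeasure {Y : ℕ → Ω → ℕ} (hY : ∀ n, Measurable (Y n)) {r : ℝ≥0}
    (h : ∀ t : ℝ, Tendsto (fun n => ∫ ω, Complex.exp (t * Y n ω * Complex.I) ∂P) atTop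
      (𝓝 (Complex.exp (r * (Complex.exp (t * Complex.I) - 1))))) :
    TendstoInDistribution Y atTop (id : ℕ → ℕ) (fun _ => P) (poissonMeasure r) where
  forall_aemeasurable n := (hY n).aemeasurable
  aemeasurable_limit := aemeasurable_id
  tendsto := by
    refine tendsto_probabilityMeasure_nat_of_map_cast fun t => ?_
    have e := charFun_map_cast_poissonMeasure r t
    simp only [ProbabilityMeasure.coe_mk, Measure.map_id, e]
    refine (h t).congr fun n => ?_
    rw [Measure.map_map (by fun_prop) (hY n), charFun_apply_real, integral_map
      (by have := hY n; fun_prop) (by fun_prop)]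
    simp

theorem norm_exp_sub_one_sub_le {u : ℂ} (hu : u.re ≤ 0) :
    ‖Complex.exp u - 1 - u‖ ≤ 3 * ‖u‖ ^ 2 := by
  rcases le_or_gt ‖u‖ 1 with h | h
  · exact (Complex.norm_exp_sub_one_sub_id_le h).trans (by nlinarith [sq_nonneg ‖u‖])
  · have h1 : ‖Complex.exp u‖ ≤ 1 := by
      rw [Complex.norm_exp]; exact Real.exp_le_one_iff.2 hu
    calc ‖Complex.exp u - 1 - u‖ ≤ ‖Complex.exp u‖ + ‖(1 : ℂ)‖ + ‖u‖ :=
          (norm_sub_le _ _).trans (by gcongr; exact norm_sub_le _ _)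
      _ ≤ 3 * ‖u‖ ^ 2 := by rw [norm_one]; nlinarith

theorem re_exp_mul_I_sub_one_nonpos (t : ℝ) : (Complex.exp (t * Complex.I) - 1).re ≤ 0 := by
  have := Complex.re_le_norm (Complex.exp (t * Complex.I))
  rw [Complex.norm_exp_ofReal_mul_I] at this
  simpa using this

theorem norm_exp_mul_I_sub_one_le_two (t : ℝ) : ‖Complex.exp (t * Complex.I) - 1‖ ≤ 2 := by
  refine (norm_sub_le _ _).trans ?_
  rw [Complex.norm_exp_ofReal_mul_I, norm_one]; norm_num

/-- The left side vanishes for k = 0 and k = 1, and for k ≥ 2 it is at most 2 + 2k. This is how the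
second factorial moment enters the Poisson limit. -/
theorem norm_exp_nat_mul_I_sub_le (t : ℝ) (k : ℕ) :
    ‖Complex.exp (t * k * Complex.I) - 1 - k * (Complex.exp (t * Complex.I) - 1)‖
      ≤ 3 * ((k : ℝ) * (k - 1)) := by
  rcases Nat.lt_or_ge k 2 with h | h
  · interval_cases k <;> simp
  · have hk : (2 : ℝ) ≤ k := by exact_mod_cast h
    have h1 : ‖Complex.exp (t * k * Complex.I)‖ = 1 := by
      rw [← Complex.norm_exp_ofReal_mul_I (t * k)]; push_cast; rfl
    calc _ ≤ ‖Complex.exp (t * k * Complex.I)‖ + ‖(1 : ℂ)‖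
          + ‖(k : ℂ) * (Complex.exp (t * Complex.I) - 1)‖ :=
          (norm_sub_le _ _).trans (by gcongr; exact norm_sub_le _ _)
      _ ≤ 1 + 1 + k * 2 := by
          rw [h1, norm_one, norm_mul, Complex.norm_natCast]
          gcongr; exact norm_exp_mul_I_sub_one_le_two t
      _ ≤ _ := by nlinarith

/-- Both terms are compared with 1 + m w, where m is the mean and w = exp(it) - 1. The constant 12
is 3 times the square of the bound |w| ≤ 2. -/
theorem norm_integral_exp_sub_le {X : Ω → ℕ} (hX : Measurable X) {B : ℕ} (hB : ∀ ω, X ω ≤ B)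
    (t : ℝ) :
    ‖∫ ω, Complex.exp (t * X ω * Complex.I) ∂P
        - Complex.exp ((∫ ω, (X ω : ℝ) ∂P : ℝ) * (Complex.exp (t * Complex.I) - 1))‖
      ≤ 3 * (∫ ω, (X ω : ℝ) * (X ω - 1) ∂P) + 12 * (∫ ω, (X ω : ℝ) ∂P) ^ 2 := by
  set w := Complex.exp (t * Complex.I) - 1 with hw
  set m := ∫ ω, (X ω : ℝ) ∂P with hm
  have hm0 : 0 ≤ m := integral_nonneg fun _ => by positivity
  have bd : ∀ f : ℕ → ℝ, Integrable (fun ω => f (X ω)) P := fun f =>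
    .of_bound (by fun_prop : AEStronglyMeasurable _ P) (∑ i ∈ Finset.range (B + 1), ‖f i‖)
      (.of_forall fun ω => Finset.single_le_sum (f := fun i => ‖f i‖) (fun _ _ => norm_nonneg _)
        (Finset.mem_range.2 (Nat.lt_succ_of_le (hB ω))))
  have bdc : ∀ f : ℕ → ℂ, Integrable (fun ω => f (X ω)) P := fun f =>
    .of_bound (by fun_prop : AEStronglyMeasurable _ P) (∑ i ∈ Finset.range (B + 1), ‖f i‖)
      (.of_forall fun ω => Finset.single_le_sum (f := fun i => ‖f i‖) (fun _ _ => norm_nonneg _)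
        (Finset.mem_range.2 (Nat.lt_succ_of_le (hB ω))))
  have e1 : ∫ ω, (Complex.exp (t * X ω * Complex.I) - 1 - X ω * w) ∂P
      = ∫ ω, Complex.exp (t * X ω * Complex.I) ∂P - 1 - m * w := by
    rw [integral_sub, integral_sub, integral_mul_const, hm, ← integral_complex_ofReal]
    · simp
    · exact bdc fun k => Complex.exp (t * k * Complex.I)
    · exact bdc fun k => 1
    · exact bdc fun k => Complex.exp (t * k * Complex.I) - 1
    · exact bdc fun k => k * w
  have h1 : ‖∫ ω, Complex.exp (t * X ω * Complex.I) ∂P - 1 - m * w‖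
      ≤ 3 * ∫ ω, (X ω : ℝ) * (X ω - 1) ∂P := by
    rw [← e1, ← integral_const_mul]
    exact norm_integral_le_of_norm_le (bd fun k => 3 * ((k : ℝ) * (k - 1)))
      (.of_forall fun ω => norm_exp_nat_mul_I_sub_le t (X ω))
  have h2 : ‖Complex.exp (m * w) - 1 - m * w‖ ≤ 12 * m ^ 2 := by
    refine (norm_exp_sub_one_sub_le ?_).trans ?_
    · rw [Complex.re_ofReal_mul]
      exact mul_nonpos_of_nonneg_of_nonpos hm0 (re_exp_mul_I_sub_one_nonpos t)
    · rw [norm_mul, mul_pow, Complex.norm_real, Real.norm_eq_abs, sq_abs]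
      have := norm_exp_mul_I_sub_one_le_two t
      have : ‖w‖ ^ 2 ≤ 2 ^ 2 := by gcongr
      nlinarith [sq_nonneg m]
  calc _ = ‖(∫ ω, Complex.exp (t * X ω * Complex.I) ∂P - 1 - m * w)
        - (Complex.exp (m * w) - 1 - m * w)‖ := by congr 1; ring
    _ ≤ _ := (norm_sub_le _ _).trans (add_le_add h1 h2)

theorem norm_prod_sub_prod_le_sum {ι : Type*} (s : Finset ι) {f g : ι → ℂ} (hf : ∀ i, ‖f i‖ ≤ 1)
    (hg : ∀ i, ‖g i‖ ≤ 1) : ‖∏ i ∈ s, f i - ∏ i ∈ s, g i‖ ≤ ∑ i ∈ s, ‖f i - g i‖ := by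
  classical
  induction s using Finset.induction_on with
  | empty => simp
  | insert a s ha ih =>
    rw [Finset.prod_insert ha, Finset.prod_insert ha, Finset.sum_insert ha]
    have h1 : ‖∏ i ∈ s, g i‖ ≤ 1 := by
      rw [norm_prod]; exact Finset.prod_le_one (fun _ _ => norm_nonneg _) fun i _ => hg i
    calc _ = ‖(f a - g a) * ∏ i ∈ s, g i + f a * (∏ i ∈ s, f i - ∏ i ∈ s, g i)‖ := by
          congr 1; ring
      _ ≤ ‖f a - g a‖ * 1 + 1 * ∑ i ∈ s, ‖f i - g i‖ := by
          refine (norm_add_le _ _).trans ?_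
          rw [norm_mul, norm_mul]
          gcongr
          exact hf a
      _ = _ := by ring

theorem norm_exp_mul_I_sub_exp_mul_I_le (x y : ℝ) :
    ‖Complex.exp (x * Complex.I) - Complex.exp (y * Complex.I)‖ ≤ |x - y| := by
  have h : Complex.exp (x * Complex.I) - Complex.exp (y * Complex.I)
      = Complex.exp (y * Complex.I) * (Complex.exp (Complex.I * ((x - y : ℝ) : ℂ)) - 1) := by
    rw [mul_sub, ← Complex.exp_add, mul_one]; push_cast; ring_nf
  rw [h, norm_mul, Complex.norm_exp_ofReal_mul_I, one_mul]
  exact Real.norm_exp_I_mul_ofReal_sub_one_le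

/-- If `Y n` is close in mean to a sum of independent counting variables `X n p` whose means add
up to `r` in the limit, whose factorial second moments are negligible and which are uniformly
asymptotically negligible, then `Y n` converges to a Poisson variable of parameter `r`. -/
theorem tendstoInDistribution_poisson_of_array {ι : ℕ → Type*} [∀ n, Fintype (ι n)]
    {X : ∀ n, ι n → Ω → ℕ} {Y : ℕ → Ω → ℕ} (hX : ∀ n p, Measurable (X n p))
    (hY : ∀ n, Measurable (Y n)) {B : ℕ → ℕ} (hB : ∀ n p ω, X n p ω ≤ B n)
    (hBY : ∀ n ω, Y n ω ≤ B n) (hind : ∀ n, iIndepFun (X n) P) {r : ℝ≥0}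
    (h1 : Tendsto (fun n => ∑ p, ∫ ω, (X n p ω : ℝ) ∂P) atTop (𝓝 r))
    (h2 : Tendsto (fun n => ∑ p, ∫ ω, (X n p ω : ℝ) * (X n p ω - 1) ∂P) atTop (𝓝 0))
    (h3 : Tendsto (fun n => ∑ p, (∫ ω, (X n p ω : ℝ) ∂P) ^ 2) atTop (𝓝 0))
    (h4 : Tendsto (fun n => ∫ ω, |(Y n ω : ℝ) - ∑ p, (X n p ω : ℝ)| ∂P) atTop (𝓝 0)) :
    TendstoInDistribution Y atTop (id : ℕ → ℕ) (fun _ => P) (poissonMeasure r) := by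
  refine tendstoInDistribution_poissonMeasure hY fun t => ?_
  set w := Complex.exp (t * Complex.I) - 1 with hw
  set m : ∀ n, ι n → ℝ := fun n p => ∫ ω, (X n p ω : ℝ) ∂P with hm
  have hm0 : ∀ n p, 0 ≤ m n p := fun n p => integral_nonneg fun _ => by positivity
  have hlim : Tendsto (fun n => Complex.exp ((∑ p, m n p : ℝ) * w)) atTop
      (𝓝 (Complex.exp (r * w))) := by
    refine (Complex.continuous_exp.tendsto _).comp (Tendsto.mul_const _ ?_)
    exact (Complex.continuous_ofReal.tendsto _).comp h1
  have hbd : ∀ n, ‖∫ ω, Complex.exp (t * Y n ω * Complex.I) ∂P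
      - Complex.exp ((∑ p, m n p : ℝ) * w)‖
      ≤ |t| * (∫ ω, |(Y n ω : ℝ) - ∑ p, (X n p ω : ℝ)| ∂P)
        + (3 * (∑ p, ∫ ω, (X n p ω : ℝ) * (X n p ω - 1) ∂P) + 12 * ∑ p, (m n p) ^ 2) := by
    intro n
    have hcf : ∀ {f : Ω → ℝ}, Measurable f → Integrable (fun ω => Complex.exp (f ω * Complex.I)) P :=
      fun {f} hf => .of_bound (by fun_prop) 1
        (.of_forall fun ω => (Complex.norm_exp_ofReal_mul_I _).le)
    have hS : Measurable fun ω => ∑ p, (X n p ω : ℝ) :=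
      Finset.measurable_sum _ fun p _ => measurable_from_top.comp (hX n p)
    have hYr : Measurable fun ω => (Y n ω : ℝ) := measurable_from_top.comp (hY n)
    have hSb : ∀ ω, |(Y n ω : ℝ) - ∑ p, (X n p ω : ℝ)| ≤ B n + Fintype.card (ι n) * B n := by
      intro ω
      have a1 : (Y n ω : ℝ) ≤ B n := by exact_mod_cast hBY n ω
      have a2 : ∑ p, (X n p ω : ℝ) ≤ Fintype.card (ι n) * B n := by
        refine (Finset.sum_le_card_nsmul _ _ (B n : ℝ) fun p _ => ?_).trans (by simp)
        exact_mod_cast hB n p ω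
      have a3 : 0 ≤ ∑ p, (X n p ω : ℝ) := by positivity
      have a4 : (0 : ℝ) ≤ Y n ω := by positivity
      rw [abs_le]; constructor <;> linarith
    have s1 : ‖∫ ω, Complex.exp (t * Y n ω * Complex.I) ∂P
        - ∫ ω, Complex.exp ((t * ∑ p, (X n p ω : ℝ) : ℝ) * Complex.I) ∂P‖
        ≤ |t| * ∫ ω, |(Y n ω : ℝ) - ∑ p, (X n p ω : ℝ)| ∂P := by
      have e : ∀ ω, Complex.exp (t * Y n ω * Complex.I)
          = Complex.exp ((t * Y n ω : ℝ) * Complex.I) := fun ω => by push_cast; rfl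
      simp only [e]
      rw [← integral_sub (hcf (hYr.const_mul t)) (hcf (hS.const_mul t)), ← integral_const_mul]
      refine norm_integral_le_of_norm_le ?_ (.of_forall fun ω => ?_)
      · exact (Integrable.of_bound (by fun_prop) _ (.of_forall fun ω => by
          rw [Real.norm_eq_abs, abs_abs]; exact hSb ω)).const_mul _
      · refine (norm_exp_mul_I_sub_exp_mul_I_le _ _).trans (le_of_eq ?_)
        rw [← mul_sub, abs_mul]
    have s2 : ∫ ω, Complex.exp ((t * ∑ p, (X n p ω : ℝ) : ℝ) * Complex.I) ∂P
        = ∏ p, ∫ ω, Complex.exp (t * X n p ω * Complex.I) ∂P := by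
      have hi : iIndepFun (fun p ω => Complex.exp (t * X n p ω * Complex.I)) P :=
        (hind n).comp (fun _ k => Complex.exp (t * (k : ℂ) * Complex.I))
          fun _ => measurable_from_top
      rw [← hi.integral_fun_prod_eq_prod_integral fun p =>
        (measurable_from_top.comp (hX n p) : Measurable
          ((fun k : ℕ => Complex.exp (t * (k : ℂ) * Complex.I)) ∘ X n p)).aestronglyMeasurable]
      congr 1; funext ω
      rw [← Complex.exp_sum]
      congr 1; push_cast
      rw [Finset.mul_sum, Finset.sum_mul]
    have s3 : Complex.exp ((∑ p, m n p : ℝ) * w) = ∏ p, Complex.exp (m n p * w) := by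
      rw [← Complex.exp_sum]; push_cast; rw [Finset.sum_mul]
    have s4 : ‖∏ p, ∫ ω, Complex.exp (t * X n p ω * Complex.I) ∂P - ∏ p, Complex.exp (m n p * w)‖
        ≤ 3 * (∑ p, ∫ ω, (X n p ω : ℝ) * (X n p ω - 1) ∂P) + 12 * ∑ p, (m n p) ^ 2 := by
      refine (norm_prod_sub_prod_le_sum _ (fun p => ?_) fun p => ?_).trans ?_
      · refine (norm_integral_le_of_norm_le (integrable_const (1 : ℝ))
          (.of_forall fun ω => le_of_eq ?_)).trans (by simp)
        rw [← Complex.norm_exp_ofReal_mul_I (t * X n p ω)]; push_cast; rfl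
      · rw [Complex.norm_exp, Real.exp_le_one_iff, Complex.re_ofReal_mul]
        exact mul_nonpos_of_nonneg_of_nonpos (hm0 n p) (re_exp_mul_I_sub_one_nonpos t)
      · rw [Finset.mul_sum, Finset.mul_sum, ← Finset.sum_add_distrib]
        exact Finset.sum_le_sum fun p _ => norm_integral_exp_sub_le (hX n p) (hB n p) t
    rw [s2] at s1
    rw [s3]
    calc _ ≤ _ := norm_sub_le_norm_sub_add_norm_sub _ _ _
      _ ≤ _ := add_le_add s1 s4
  have hz : Tendsto (fun n => |t| * (∫ ω, |(Y n ω : ℝ) - ∑ p, (X n p ω : ℝ)| ∂P)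
        + (3 * (∑ p, ∫ ω, (X n p ω : ℝ) * (X n p ω - 1) ∂P) + 12 * ∑ p, (m n p) ^ 2))
      atTop (𝓝 0) := by
    simpa using (h4.const_mul |t|).add ((h2.const_mul 3).add (h3.const_mul 12))
  have := (squeeze_zero_norm hbd hz).add hlim
  simpa using this

end PoissonLimit

/-! ### Resolvents of Hermitian matrices -/

section Resolvent

open Matrix

variable {ι : Type*} [Fintype ι] [DecidableEq ι] {A : Matrix ι ι ℂ}

/-- The resolvent `(A - z)⁻¹`. -/
noncomputable abbrev resolventMatrix (A : Matrix ι ι ℂ) (z : ℂ) : Matrix ι ι ℂ :=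
  (A - z • (1 : Matrix ι ι ℂ))⁻¹

theorem ofReal_sub_ne_zero {z : ℂ} (hz : 0 < z.im) (x : ℝ) : (x : ℂ) - z ≠ 0 := fun h => by
  have := congrArg Complex.im h
  simp at this
  exact hz.ne' this

theorem im_inv_ofReal_sub (x : ℝ) (z : ℂ) :
    (((x : ℂ) - z)⁻¹).im = z.im / ((x - z.re) ^ 2 + z.im ^ 2) := by
  rw [Complex.inv_im, Complex.normSq_apply]
  simp [sq]

theorem eq_eigenvector_conj (hA : A.IsHermitian) :
    A = (hA.eigenvectorUnitary : Matrix ι ι ℂ) * diagonal (fun i => (hA.eigenvalues i : ℂ))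
      * star (hA.eigenvectorUnitary : Matrix ι ι ℂ) :=
  hA.spectral_theorem.trans (Unitary.conjStarAlgAut_apply _ _)

theorem resolventMatrix_eq (hA : A.IsHermitian) {z : ℂ} (hz : 0 < z.im) :
    (A - z • (1 : Matrix ι ι ℂ)) * ((hA.eigenvectorUnitary : Matrix ι ι ℂ)
        * diagonal (fun i => ((hA.eigenvalues i : ℂ) - z)⁻¹)
        * star (hA.eigenvectorUnitary : Matrix ι ι ℂ)) = 1 := by
  set U : Matrix ι ι ℂ := (hA.eigenvectorUnitary : Matrix ι ι ℂ) with hU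
  have h1 : star U * U = 1 := Unitary.coe_star_mul_self _
  have h2 : U * star U = 1 := Unitary.coe_mul_star_self _
  have e : A - z • (1 : Matrix ι ι ℂ)
      = U * diagonal (fun i => (hA.eigenvalues i : ℂ) - z) * star U := by
    have : diagonal (fun i => (hA.eigenvalues i : ℂ) - z)
        = diagonal (fun i => (hA.eigenvalues i : ℂ)) - z • (1 : Matrix ι ι ℂ) := by
      rw [← diagonal_one, ← diagonal_smul, diagonal_sub]
      congr 1; funext i; simp
    rw [this, mul_sub, sub_mul, ← eq_eigenvector_conj hA, mul_smul_comm, smul_mul_assoc, mul_one, h2]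
  have h3 : diagonal (fun i => (hA.eigenvalues i : ℂ) - z)
      * diagonal (fun i => ((hA.eigenvalues i : ℂ) - z)⁻¹) = 1 := by
    rw [diagonal_mul_diagonal, ← diagonal_one]
    congr 1; funext i
    exact mul_inv_cancel₀ (ofReal_sub_ne_zero hz _)
  rw [e]
  calc _ = U * diagonal (fun i => (hA.eigenvalues i : ℂ) - z) * (star U * U)
        * diagonal (fun i => ((hA.eigenvalues i : ℂ) - z)⁻¹) * star U := by
        simp only [mul_assoc]
    _ = U * (diagonal (fun i => (hA.eigenvalues i : ℂ) - z)
        * diagonal (fun i => ((hA.eigenvalues i : ℂ) - z)⁻¹)) * star U := by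
        rw [h1]; simp only [mul_assoc, mul_one]
    _ = 1 := by rw [h3, mul_one, h2]

theorem sub_mul_resolventMatrix (hA : A.IsHermitian) {z : ℂ} (hz : 0 < z.im) :
    (A - z • (1 : Matrix ι ι ℂ)) * resolventMatrix A z = 1 := by
  have h := resolventMatrix_eq hA hz
  rwa [← Matrix.inv_eq_right_inv h] at h

theorem resolventMatrix_mul_sub (hA : A.IsHermitian) {z : ℂ} (hz : 0 < z.im) :
    resolventMatrix A z * (A - z • (1 : Matrix ι ι ℂ)) = 1 :=
  mul_eq_one_comm.1 (sub_mul_resolventMatrix hA hz)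

theorem det_sub_ne_zero (hA : A.IsHermitian) {z : ℂ} (hz : 0 < z.im) :
    (A - z • (1 : Matrix ι ι ℂ)).det ≠ 0 := fun h => by
  have := congrArg Matrix.det (sub_mul_resolventMatrix hA hz)
  rw [Matrix.det_mul, h] at this
  simp at this

/-- The weight of the `i`-th eigenvector at the site `n`. -/
noncomputable def eigenWeight (hA : A.IsHermitian) (n i : ι) : ℝ :=
  ‖(hA.eigenvectorUnitary : Matrix ι ι ℂ) n i‖ ^ 2

theorem eigenWeight_nonneg (hA : A.IsHermitian) (n i : ι) : 0 ≤ eigenWeight hA n i :=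
  sq_nonneg _

theorem resolventMatrix_diag (hA : A.IsHermitian) {z : ℂ} (hz : 0 < z.im) (n : ι) :
    resolventMatrix A z n n
      = ∑ i, (eigenWeight hA n i : ℂ) * ((hA.eigenvalues i : ℂ) - z)⁻¹ := by
  rw [resolventMatrix, Matrix.inv_eq_right_inv (resolventMatrix_eq hA hz), Matrix.mul_apply]
  refine Finset.sum_congr rfl fun i _ => ?_
  rw [Matrix.mul_diagonal, Matrix.star_apply, mul_right_comm]
  congr 1
  rw [eigenWeight, ← Complex.normSq_eq_norm_sq, Complex.normSq_eq_conj_mul_self, mul_comm]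
  rfl

theorem sum_eigenWeight_site (hA : A.IsHermitian) (i : ι) : ∑ n, eigenWeight hA n i = 1 := by
  have h : star (hA.eigenvectorUnitary : Matrix ι ι ℂ) * (hA.eigenvectorUnitary : Matrix ι ι ℂ) = 1 :=
    Unitary.coe_star_mul_self _
  have h2 := congrFun (congrFun h i) i
  rw [Matrix.mul_apply, Matrix.one_apply_eq] at h2
  have : ((∑ n, eigenWeight hA n i : ℝ) : ℂ) = 1 := by
    rw [← h2]; push_cast
    refine Finset.sum_congr rfl fun n _ => ?_
    rw [eigenWeight, ← Complex.normSq_eq_norm_sq, Complex.normSq_eq_conj_mul_self,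
      Matrix.star_apply]
    rfl
  exact_mod_cast this

theorem sum_eigenWeight (hA : A.IsHermitian) (n : ι) : ∑ i, eigenWeight hA n i = 1 := by
  have h : (hA.eigenvectorUnitary : Matrix ι ι ℂ) * star (hA.eigenvectorUnitary : Matrix ι ι ℂ) = 1 :=
    Unitary.coe_mul_star_self _
  have h2 := congrFun (congrFun h n) n
  rw [Matrix.mul_apply, Matrix.one_apply_eq] at h2
  have : ((∑ i, eigenWeight hA n i : ℝ) : ℂ) = 1 := by
    rw [← h2]; push_cast
    refine Finset.sum_congr rfl fun i _ => ?_
    rw [eigenWeight, ← Complex.normSq_eq_norm_sq, Complex.normSq_eq_conj_mul_self,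
      Matrix.star_apply, mul_comm]
    rfl
  exact_mod_cast this

/-- Both sides are the entry (n, n) of A². The second moment of the spectral measure at n is thereby
controlled by one column of A, which later gives tightness. -/
theorem sum_eigenWeight_mul_sq (hA : A.IsHermitian) (n : ι) :
    ∑ i, eigenWeight hA n i * hA.eigenvalues i ^ 2 = ∑ m, ‖A m n‖ ^ 2 := by
  set U : Matrix ι ι ℂ := (hA.eigenvectorUnitary : Matrix ι ι ℂ) with hU
  have h1 : star U * U = 1 := Unitary.coe_star_mul_self _
  have hsq : A * A = U * diagonal (fun i => (hA.eigenvalues i : ℂ) ^ 2) * star U := by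
    have e := eq_eigenvector_conj hA
    calc A * A = U * diagonal (fun i => (hA.eigenvalues i : ℂ)) * (star U * U)
          * diagonal (fun i => (hA.eigenvalues i : ℂ)) * star U := by
          conv_lhs => rw [e]
          simp only [mul_assoc, hU]
      _ = U * (diagonal (fun i => (hA.eigenvalues i : ℂ))
          * diagonal (fun i => (hA.eigenvalues i : ℂ))) * star U := by
          rw [h1]; simp only [mul_assoc, mul_one]
      _ = _ := by rw [diagonal_mul_diagonal]; simp only [sq]
  have h2 := congrFun (congrFun hsq n) n
  rw [Matrix.mul_apply, Matrix.mul_apply] at h2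
  have : ((∑ i, eigenWeight hA n i * hA.eigenvalues i ^ 2 : ℝ) : ℂ)
      = ((∑ m, ‖A m n‖ ^ 2 : ℝ) : ℂ) := by
    push_cast
    refine Eq.trans (Finset.sum_congr rfl fun i _ => ?_) (h2.symm.trans
      (Finset.sum_congr rfl fun m _ => ?_))
    · rw [Matrix.mul_diagonal, Matrix.star_apply, mul_right_comm]
      congr 1
      rw [eigenWeight, ← Complex.normSq_eq_norm_sq, Complex.normSq_eq_conj_mul_self, mul_comm]
      rfl
    · rw [← Complex.ofReal_pow, ← Complex.normSq_eq_norm_sq, Complex.normSq_eq_conj_mul_self]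
      congr 1
      exact (hA.apply n m).symm
  exact_mod_cast this

theorem im_resolventMatrix_diag (hA : A.IsHermitian) {z : ℂ} (hz : 0 < z.im) (n : ι) :
    (resolventMatrix A z n n).im
      = ∑ i, eigenWeight hA n i * (z.im / ((hA.eigenvalues i - z.re) ^ 2 + z.im ^ 2)) := by
  rw [resolventMatrix_diag hA hz, Complex.im_sum]
  refine Finset.sum_congr rfl fun i _ => ?_
  rw [Complex.im_ofReal_mul, im_inv_ofReal_sub]

theorem im_resolventMatrix_diag_nonneg (hA : A.IsHermitian) {z : ℂ} (hz : 0 < z.im) (n : ι) :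
    0 ≤ (resolventMatrix A z n n).im := by
  rw [im_resolventMatrix_diag hA hz]
  exact Finset.sum_nonneg fun i _ => mul_nonneg (eigenWeight_nonneg _ _ _) (by positivity)

theorem sum_im_resolventMatrix_diag (hA : A.IsHermitian) {z : ℂ} (hz : 0 < z.im) :
    ∑ n, (resolventMatrix A z n n).im
      = ∑ i, z.im / ((hA.eigenvalues i - z.re) ^ 2 + z.im ^ 2) := by
  simp only [im_resolventMatrix_diag hA hz]
  rw [Finset.sum_comm]
  refine Finset.sum_congr rfl fun i _ => ?_
  rw [← Finset.sum_mul, sum_eigenWeight_site, one_mul]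

theorem mul_mul_sub_mul_mul {R : Type*} [Ring R] (a b x y : R) :
    a * x * b - a * (y * b) = a * (x - y) * b := by
  rw [mul_sub, sub_mul, mul_assoc a y]

/-- The Ward identity. -/
theorem im_resolventMatrix_eq_mul_sum (hA : A.IsHermitian) {z : ℂ} (hz : 0 < z.im) (m : ι) :
    (resolventMatrix A z m m).im = z.im * ∑ n, ‖resolventMatrix A z n m‖ ^ 2 := by
  set R := resolventMatrix A z with hR
  have h1 : (A - z • (1 : Matrix ι ι ℂ)) * R = 1 := sub_mul_resolventMatrix hA hz
  have h2 : Rᴴ * (A - star z • (1 : Matrix ι ι ℂ)) = 1 := by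
    have := congrArg conjTranspose h1
    rw [conjTranspose_mul, conjTranspose_sub, hA.eq, conjTranspose_smul, conjTranspose_one] at this
    exact this
  have h3 : R - Rᴴ = (z - star z) • (Rᴴ * R) := by
    calc R - Rᴴ = Rᴴ * (A - star z • (1 : Matrix ι ι ℂ)) * R
          - Rᴴ * ((A - z • (1 : Matrix ι ι ℂ)) * R) := by rw [h1, h2, one_mul, mul_one]
      _ = Rᴴ * ((A - star z • (1 : Matrix ι ι ℂ)) - (A - z • (1 : Matrix ι ι ℂ))) * R := by
          rw [mul_mul_sub_mul_mul]
      _ = Rᴴ * ((z - star z) • (1 : Matrix ι ι ℂ)) * R := by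
          congr 2; rw [sub_smul]; abel
      _ = _ := by rw [mul_smul_comm, smul_mul_assoc, mul_one]
  have h4 := congrArg Complex.im (congrFun (congrFun h3 m) m)
  have h5 : (Rᴴ * R) m m = ((∑ n, ‖R n m‖ ^ 2 : ℝ) : ℂ) := by
    rw [Matrix.mul_apply]; push_cast
    refine Finset.sum_congr rfl fun n _ => ?_
    rw [← Complex.ofReal_pow, ← Complex.normSq_eq_norm_sq, Complex.normSq_eq_conj_mul_self]
    rfl
  rw [Matrix.sub_apply, Matrix.smul_apply, h5, smul_eq_mul, Complex.im_mul_ofReal,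
    conjTranspose_apply] at h4
  simp only [RCLike.star_def, Complex.sub_im, Complex.conj_im] at h4
  linarith

/-- If S is the sum, the Ward identity gives Im z · S ≤ |R m m| ≤ √S. -/
theorem sum_norm_resolventMatrix_sq_le (hA : A.IsHermitian) {z : ℂ} (hz : 0 < z.im) (m : ι) :
    ∑ n, ‖resolventMatrix A z n m‖ ^ 2 ≤ (1 / z.im) ^ 2 := by
  have h0 : 0 ≤ ∑ n, ‖resolventMatrix A z n m‖ ^ 2 := Finset.sum_nonneg fun _ _ => sq_nonneg _
  have h1 : ‖resolventMatrix A z m m‖ ^ 2 ≤ ∑ n, ‖resolventMatrix A z n m‖ ^ 2 :=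
    Finset.single_le_sum (f := fun n => ‖resolventMatrix A z n m‖ ^ 2) (fun _ _ => sq_nonneg _)
      (Finset.mem_univ m)
  have h2 : z.im * ∑ n, ‖resolventMatrix A z n m‖ ^ 2 ≤ ‖resolventMatrix A z m m‖ := by
    rw [← im_resolventMatrix_eq_mul_sum hA hz]
    exact (le_abs_self _).trans (Complex.abs_im_le_norm _)
  generalize ∑ n, ‖resolventMatrix A z n m‖ ^ 2 = S at h0 h1 h2 ⊢
  generalize ‖resolventMatrix A z m m‖ = g at h1 h2
  have h3 : (z.im * S) ^ 2 ≤ S := (pow_le_pow_left₀ (mul_nonneg hz.le h0) h2 2).trans h1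
  rcases h0.eq_or_lt with h | h
  · rw [← h]; positivity
  · rw [div_pow, one_pow, le_div_iff₀ (by positivity)]
    refine le_of_mul_le_mul_right ?_ h
    linarith [h3, mul_pow z.im S 2, sq S]

theorem norm_resolventMatrix_le (hA : A.IsHermitian) {z : ℂ} (hz : 0 < z.im) (n m : ι) :
    ‖resolventMatrix A z n m‖ ≤ 1 / z.im := by
  have h1 : ‖resolventMatrix A z n m‖ ^ 2 ≤ ∑ n, ‖resolventMatrix A z n m‖ ^ 2 :=
    Finset.single_le_sum (f := fun n => ‖resolventMatrix A z n m‖ ^ 2) (fun _ _ => sq_nonneg _)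
      (Finset.mem_univ n)
  exact le_of_sq_le_sq (h1.trans (sum_norm_resolventMatrix_sq_le hA hz m)) (by positivity)

theorem im_mul_norm_sq_le (hA : A.IsHermitian) {z : ℂ} (hz : 0 < z.im) (n : ι) :
    z.im * ‖resolventMatrix A z n n‖ ^ 2 ≤ (resolventMatrix A z n n).im := by
  rw [im_resolventMatrix_eq_mul_sum hA hz]
  gcongr
  exact Finset.single_le_sum (f := fun m => ‖resolventMatrix A z m n‖ ^ 2) (fun _ _ => sq_nonneg _)
      (Finset.mem_univ n)

/-- By the Ward identity a vanishing diagonal entry would annihilate its whole column, contradicting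
(A - z) R = 1. -/
theorem resolventMatrix_diag_ne_zero (hA : A.IsHermitian) {z : ℂ} (hz : 0 < z.im) (n : ι) :
    resolventMatrix A z n n ≠ 0 := fun h => by
  have h1 := im_resolventMatrix_eq_mul_sum hA hz n
  rw [h, Complex.zero_im, eq_comm, mul_eq_zero, or_iff_right hz.ne',
    Finset.sum_eq_zero_iff_of_nonneg fun _ _ => sq_nonneg _] at h1
  have h2 := congrFun (congrFun (sub_mul_resolventMatrix hA hz) n) n
  rw [Matrix.mul_apply, Finset.sum_eq_zero, Matrix.one_apply_eq] at h2
  · exact zero_ne_one h2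
  · intro m _
    have := h1 m (Finset.mem_univ m)
    rw [sq_eq_zero_iff, norm_eq_zero] at this
    rw [this, mul_zero]

theorem resolventMatrix_rank_one (hA : A.IsHermitian) {z : ℂ} (hz : 0 < z.im) (n : ι) (t : ℝ)
    (hB : (A + Matrix.single n n (t : ℂ)).IsHermitian) :
    resolventMatrix (A + Matrix.single n n (t : ℂ)) z n n * (1 + t * resolventMatrix A z n n)
      = resolventMatrix A z n n := by
  set B := A + Matrix.single n n (t : ℂ) with hBdef
  have h1 := sub_mul_resolventMatrix hA hz
  have h2 := resolventMatrix_mul_sub hB hz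
  have h3 : resolventMatrix A z - resolventMatrix B z
      = resolventMatrix B z * Matrix.single n n (t : ℂ) * resolventMatrix A z := by
    calc _ = resolventMatrix B z * (B - z • (1 : Matrix ι ι ℂ)) * resolventMatrix A z
          - resolventMatrix B z * ((A - z • (1 : Matrix ι ι ℂ)) * resolventMatrix A z) := by
          rw [h1, h2, one_mul, mul_one]
      _ = resolventMatrix B z * ((B - z • (1 : Matrix ι ι ℂ)) - (A - z • (1 : Matrix ι ι ℂ)))
          * resolventMatrix A z := by
          rw [mul_mul_sub_mul_mul]
      _ = _ := by congr 2; rw [hBdef]; abel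
  have h4 := congrFun (congrFun h3 n) n
  rw [Matrix.sub_apply, Matrix.mul_apply, Finset.sum_eq_single n] at h4
  · rw [Matrix.mul_single_apply_same] at h4
    linear_combination -h4
  · intro m _ hm
    rw [Matrix.mul_single_apply_of_ne _ _ _ _ _ hm, zero_mul]
  · simp

/-! ### Counting eigenvalues -/

/-- The number of eigenvalues, with multiplicity, at distance less than `r` from `E`. -/
noncomputable def eigenCount (hA : A.IsHermitian) (E r : ℝ) : ℕ :=
  Nat.card {i : ι // |hA.eigenvalues i - E| < r}

theorem eigenCount_le_card (hA : A.IsHermitian) (E r : ℝ) : eigenCount hA E r ≤ Fintype.card ι := by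
  rw [eigenCount, ← Nat.card_eq_fintype_card]
  exact Nat.card_le_card_of_injective _ Subtype.val_injective

theorem inner_eigenvectorBasis_mulVec (hA : A.IsHermitian) (E : ℝ) (v : EuclideanSpace ℂ ι) (i : ι) :
    inner ℂ (hA.eigenvectorBasis i) (Matrix.toEuclideanLin A v - (E : ℂ) • v)
      = ((hA.eigenvalues i - E : ℝ) : ℂ) * inner ℂ (hA.eigenvectorBasis i) v := by
  have hs := Matrix.isSymmetric_toEuclideanLin_iff.2 hA
  have hb : Matrix.toEuclideanLin A (hA.eigenvectorBasis i)
      = (hA.eigenvalues i : ℂ) • hA.eigenvectorBasis i := by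
    ext j
    have := congrFun (hA.mulVec_eigenvectorBasis i) j
    simpa [Matrix.toLpLin_apply] using this
  rw [inner_sub_right, inner_smul_right, ← hs, hb, inner_smul_left]
  simp [sub_mul]

theorem norm_mulVec_sub_sq (hA : A.IsHermitian) (E : ℝ) (v : EuclideanSpace ℂ ι) :
    ‖Matrix.toEuclideanLin A v - (E : ℂ) • v‖ ^ 2
      = ∑ i, (hA.eigenvalues i - E) ^ 2 * ‖inner ℂ (hA.eigenvectorBasis i) v‖ ^ 2 := by
  rw [← hA.eigenvectorBasis.sum_sq_norm_inner_right]
  refine Finset.sum_congr rfl fun i _ => ?_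
  rw [inner_eigenvectorBasis_mulVec, norm_mul, mul_pow, Complex.norm_real, Real.norm_eq_abs, sq_abs]

/-- A rank one diagonal perturbation changes the number of eigenvalues in an interval by at most
one. -/
theorem eigenCount_le_add_one (hA : A.IsHermitian) {n : ι} {t : ℝ}
    (hB : (A + Matrix.single n n (t : ℂ)).IsHermitian) (E r : ℝ) :
    eigenCount hA E r ≤ eigenCount hB E r + 1 := by
  rcases le_or_gt r 0 with hr | hr
  · have : eigenCount hA E r = 0 := by
      rw [eigenCount, Nat.card_eq_zero]
      exact .inl ⟨fun i => absurd i.2 (by linarith [abs_nonneg (hA.eigenvalues i - E)])⟩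
    omega
  set J := {i : ι // |hA.eigenvalues i - E| < r}
  set J' := {i : ι // |hB.eigenvalues i - E| < r}
  let comb : (J → ℂ) →ₗ[ℂ] EuclideanSpace ℂ ι :=
    Fintype.linearCombination ℂ fun i : J => hA.eigenvectorBasis i
  -- A dimension count: a combination of eigenvectors of A with level near E is tested against those
  -- of the perturbed matrix and against the coordinate n. Injectivity gives |J| ≤ |J'| + 1.
  let f : (J → ℂ) →ₗ[ℂ] (J' → ℂ) × ℂ :=
    ((LinearMap.pi fun j : J' => (innerSL ℂ (hB.eigenvectorBasis j)).toLinearMap).prod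
      (EuclideanSpace.proj n : EuclideanSpace ℂ ι →L[ℂ] ℂ).toLinearMap) ∘ₗ comb
  have hcomb : Function.Injective comb :=
    LinearIndependent.fintypeLinearCombination_injective
      (hA.eigenvectorBasis.orthonormal.linearIndependent.comp _ Subtype.val_injective)
  have hf : Function.Injective f := by
    rw [← LinearMap.ker_eq_bot, LinearMap.ker_eq_bot']
    intro c hc
    set v := comb c with hv
    have h1 : ∀ j : J', inner ℂ (hB.eigenvectorBasis j) v = 0 := fun j =>
      congrFun (congrArg Prod.fst hc) j
    have h2 : v n = 0 := congrArg Prod.snd hc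
    have h0 : ∀ i : ι, ¬ |hA.eigenvalues i - E| < r → inner ℂ (hA.eigenvectorBasis i) v = 0 := by
      intro i hi
      rw [hv]
      change inner ℂ (hA.eigenvectorBasis i) (Fintype.linearCombination ℂ _ c) = 0
      rw [Fintype.linearCombination_apply, inner_sum]
      refine Finset.sum_eq_zero fun j _ => ?_
      rw [inner_smul_right, hA.eigenvectorBasis.inner_eq_zero, mul_zero]
      rintro rfl
      exact hi j.2
    -- A vector vanishing at n does not feel the perturbation.
    have h3 : Matrix.toEuclideanLin (A + Matrix.single n n (t : ℂ)) v = Matrix.toEuclideanLin A v := by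
      rw [map_add, LinearMap.add_apply, add_eq_left]
      ext i
      simp [Matrix.toLpLin_apply, Matrix.single_mulVec, h2]
    have hge : r ^ 2 * ‖v‖ ^ 2 ≤ ‖Matrix.toEuclideanLin A v - (E : ℂ) • v‖ ^ 2 := by
      rw [← h3, norm_mulVec_sub_sq hB, ← hB.eigenvectorBasis.sum_sq_norm_inner_right, Finset.mul_sum]
      refine Finset.sum_le_sum fun i _ => ?_
      by_cases hi : |hB.eigenvalues i - E| < r
      · rw [h1 ⟨i, hi⟩]; simp
      · refine mul_le_mul_of_nonneg_right ?_ (sq_nonneg _)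
        rw [← sq_abs (_ - _)]
        exact pow_le_pow_left₀ hr.le (not_lt.1 hi) 2
    rw [norm_mulVec_sub_sq hA, ← hA.eigenvectorBasis.sum_sq_norm_inner_right, Finset.mul_sum] at hge
    have hle : ∀ i ∈ Finset.univ, (hA.eigenvalues i - E) ^ 2 * ‖inner ℂ (hA.eigenvectorBasis i) v‖ ^ 2
        ≤ r ^ 2 * ‖inner ℂ (hA.eigenvectorBasis i) v‖ ^ 2 := by
      intro i _
      by_cases hi : |hA.eigenvalues i - E| < r
      · refine mul_le_mul_of_nonneg_right ?_ (sq_nonneg _)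
        rw [← sq_abs (_ - _)]
        exact pow_le_pow_left₀ (abs_nonneg _) hi.le 2
      · rw [h0 i hi]; simp
    -- The expansion in eigenvectors of A bounds ‖(A - E)v‖ by r‖v‖ from above, that of the
    -- perturbed matrix from below. Equality must hold term by term, and it is strict for any
    -- nonzero component with |λ - E| < r.
    have heq := (Finset.sum_eq_sum_iff_of_le hle).1 (le_antisymm (Finset.sum_le_sum hle) hge)
    have hv0 : v = 0 := by
      rw [← norm_eq_zero, ← sq_eq_zero_iff, ← hA.eigenvectorBasis.sum_sq_norm_inner_right]
      refine Finset.sum_eq_zero fun i hi => ?_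
      by_cases h : |hA.eigenvalues i - E| < r
      · have h5 := heq i hi
        by_contra hne
        have h6 := mul_right_cancel₀ hne h5
        rw [← sq_abs (_ - _)] at h6
        exact absurd ((pow_left_inj₀ (abs_nonneg _) hr.le two_ne_zero).1 h6) h.ne
      · rw [h0 i h]; simp
    exact hcomb (by rw [← hv, hv0, map_zero])
  have := LinearMap.finrank_le_finrank_of_injective hf
  rw [Module.finrank_prod, Module.finrank_pi, Module.finrank_pi, Module.finrank_self] at this
  rw [eigenCount, eigenCount, Nat.card_eq_fintype_card, Nat.card_eq_fintype_card]
  exact this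

end Resolvent

/-! ### Approximation of an indicator function by Cauchy kernels -/

section Approximation

/-- The function `v ↦ 1 / (1 + s v)` on the unit interval. -/
noncomputable def invAffine (s : Set.Ioi (-1 : ℝ)) : C(Set.Icc (0 : ℝ) 1, ℝ) where
  toFun v := (1 + s * v)⁻¹
  continuous_toFun := by
    refine Continuous.inv₀ (by fun_prop) fun v => ?_
    have h1 := v.2.1; have h2 := v.2.2; have h3 : -1 < (s : ℝ) := s.2
    have : 0 < 1 + (s : ℝ) * v := by
      rcases le_total 0 (s : ℝ) with h | h <;> nlinarith
    exact this.ne'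

theorem one_add_mul_ge (s : Set.Ioi (-1 : ℝ)) (v : Set.Icc (0 : ℝ) 1) :
    min 1 (1 + (s : ℝ)) ≤ 1 + s * v := by
  have h1 := v.2.1; have h2 := v.2.2
  rcases le_total 0 (s : ℝ) with h | h
  · exact (min_le_left _ _).trans (by nlinarith)
  · exact (min_le_right _ _).trans (by nlinarith)

theorem one_add_mul_pos (s : Set.Ioi (-1 : ℝ)) (v : Set.Icc (0 : ℝ) 1) : 0 < 1 + (s : ℝ) * v :=
  (lt_min one_pos (by have : -1 < (s : ℝ) := s.2; linarith)).trans_le (one_add_mul_ge s v)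

/-- Partial fractions. -/
theorem invAffine_mul_mem_span {s s' : Set.Ioi (-1 : ℝ)} (h : s ≠ s') :
    invAffine s * invAffine s' ∈ Submodule.span ℝ (Set.range invAffine) := by
  have hne : (s : ℝ) - s' ≠ 0 := sub_ne_zero.2 fun e => h (Subtype.ext e)
  have e : invAffine s * invAffine s'
      = ((s : ℝ) / (s - s')) • invAffine s - ((s' : ℝ) / (s - s')) • invAffine s' := by
    ext v
    have h1 := (one_add_mul_pos s v).ne'
    have h2 := (one_add_mul_pos s' v).ne'
    simp only [ContinuousMap.mul_apply, ContinuousMap.sub_apply, ContinuousMap.smul_apply,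
      smul_eq_mul]
    change (1 + (s : ℝ) * v)⁻¹ * (1 + (s' : ℝ) * v)⁻¹
      = (s : ℝ) / (s - s') * (1 + (s : ℝ) * v)⁻¹ - (s' : ℝ) / (s - s') * (1 + (s' : ℝ) * v)⁻¹
    have h3 : (s : ℝ) * (1 + s' * v) - s' * (1 + s * v) = s - s' := by ring
    generalize 1 + (s : ℝ) * v = a at h1 h3 ⊢
    generalize 1 + (s' : ℝ) * v = b at h2 h3 ⊢
    field_simp
    linarith
  rw [e]
  exact Submodule.sub_mem _ (Submodule.smul_mem _ _ (Submodule.subset_span ⟨s, rfl⟩))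
    (Submodule.smul_mem _ _ (Submodule.subset_span ⟨s', rfl⟩))

theorem tendsto_invAffine (s : Set.Ioi (-1 : ℝ)) : ∃ u : ℕ → Set.Ioi (-1 : ℝ), (∀ n, s ≠ u n) ∧
    Tendsto (fun n => invAffine (u n)) atTop (𝓝 (invAffine s)) := by
  have hs : -1 < (s : ℝ) := s.2
  set δ := min 1 (1 + (s : ℝ)) with hδ
  have hδ0 : 0 < δ := lt_min one_pos (by linarith)
  let u : ℕ → Set.Ioi (-1 : ℝ) := fun n =>
    ⟨s + 1 / ((n : ℝ) + 1), by
      have : 0 < 1 / ((n : ℝ) + 1) := by positivity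
      exact Set.mem_Ioi.2 (by linarith)⟩
  refine ⟨u, fun n h => ?_, ?_⟩
  · have h1 : (s : ℝ) = s + 1 / ((n : ℝ) + 1) := congrArg Subtype.val h
    have : 0 < 1 / ((n : ℝ) + 1) := by positivity
    linarith
  · rw [tendsto_iff_norm_sub_tendsto_zero]
    have hlim : Tendsto (fun n : ℕ => 1 / ((n : ℝ) + 1) * (1 / δ ^ 2)) atTop (𝓝 0) := by
      simpa only [zero_mul] using
        (tendsto_one_div_add_atTop_nhds_zero_nat (𝕜 := ℝ)).mul_const (1 / δ ^ 2)
    refine squeeze_zero (fun _ => norm_nonneg _) (fun n => ?_) hlim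
    rw [ContinuousMap.norm_le _ (by positivity)]
    intro v
    have h0 : 0 < 1 / ((n : ℝ) + 1) := by positivity
    have hv0 := v.2.1; have hv1 := v.2.2
    have h1 : δ ≤ 1 + (s : ℝ) * v := one_add_mul_ge s v
    have h2 : 1 + (s : ℝ) * v ≤ 1 + (s + 1 / ((n : ℝ) + 1)) * v := by nlinarith
    rw [ContinuousMap.sub_apply, Real.norm_eq_abs]
    change |(1 + (s + 1 / ((n : ℝ) + 1)) * v)⁻¹ - (1 + (s : ℝ) * v)⁻¹| ≤ _
    generalize 1 / ((n : ℝ) + 1) = h at h0 h2 ⊢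
    have h3 : 0 < 1 + (s : ℝ) * v := hδ0.trans_le h1
    have h4 : 0 < 1 + ((s : ℝ) + h) * v := h3.trans_le h2
    rw [inv_sub_inv h4.ne' h3.ne', abs_div, abs_of_pos (mul_pos h4 h3), mul_one_div]
    have e : 1 + (s : ℝ) * v - (1 + (s + h) * v) = -(h * v) := by ring
    rw [e, abs_neg, abs_of_nonneg (mul_nonneg h0.le hv0), sq]
    exact div_le_div₀ h0.le (by nlinarith) (by positivity)
      (mul_le_mul (h1.trans h2) h1 hδ0.le h4.le)

/-- Stone–Weierstrass. The span itself need not be closed under products, but its closure is: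
products of distinct generators lie in the span by partial fractions, and squares are limits of such
products. -/
theorem dense_span_invAffine (f : C(Set.Icc (0 : ℝ) 1, ℝ)) :
    f ∈ (Submodule.span ℝ (Set.range invAffine)).topologicalClosure := by
  set S := Submodule.span ℝ (Set.range invAffine) with hS
  have hmul0 : ∀ s s', invAffine s * invAffine s' ∈ S.topologicalClosure := by
    intro s s'
    rcases ne_or_eq s s' with h | rfl
    · exact S.le_topologicalClosure (invAffine_mul_mem_span h)
    · obtain ⟨u, hu, hlim⟩ := tendsto_invAffine s
      exact mem_closure_of_tendsto (hlim.const_mul (invAffine s))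
        (.of_forall fun n => invAffine_mul_mem_span (hu n))
  have hmul1 : ∀ x ∈ S, ∀ y ∈ S, x * y ∈ S.topologicalClosure := by
    intro x hx y hy
    induction hx, hy using Submodule.span_induction₂ with
    | mem_mem x y hx hy =>
      obtain ⟨s, rfl⟩ := hx
      obtain ⟨s', rfl⟩ := hy
      exact hmul0 s s'
    | zero_left y hy => rw [zero_mul]; exact Submodule.zero_mem _
    | zero_right x hx => rw [mul_zero]; exact Submodule.zero_mem _
    | add_left x y z _ _ _ h1 h2 => rw [add_mul]; exact Submodule.add_mem _ h1 h2
    | add_right x y z _ _ _ h1 h2 => rw [mul_add]; exact Submodule.add_mem _ h1 h2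
    | smul_left r x y _ _ h => rw [smul_mul_assoc]; exact Submodule.smul_mem _ _ h
    | smul_right r x y _ _ h => rw [mul_smul_comm]; exact Submodule.smul_mem _ _ h
  have hmul2 : ∀ x ∈ S.topologicalClosure, ∀ y ∈ S.topologicalClosure,
      x * y ∈ S.topologicalClosure := by
    intro x hx y hy
    have := map_mem_closure₂ continuous_mul hx hy (u := (S.topologicalClosure : Set _)) hmul1
    rwa [S.isClosed_topologicalClosure.closure_eq] at this
  have hone : (1 : C(Set.Icc (0 : ℝ) 1, ℝ)) ∈ S.topologicalClosure := by
    refine S.le_topologicalClosure (Submodule.subset_span ⟨⟨0, by simp⟩, ?_⟩)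
    ext v
    simp [invAffine]
  let A : Subalgebra ℝ C(Set.Icc (0 : ℝ) 1, ℝ) :=
    Submodule.toSubalgebra S.topologicalClosure hone fun x y hx hy => hmul2 x hx y hy
  have hsep : A.SeparatesPoints := by
    intro v w hvw
    refine ⟨_, ⟨invAffine ⟨1, by norm_num⟩,
      S.le_topologicalClosure (Submodule.subset_span ⟨_, rfl⟩), rfl⟩, ?_⟩
    intro h
    change (1 + (1 : ℝ) * v)⁻¹ = (1 + (1 : ℝ) * w)⁻¹ at h
    have := inv_injective h
    exact hvw (Subtype.ext (by linarith))
  have htop := ContinuousMap.subalgebra_topologicalClosure_eq_top_of_separatesPoints A hsep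
  have hf : f ∈ A.topologicalClosure := htop ▸ Algebra.mem_top
  have hf2 : f ∈ closure (S.topologicalClosure : Set C(Set.Icc (0 : ℝ) 1, ℝ)) := hf
  rwa [S.isClosed_topologicalClosure.closure_eq] at hf2

/-- The error allowed in the approximation of the indicator function of `(-c, c)`. -/
noncomputable def approxError (c κ x : ℝ) : ℝ :=
  κ * (1 / (x ^ 2 + 1 ^ 2))
    + 2 * (κ * (κ / ((x - c) ^ 2 + κ ^ 2)) + κ * (κ / ((x + c) ^ 2 + κ ^ 2)))

theorem one_le_two_mul_cauchy {κ y : ℝ} (hκ : 0 < κ) (hy : |y| ≤ κ) :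
    1 ≤ 2 * (κ * (κ / (y ^ 2 + κ ^ 2))) := by
  have h : y ^ 2 ≤ κ ^ 2 := sq_le_sq.2 (by rwa [abs_of_pos hκ])
  rw [← mul_div_assoc, ← mul_div_assoc, le_div_iff₀ (by positivity)]
  nlinarith

/-- Put v = 1/(1 + x²). Then v (1 + s v)⁻¹ = 1/(x² + 1 + s), so density of the span of `invAffine`
becomes approximation by kernels centred at 0 of width √(1 + s). The target is a continuous ramp in
v that equals the indicator unless c - κ < |x| < c; on that layer the discrepancy is at most 1 and
is dominated by kernels of width κ at ±c. The last clause, a bound by κ off the layer, serves to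
prove measurability of level counts. -/
theorem exists_cauchy_approx {c κ : ℝ} (hc : 0 < c) (hκ : 0 < κ) :
    ∃ (m : ℕ) (t a : Fin m → ℝ), (∀ j, 0 < t j) ∧
      (∀ x : ℝ, |(if |x| < c then (1 : ℝ) else 0) - ∑ j, a j * (t j / (x ^ 2 + t j ^ 2))|
        ≤ approxError c κ x) ∧
      ∀ x : ℝ, |x| ≤ c - κ ∨ c ≤ |x| →
        |(if |x| < c then (1 : ℝ) else 0) - ∑ j, a j * (t j / (x ^ 2 + t j ^ 2))| ≤ κ := by
  -- The value of v at |x| = c. The slope N below lets the ramp reach 1 by |x| = c - κ, where c² -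
  -- x² ≥ κ c.
  set w : ℝ := 1 / (1 + c ^ 2) with hw
  have hw0 : 0 < w := by positivity
  set N : ℝ := (1 + c ^ 2) ^ 2 / (κ * c) with hN
  have hN0 : 0 < N := by positivity
  let θ : ℝ → ℝ := fun v => min 1 (max 0 (N * (v - w)))
  have hθc : Continuous θ := by fun_prop
  -- Approximating θ(v)/v rather than θ turns a uniform error κ into κ v = κ/(1 + x²), itself a
  -- Cauchy kernel. The maximum only removes the singularity at 0, because θ vanishes for v ≤ w.
  let f : C(Set.Icc (0 : ℝ) 1, ℝ) := ⟨fun v => θ v / max (v : ℝ) w,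
    (hθc.comp continuous_subtype_val).div (by fun_prop)
      fun v => (lt_max_of_lt_right hw0).ne'⟩
  obtain ⟨g, hg, hgf⟩ := Metric.mem_closure_iff.1 (dense_span_invAffine f) κ hκ
  obtain ⟨m, b, p, hp⟩ := (Submodule.mem_span_set' (s := Set.range invAffine)).1 hg
  choose s hs using fun j => (p j).2
  have hs1 : ∀ j, 0 < 1 + (s j : ℝ) := fun j => by
    have : -1 < (s j : ℝ) := (s j).2
    linarith
  refine ⟨m, fun j => √(1 + s j), fun j => b j / √(1 + s j), fun j => Real.sqrt_pos.2 (hs1 j),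
    ?_⟩
  rw [← forall_and]
  intro x
  set v : ℝ := 1 / (1 + x ^ 2) with hv
  have hx1 : 0 < 1 + x ^ 2 := by positivity
  have hv0 : 0 < v := by positivity
  have hv1 : v ≤ 1 := by rw [hv, div_le_one hx1]; nlinarith [sq_nonneg x]
  have hsum : ∑ j, b j / √(1 + s j) * (√(1 + s j) / (x ^ 2 + √(1 + s j) ^ 2))
      = v * g ⟨v, hv0.le, hv1⟩ := by
    rw [← hp, ContinuousMap.sum_apply, Finset.mul_sum]
    refine Finset.sum_congr rfl fun j _ => ?_
    rw [ContinuousMap.smul_apply, ← hs j, smul_eq_mul]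
    change _ = v * (b j * (1 + s j * v)⁻¹)
    have h1 : √(1 + (s j : ℝ)) ≠ 0 := (Real.sqrt_pos.2 (hs1 j)).ne'
    have h2 : x ^ 2 + (1 + s j) ≠ 0 := by have := hs1 j; positivity
    have h3 : 1 + s j * v = (x ^ 2 + (1 + s j)) * v := by
      rw [hv]; field_simp; ring
    rw [Real.sq_sqrt (hs1 j).le, h3]
    field_simp
  have happrox : |θ v - v * g ⟨v, hv0.le, hv1⟩| ≤ κ * (1 / (x ^ 2 + 1 ^ 2)) := by
    have h1 := (ContinuousMap.dist_apply_le_dist (f := f) (g := g) ⟨v, hv0.le, hv1⟩).trans hgf.le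
    have h2 : θ v = v * f ⟨v, hv0.le, hv1⟩ := by
      change θ v = v * (θ v / max v w)
      rcases le_total w v with h | h
      · rw [max_eq_left h]; field_simp
      · have : θ v = 0 := by
          change min 1 (max 0 (N * (v - w))) = 0
          rw [max_eq_left (mul_nonpos_of_nonneg_of_nonpos hN0.le (by linarith))]
          simp
        rw [this]; simp
    rw [h2, ← mul_sub, abs_mul, abs_of_pos hv0, mul_comm]
    rw [Real.dist_eq] at h1
    calc _ ≤ κ * v := by gcongr
      _ = _ := by rw [hv, one_pow, add_comm (x ^ 2)]
  have hθ0 : 0 ≤ θ v := le_min zero_le_one (le_max_left _ _)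
  have hθ1 : θ v ≤ 1 := min_le_left _ _
  have hdiff : v - w = (c ^ 2 - x ^ 2) / ((1 + x ^ 2) * (1 + c ^ 2)) := by
    rw [hv, hw]; field_simp; ring
  have hnn : ∀ y : ℝ, 0 ≤ κ * (κ / (y ^ 2 + κ ^ 2)) := fun y => by positivity
  have hθeq : |x| ≤ c - κ ∨ c ≤ |x| → θ v = if |x| < c then (1 : ℝ) else 0 := by
    rintro (hxk | hxc)
    · rw [if_pos (by linarith)]
      have h1 : 1 ≤ N * (v - w) := by
        have h2 : x ^ 2 = |x| ^ 2 := (sq_abs x).symm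
        have h3 := abs_nonneg x
        rw [hN, hdiff, div_mul_div_comm, le_div_iff₀ (by positivity), one_mul]
        have h4 : κ * c ≤ c ^ 2 - x ^ 2 := by rw [h2]; nlinarith
        have h5 : 1 + x ^ 2 ≤ 1 + c ^ 2 := by rw [h2]; nlinarith
        have h6 : 0 ≤ c ^ 2 - x ^ 2 := le_trans (by positivity) h4
        calc κ * c * ((1 + x ^ 2) * (1 + c ^ 2))
            ≤ (c ^ 2 - x ^ 2) * ((1 + c ^ 2) * (1 + c ^ 2)) := by gcongr
          _ = _ := by ring
      exact min_eq_left (h1.trans (le_max_right _ _))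
    · rw [if_neg (not_lt.2 hxc)]
      have h1 : v - w ≤ 0 := by
        rw [hdiff]
        refine div_nonpos_of_nonpos_of_nonneg ?_ (by positivity)
        have : c ^ 2 ≤ |x| ^ 2 := pow_le_pow_left₀ hc.le hxc 2
        rw [sq_abs] at this; linarith
      change min 1 (max 0 (N * (v - w))) = 0
      rw [max_eq_left (mul_nonpos_of_nonneg_of_nonpos hN0.le h1)]
      simp
  have hind : |(if |x| < c then (1 : ℝ) else 0) - θ v|
      ≤ 2 * (κ * (κ / ((x - c) ^ 2 + κ ^ 2)) + κ * (κ / ((x + c) ^ 2 + κ ^ 2))) := by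
    by_cases h : |x| ≤ c - κ ∨ c ≤ |x|
    · rw [hθeq h, sub_self, abs_zero]
      have := hnn (x - c); have := hnn (x + c); linarith
    · rw [not_or, not_le, not_le] at h
      obtain ⟨hxk, hxc⟩ := h
      rw [if_pos hxc]
      have h1 : |1 - θ v| ≤ 1 := by rw [abs_le]; constructor <;> linarith
      refine h1.trans ?_
      rcases le_total 0 x with h | h
      · rw [abs_of_nonneg h] at hxc hxk
        have := one_le_two_mul_cauchy (y := x - c) hκ (by rw [abs_le]; constructor <;> linarith)
        have := hnn (x + c); linarith
      · rw [abs_of_nonpos h] at hxc hxk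
        have := one_le_two_mul_cauchy (y := x + c) hκ (by rw [abs_le]; constructor <;> linarith)
        have := hnn (x - c); linarith
  refine ⟨?_, fun h => ?_⟩
  · rw [hsum, approxError, add_comm]
    exact (abs_sub_le _ (θ v) _).trans (add_le_add hind happrox)
  · rw [hsum, ← hθeq h]
    refine happrox.trans (mul_le_of_le_one_right hκ.le ?_)
    rw [one_pow, div_le_one (by positivity)]
    nlinarith [sq_nonneg x]

end Approximation

/-! ### The product law -/

section Law

open ProbabilityTheory

variable {ι : Type*} {μ : Measure ℝ} [IsProbabilityMeasure μ]

theorem map_update_infinitePi [DecidableEq ι] (n : ι) :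
    ((Measure.infinitePi fun _ : ι => μ).prod μ).map (fun p => Function.update p.1 n p.2)
      = Measure.infinitePi fun _ : ι => μ := by
  refine Measure.eq_infinitePi _ fun s t ht => ?_
  have hm : Measurable fun p : (ι → ℝ) × ℝ => Function.update p.1 n p.2 := measurable_update'
  rw [Measure.map_apply hm (.pi s.countable_toSet fun i _ => ht i)]
  by_cases hn : n ∈ s
  · have e : (fun p : (ι → ℝ) × ℝ => Function.update p.1 n p.2) ⁻¹' Set.pi s t
        = Set.pi (s.erase n) t ×ˢ t n := by
      ext p
      simp only [Set.mem_preimage, Set.mem_pi, Finset.mem_coe, Set.mem_prod, Finset.mem_erase]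
      refine ⟨fun h => ⟨fun i hi => ?_, ?_⟩, fun h i hi => ?_⟩
      · simpa [Function.update_of_ne hi.1] using h i hi.2
      · simpa using h n hn
      · rcases eq_or_ne i n with rfl | hin
        · simpa using h.2
        · simpa [Function.update_of_ne hin] using h.1 i ⟨hin, hi⟩
    rw [e, Measure.prod_prod, Measure.infinitePi_pi _ fun i _ => ht i, mul_comm,
      Finset.mul_prod_erase s (fun i => μ (t i)) hn]
  · have e : (fun p : (ι → ℝ) × ℝ => Function.update p.1 n p.2) ⁻¹' Set.pi s t
        = Set.pi s t ×ˢ Set.univ := by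
      ext p
      simp only [Set.mem_preimage, Set.mem_pi, Finset.mem_coe, Set.mem_prod, Set.mem_univ, and_true]
      refine forall₂_congr fun i hi => ?_
      rw [Function.update_of_ne (ne_of_mem_of_not_mem hi hn)]
    rw [e, Measure.prod_prod, Measure.infinitePi_pi _ fun i _ => ht i, measure_univ, mul_one]

/-- Lets one site be integrated with all the others frozen, the form in which independence enters
the Wegner and Minami estimates. -/
theorem lintegral_update_infinitePi [DecidableEq ι] (n : ι) {f : (ι → ℝ) → ℝ≥0∞}
    (hf : Measurable f) :
    ∫⁻ ω, ∫⁻ t, f (Function.update ω n t) ∂μ ∂(Measure.infinitePi fun _ : ι => μ)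
      = ∫⁻ ω, f ω ∂(Measure.infinitePi fun _ : ι => μ) := by
  have hm : Measurable fun p : (ι → ℝ) × ℝ => Function.update p.1 n p.2 := measurable_update'
  conv_rhs => rw [← map_update_infinitePi (μ := μ) n]
  rw [lintegral_map hf hm]
  exact (lintegral_prod _ (hf.comp hm).aemeasurable).symm

theorem map_comp_infinitePi {f : ι → ι} (hf : Function.Injective f) :
    (Measure.infinitePi fun _ : ι => μ).map (fun ω i => ω (f i))
      = Measure.infinitePi fun _ : ι => μ :=
  Measure.map_infinitePi_infinitePi_of_inj hf

theorem integral_comp_infinitePi {f : ι → ι} (hf : Function.Injective f) {g : (ι → ℝ) → ℝ}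
    (hg : Measurable g) :
    ∫ ω, g (fun i => ω (f i)) ∂(Measure.infinitePi fun _ : ι => μ)
      = ∫ ω, g ω ∂(Measure.infinitePi fun _ : ι => μ) := by
  conv_rhs => rw [← map_comp_infinitePi (μ := μ) hf]
  rw [integral_map (measurable_pi_lambda _ fun i => measurable_pi_apply _).aemeasurable
    hg.aestronglyMeasurable]

/-- Disjointness embeds the disjoint union of the S p into ι. The joint law is then a product over a
sigma type, which currying splits into a product of products. -/
theorem iIndepFun_restrict_infinitePi {κ : Type*} {S : κ → Finset ι}
    (hS : Pairwise (Function.onFun Disjoint S)) :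
    iIndepFun (fun p (ω : ι → ℝ) (j : S p) => ω j) (Measure.infinitePi fun _ : ι => μ) := by
  have hinj : Function.Injective fun q : (p : κ) × S p => (q.2 : ι) := by
    rintro ⟨p, j⟩ ⟨q, k⟩ h
    have hpq : p = q := by
      by_contra hne
      exact Finset.disjoint_left.1 (hS hne) j.2 (by have : (j : ι) = k := h; rw [this]; exact k.2)
    subst hpq
    congr 1
    exact Subtype.ext h
  rw [iIndepFun_iff_map_fun_eq_infinitePi_map (by fun_prop)]
  have h1 : ∀ p, (Measure.infinitePi fun _ : ι => μ).map (fun (ω : ι → ℝ) (j : S p) => ω j)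
      = Measure.infinitePi fun _ : S p => μ := fun p =>
    Measure.map_infinitePi_infinitePi_of_inj (P := fun _ => μ) Subtype.val_injective
  have h2 := Measure.map_infinitePi_infinitePi_of_inj (P := fun _ : ι => μ) hinj
  have h3 := Measure.infinitePi_map_piCurry (X := fun (p : κ) (_ : S p) => ℝ) (fun p (_ : S p) => μ)
  simp only [h1]
  rw [← h3, ← h2, Measure.map_map (by fun_prop) (by fun_prop)]
  rfl

theorem iIndepFun_of_dependsOn {κ : Type*} {S : κ → Finset ι}
    (hS : Pairwise (Function.onFun Disjoint S)) {X : κ → (ι → ℝ) → ℕ}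
    (hX : ∀ p, Measurable (X p)) (hdep : ∀ p, DependsOn (X p) (S p)) :
    iIndepFun X (Measure.infinitePi fun _ : ι => μ) := by
  classical
  -- Extension by zero factors X p measurably through the coordinates in S p; the default value is
  -- immaterial since X p ignores the other coordinates.
  let ext : ∀ p, (S p → ℝ) → ι → ℝ := fun p u i => if h : i ∈ S p then u ⟨i, h⟩ else 0
  have hext : ∀ p, Measurable (ext p) := fun p => by
    refine measurable_pi_lambda _ fun i => ?_
    by_cases h : i ∈ S p
    · simp only [ext, h, dite_true]; fun_prop
    · simp only [ext, h, dite_false]; fun_prop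
  have h := (iIndepFun_restrict_infinitePi (μ := μ) hS).comp (fun p u => X p (ext p u))
    fun p => (hX p).comp (hext p)
  have e : ∀ p, X p = (fun u => X p (ext p u)) ∘ fun (ω : ι → ℝ) (j : S p) => ω j := by
    intro p
    funext ω
    refine hdep p fun i hi => ?_
    simp [ext, Finset.mem_coe.1 hi]
  rwa [funext e]

end Law

/-! ### Averages of Cauchy kernels against a Hölder continuous measure -/

section Holder

/-- Cut the line into intervals of length η around -x. On the two k-th ones the kernel is at most
η⁻¹/(1 + k²) and each has mass at most |U| η^α; the sum over k converges. -/
theorem lintegral_cauchy_le {α : ℝ} {μ : Measure ℝ} (hμ : IsUniformlyHolder α μ) :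
    ∃ K : ℝ, 0 ≤ K ∧ ∀ x η : ℝ, 0 < η →
      ∫⁻ t, ENNReal.ofReal (η / ((t + x) ^ 2 + η ^ 2)) ∂μ ≤ ENNReal.ofReal (K * η ^ (α - 1)) := by
  obtain ⟨U, hU⟩ := hμ
  have hsum : Summable fun k : ℕ => 1 / (1 + (k : ℝ) ^ 2) := by
    refine Summable.of_nonneg_of_le (fun _ => by positivity) (fun k => ?_)
      (((summable_nat_add_iff 1).2 (Real.summable_one_div_nat_pow.2 one_lt_two)).mul_left 2)
    push_cast
    rw [mul_one_div, div_le_div_iff₀ (by positivity) (by positivity)]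
    nlinarith [sq_nonneg ((k : ℝ) - 1)]
  set S : ℝ := ∑' k : ℕ, 1 / (1 + (k : ℝ) ^ 2)
  have hS0 : 0 ≤ S := tsum_nonneg fun _ => by positivity
  refine ⟨2 * |U| * S, by positivity, fun x η hη => ?_⟩
  let A : ℕ → Set ℝ := fun k => Set.Icc (-x + k * η) (-x + k * η + η)
  let B : ℕ → Set ℝ := fun k => Set.Icc (-x - (k + 1) * η) (-x - (k + 1) * η + η)
  let w : ℕ → ℝ := fun k => 1 / η * (1 / (1 + (k : ℝ) ^ 2))
  have hw : ∀ k, 0 ≤ w k := fun k => by positivity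
  have hpt : ∀ t, ENNReal.ofReal (η / ((t + x) ^ 2 + η ^ 2))
      ≤ ∑' k, ((A k).indicator (fun _ => ENNReal.ofReal (w k)) t
        + (B k).indicator (fun _ => ENNReal.ofReal (w k)) t) := by
    intro t
    set k := ⌊|t + x| / η⌋₊ with hk
    have h1 : (k : ℝ) * η ≤ |t + x| := by
      rw [← le_div_iff₀ hη]; exact Nat.floor_le (by positivity)
    have h2 : |t + x| ≤ ((k : ℝ) + 1) * η := by
      rw [← div_le_iff₀ hη]; exact (Nat.lt_floor_add_one _).le
    have h3 : η / ((t + x) ^ 2 + η ^ 2) ≤ w k := by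
      have h4 : ((k : ℝ) * η) ^ 2 ≤ (t + x) ^ 2 := by
        rw [← sq_abs (t + x)]; exact pow_le_pow_left₀ (by positivity) h1 2
      have h5 : w k = η / (((k : ℝ) * η) ^ 2 + η ^ 2) := by
        simp only [w]; field_simp; ring
      rw [h5]
      gcongr
    refine le_trans ?_ (ENNReal.le_tsum k)
    rcases le_total 0 (t + x) with h | h
    · rw [abs_of_nonneg h] at h1 h2
      have : t ∈ A k := ⟨by linarith, by linarith⟩
      rw [Set.indicator_of_mem this]
      exact (ENNReal.ofReal_le_ofReal h3).trans le_self_add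
    · rw [abs_of_nonpos h] at h1 h2
      have : t ∈ B k := ⟨by linarith, by linarith⟩
      rw [Set.indicator_of_mem this]
      exact (ENNReal.ofReal_le_ofReal h3).trans le_add_self
  have hmeas : ∀ (T : ℕ → Set ℝ) (k : ℕ), MeasurableSet (T k) →
      Measurable ((T k).indicator (fun _ : ℝ => ENNReal.ofReal (w k))) := fun T k h =>
    measurable_const.indicator h
  have hμU : ∀ y, μ (Set.Icc y (y + η)) ≤ ENNReal.ofReal (|U| * η ^ α) := fun y =>
    (hU y η hη).trans (ENNReal.ofReal_le_ofReal (by gcongr; exact le_abs_self U))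
  calc ∫⁻ t, ENNReal.ofReal (η / ((t + x) ^ 2 + η ^ 2)) ∂μ
      ≤ ∫⁻ t, ∑' k, ((A k).indicator (fun _ => ENNReal.ofReal (w k)) t
        + (B k).indicator (fun _ => ENNReal.ofReal (w k)) t) ∂μ := lintegral_mono hpt
    _ = ∑' k, ∫⁻ t, ((A k).indicator (fun _ => ENNReal.ofReal (w k)) t
        + (B k).indicator (fun _ => ENNReal.ofReal (w k)) t) ∂μ :=
        lintegral_tsum fun k =>
          ((hmeas A k measurableSet_Icc).add (hmeas B k measurableSet_Icc)).aemeasurable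
    _ ≤ ∑' k, ENNReal.ofReal (w k * (2 * (|U| * η ^ α))) := by
        refine ENNReal.tsum_le_tsum fun k => ?_
        rw [lintegral_add_left (hmeas A k measurableSet_Icc),
          lintegral_indicator_const measurableSet_Icc, lintegral_indicator_const measurableSet_Icc,
          ← mul_add, ENNReal.ofReal_mul (hw k), two_mul, ENNReal.ofReal_add (by positivity)
            (by positivity)]
        gcongr
        · exact hμU _
        · exact hμU _
    _ = ENNReal.ofReal (2 * |U| * S * η ^ (α - 1)) := by
        rw [← ENNReal.ofReal_tsum_of_nonneg (fun k => by have := hw k; positivity)]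
        · congr 1
          rw [tsum_mul_right, tsum_mul_left, Real.rpow_sub_one hη.ne']
          ring
        · exact (hsum.mul_left _).mul_right _

end Holder

/-! ### Finite volume operators: measurability, Wegner and Minami estimates -/

section FiniteVolume

variable {d : ℕ} {H0 : L2 d →L[ℂ] L2 d}

instance : Countable (Fin d → ℤ) := inferInstance

theorem finiteVolume_apply (ω : (Fin d → ℤ) → ℝ) (Λ : Finset (Fin d → ℤ)) (n m : Λ) :
    finiteVolume H0 ω Λ n m = inner ℂ (delta (n : Fin d → ℤ)) (H0 (delta (m : Fin d → ℤ)))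
      + if n = m then (ω n : ℂ) else 0 := by
  rw [finiteVolume, Matrix.add_apply, Matrix.of_apply, Matrix.diagonal_apply]

theorem continuous_finiteVolume (Λ : Finset (Fin d → ℤ)) :
    Continuous fun ω => finiteVolume H0 ω Λ := by
  unfold finiteVolume
  refine continuous_const.add (Continuous.matrix_diagonal ?_)
  exact continuous_pi fun n => Complex.continuous_ofReal.comp (continuous_apply _)

theorem continuous_green (hH0 : IsSelfAdjoint H0) (Λ : Finset (Fin d → ℤ)) {z : ℂ} (hz : 0 < z.im)
    (n m : Λ) : Continuous fun ω => green H0 ω Λ z n m := by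
  have hc : Continuous fun ω => finiteVolume H0 ω Λ - z • (1 : Matrix Λ Λ ℂ) :=
    (continuous_finiteVolume Λ).sub continuous_const
  have e : ∀ ω, green H0 ω Λ z n m = ((finiteVolume H0 ω Λ - z • (1 : Matrix Λ Λ ℂ)).det)⁻¹
      * (finiteVolume H0 ω Λ - z • (1 : Matrix Λ Λ ℂ)).adjugate n m := by
    intro ω
    rw [green, Matrix.inv_def, Matrix.smul_apply, Ring.inverse_eq_inv', smul_eq_mul]
  simp only [e]
  exact (hc.matrix_det.inv₀ fun ω => det_sub_ne_zero (finiteVolume_isHermitian hH0 ω Λ) hz).mul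
    (hc.matrix_adjugate.matrix_elem n m)

theorem norm_green_le (hH0 : IsSelfAdjoint H0) (ω : (Fin d → ℤ) → ℝ) (Λ : Finset (Fin d → ℤ))
    {z : ℂ} (hz : 0 < z.im) (n m : Λ) : ‖green H0 ω Λ z n m‖ ≤ 1 / z.im :=
  norm_resolventMatrix_le (finiteVolume_isHermitian hH0 ω Λ) hz n m

theorem im_green_nonneg (hH0 : IsSelfAdjoint H0) (ω : (Fin d → ℤ) → ℝ) (Λ : Finset (Fin d → ℤ))
    {z : ℂ} (hz : 0 < z.im) (n : Λ) : 0 ≤ (green H0 ω Λ z n n).im :=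
  im_resolventMatrix_diag_nonneg (finiteVolume_isHermitian hH0 ω Λ) hz n

theorem finiteVolume_update (ω : (Fin d → ℤ) → ℝ)
    (Λ : Finset (Fin d → ℤ)) (n : Λ) (t : ℝ) :
    finiteVolume H0 (Function.update ω n t) Λ
      = finiteVolume H0 ω Λ + Matrix.single n n ((t - ω n : ℝ) : ℂ) := by
  ext i j
  rw [Matrix.add_apply, finiteVolume_apply, finiteVolume_apply, Matrix.single_apply, add_assoc]
  congr 1
  by_cases hij : i = j
  · subst hij
    by_cases hi : n = i
    · subst hi; simp
    · have : (i : Fin d → ℤ) ≠ n := fun h => hi (Subtype.ext h.symm)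
      simp [hi, Function.update_of_ne this]
  · have : ¬ (n = i ∧ n = j) := fun h => hij (h.1.symm.trans h.2)
    simp [hij, this]

theorem finiteVolume_congr {ω ω' : (Fin d → ℤ) → ℝ} {Λ : Finset (Fin d → ℤ)}
    (h : ∀ n ∈ Λ, ω n = ω' n) : finiteVolume H0 ω Λ = finiteVolume H0 ω' Λ := by
  ext n m
  rw [finiteVolume_apply, finiteVolume_apply, h n n.2]

/-- The rank one formula says that 1/G(n,n) is translated by t - ω n, a real number. Hence only its
real part moves and η = -Im(1/G(n,n)) is constant; η ≥ Im z follows from the Ward identity. -/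
theorem im_green_update (hH0 : IsSelfAdjoint H0)
    (Λ : Finset (Fin d → ℤ)) (n : Λ) {z : ℂ} (hz : 0 < z.im) (ω : (Fin d → ℤ) → ℝ) :
    ∃ x η : ℝ, z.im ≤ η ∧ ∀ t : ℝ,
      (green H0 (Function.update ω n t) Λ z n n).im = η / ((t + x) ^ 2 + η ^ 2) := by
  set A := finiteVolume H0 ω Λ with hAdef
  have hA : A.IsHermitian := finiteVolume_isHermitian hH0 ω Λ
  set g := resolventMatrix A z n n with hg
  have hg0 : g ≠ 0 := resolventMatrix_diag_ne_zero hA hz n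
  have hns : 0 < Complex.normSq g := Complex.normSq_pos.2 hg0
  refine ⟨(g⁻¹).re - ω n, -(g⁻¹).im, ?_, fun t => ?_⟩
  · rw [Complex.inv_im, neg_div, neg_neg, le_div_iff₀ hns, Complex.normSq_eq_norm_sq]
    exact im_mul_norm_sq_le hA hz n
  · have hB : (A + Matrix.single n n ((t - ω n : ℝ) : ℂ)).IsHermitian := by
      rw [hAdef, ← finiteVolume_update]
      exact finiteVolume_isHermitian hH0 _ Λ
    have h1 := resolventMatrix_rank_one hA hz n (t - ω n) hB
    rw [← hg] at h1
    have h2 : green H0 (Function.update ω n t) Λ z n n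
        = resolventMatrix (A + Matrix.single n n ((t - ω n : ℝ) : ℂ)) z n n := by
      rw [hAdef, ← finiteVolume_update]; rfl
    rw [h2]
    set gt := resolventMatrix (A + Matrix.single n n ((t - ω n : ℝ) : ℂ)) z n n
    have h3 : gt = (g⁻¹ + ((t - ω n : ℝ) : ℂ))⁻¹ := by
      have h4 : gt * (g⁻¹ + ((t - ω n : ℝ) : ℂ)) = 1 := by
        have : g⁻¹ + ((t - ω n : ℝ) : ℂ) = (1 + ((t - ω n : ℝ) : ℂ) * g) * g⁻¹ := by
          field_simp
        rw [this, ← mul_assoc, h1, mul_inv_cancel₀ hg0]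
      exact eq_inv_of_mul_eq_one_left h4
    rw [h3, Complex.inv_im, Complex.normSq_apply, Complex.add_im, Complex.add_re,
      Complex.ofReal_im, Complex.ofReal_re, add_zero]
    congr 1
    ring

variable {α : ℝ} {μ : Measure ℝ}

/-- Spectral averaging over the coupling constant of one site. -/
theorem exists_spectral_averaging (hH0 : IsSelfAdjoint H0) (hα1 : α ≤ 1)
    (hμ : IsUniformlyHolder α μ) :
    ∃ K : ℝ, 0 ≤ K ∧ ∀ (Λ : Finset (Fin d → ℤ)) (n : Λ) (z : ℂ), 0 < z.im →
      ∀ ω, ∫⁻ t, ENNReal.ofReal (green H0 (Function.update ω n t) Λ z n n).im ∂μ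
        ≤ ENNReal.ofReal (K * z.im ^ (α - 1)) := by
  obtain ⟨K, hK, h⟩ := lintegral_cauchy_le hμ
  refine ⟨K, hK, fun Λ n z hz ω => ?_⟩
  obtain ⟨x, η, hη, he⟩ := im_green_update hH0 Λ n hz ω
  simp only [he]
  refine (h x η (hz.trans_le hη)).trans (ENNReal.ofReal_le_ofReal ?_)
  -- Here α ≤ 1 matters: the exponent α - 1 is nonpositive, so the unknown width η may be replaced
  -- by Im z.
  exact mul_le_mul_of_nonneg_left (Real.rpow_le_rpow_of_nonpos hz hη (by linarith)) hK

variable [IsProbabilityMeasure μ]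

/-- `K` is a constant for which the Wegner estimate holds. -/
def WegnerBound (H0 : L2 d →L[ℂ] L2 d) (μ : Measure ℝ) (α K : ℝ) : Prop :=
  0 ≤ K ∧ ∀ (Λ : Finset (Fin d → ℤ)) (n : Λ) (z : ℂ), 0 < z.im →
    ∫⁻ ω, ENNReal.ofReal (green H0 ω Λ z n n).im ∂(law d μ)
      ≤ ENNReal.ofReal (K * z.im ^ (α - 1))

theorem measurable_green (hH0 : IsSelfAdjoint H0) (Λ : Finset (Fin d → ℤ)) {z : ℂ} (hz : 0 < z.im)
    (n m : Λ) : Measurable fun ω => green H0 ω Λ z n m :=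
  (continuous_green hH0 Λ hz n m).measurable

theorem measurable_im_green (hH0 : IsSelfAdjoint H0) (Λ : Finset (Fin d → ℤ)) {z : ℂ}
    (hz : 0 < z.im) (n m : Λ) : Measurable fun ω => (green H0 ω Λ z n m).im :=
  Complex.measurable_im.comp (measurable_green hH0 Λ hz n m)

theorem integrable_im_green (hH0 : IsSelfAdjoint H0) (Λ : Finset (Fin d → ℤ)) {z : ℂ}
    (hz : 0 < z.im) (n m : Λ) : Integrable (fun ω => (green H0 ω Λ z n m).im) (law d μ) :=
  .of_bound (measurable_im_green hH0 Λ hz n m).aestronglyMeasurable (1 / z.im)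
    (.of_forall fun ω => (Complex.abs_im_le_norm _).trans (norm_green_le hH0 ω Λ hz n m))

theorem wegnerBound_of_spectral_averaging (hH0 : IsSelfAdjoint H0) {K : ℝ}
    (hK : 0 ≤ K) (h : ∀ (Λ : Finset (Fin d → ℤ)) (n : Λ) (z : ℂ), 0 < z.im →
      ∀ ω, ∫⁻ t, ENNReal.ofReal (green H0 (Function.update ω n t) Λ z n n).im ∂μ
        ≤ ENNReal.ofReal (K * z.im ^ (α - 1))) : WegnerBound H0 μ α K := by
  refine ⟨hK, fun Λ n z hz => ?_⟩
  rw [law, ← lintegral_update_infinitePi (n : Fin d → ℤ)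
    (measurable_im_green hH0 Λ hz n n).ennreal_ofReal]
  refine (lintegral_mono fun ω => h Λ n z hz ω).trans ?_
  rw [lintegral_const, measure_univ, mul_one]

theorem WegnerBound.integral_le {K : ℝ} (h : WegnerBound H0 μ α K) (hH0 : IsSelfAdjoint H0)
    (Λ : Finset (Fin d → ℤ)) (n : Λ) {z : ℂ} (hz : 0 < z.im) :
    ∫ ω, (green H0 ω Λ z n n).im ∂(law d μ) ≤ K * z.im ^ (α - 1) := by
  have h1 := h.2 Λ n z hz
  rw [← ofReal_integral_eq_lintegral_ofReal (integrable_im_green hH0 Λ hz n n)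
    (.of_forall fun ω => im_green_nonneg hH0 ω Λ hz n)] at h1
  exact (ENNReal.ofReal_le_ofReal_iff (mul_nonneg h.1 (Real.rpow_nonneg hz.le _))).1 h1

/-! ### Level counting -/

theorem eigenCount_congr {ι : Type*} [Fintype ι] [DecidableEq ι] {A B : Matrix ι ι ℂ}
    (hA : A.IsHermitian) (hB : B.IsHermitian) (h : A = B) (E r : ℝ) :
    eigenCount hA E r = eigenCount hB E r := by
  subst h; rfl

/-- The number of eigenvalues of `H_Λ^ω` in `(E - r, E + r)`. -/
noncomputable def levelCount (hH0 : IsSelfAdjoint H0) (Λ : Finset (Fin d → ℤ)) (E r : ℝ)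
    (ω : (Fin d → ℤ) → ℝ) : ℕ :=
  eigenCount (finiteVolume_isHermitian hH0 ω Λ) E r

theorem levelCount_le_card (hH0 : IsSelfAdjoint H0) (Λ : Finset (Fin d → ℤ)) (E r : ℝ)
    (ω : (Fin d → ℤ) → ℝ) : levelCount hH0 Λ E r ω ≤ Λ.card := by
  have h := eigenCount_le_card (finiteVolume_isHermitian hH0 ω Λ) E r
  rwa [Fintype.card_coe] at h

theorem levelCount_congr (hH0 : IsSelfAdjoint H0) {Λ : Finset (Fin d → ℤ)} (E r : ℝ)
    {ω ω' : (Fin d → ℤ) → ℝ} (h : ∀ n ∈ Λ, ω n = ω' n) :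
    levelCount hH0 Λ E r ω = levelCount hH0 Λ E r ω' :=
  eigenCount_congr _ _ (finiteVolume_congr h) E r

theorem eigenCount_eq_sum {ι : Type*} [Fintype ι] [DecidableEq ι] {A : Matrix ι ι ℂ}
    (hA : A.IsHermitian) (E r : ℝ) :
    (eigenCount hA E r : ℝ) = ∑ i, if |hA.eigenvalues i - E| < r then (1 : ℝ) else 0 := by
  rw [eigenCount, Nat.card_eq_fintype_card, Fintype.card_subtype, Finset.sum_boole]

/-- `E + i t` as a complex number. -/
noncomputable abbrev spectralPoint (E t : ℝ) : ℂ := ⟨E, t⟩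

theorem sum_cauchy_eigenvalues {ι : Type*} [Fintype ι] [DecidableEq ι] {A : Matrix ι ι ℂ}
    (hA : A.IsHermitian) (E : ℝ) {t : ℝ} (ht : 0 < t) :
    ∑ i, t / ((hA.eigenvalues i - E) ^ 2 + t ^ 2)
      = ∑ n, (resolventMatrix A (spectralPoint E t) n n).im :=
  (sum_im_resolventMatrix_diag hA (z := spectralPoint E t) ht).symm

/-- No measurable choice of eigenvalues is needed: the count is a pointwise limit of linear
combinations of traces of Im G, which are continuous in ω. -/
theorem measurable_levelCount (hH0 : IsSelfAdjoint H0) (Λ : Finset (Fin d → ℤ)) (E : ℝ) {r : ℝ}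
    (hr : 0 < r) : Measurable (levelCount hH0 Λ E r) := by
  have hreal : Measurable fun ω => (levelCount hH0 Λ E r ω : ℝ) := by
    have hκ : ∀ k : ℕ, 0 < 1 / ((k : ℝ) + 1) := fun k => by positivity
    choose m t a ht _ hφ using fun k => exists_cauchy_approx hr (hκ k)
    refine measurable_of_tendsto_metrizable (f := fun k ω =>
      ∑ j, a k j * ∑ n : Λ, (green H0 ω Λ (spectralPoint E (t k j)) n n).im) (fun k => ?_) ?_
    · refine Finset.measurable_sum _ fun j _ => Measurable.const_mul ?_ _
      exact Finset.measurable_sum _ fun n _ => measurable_im_green hH0 Λ (ht k j) n n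
    · rw [tendsto_pi_nhds]
      intro ω
      have hA := finiteVolume_isHermitian hH0 ω Λ
      have e1 : ∀ k, ∑ j, a k j * ∑ n : Λ, (green H0 ω Λ (spectralPoint E (t k j)) n n).im
          = ∑ i, ∑ j, a k j * (t k j / ((hA.eigenvalues i - E) ^ 2 + t k j ^ 2)) := by
        intro k
        rw [Finset.sum_comm]
        refine Finset.sum_congr rfl fun j _ => ?_
        rw [← Finset.mul_sum, sum_cauchy_eigenvalues hA E (ht k j)]
        rfl
      simp only [e1, levelCount, eigenCount_eq_sum]
      refine tendsto_finsetSum _ fun i _ => ?_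
      rw [tendsto_iff_norm_sub_tendsto_zero]
      refine squeeze_zero' (.of_forall fun _ => norm_nonneg _) ?_
        tendsto_one_div_add_atTop_nhds_zero_nat
      -- The interval is open, so each fixed eigenvalue eventually leaves the shrinking transition
      -- layer just inside its endpoints.
      have hev : ∀ᶠ k : ℕ in atTop, |hA.eigenvalues i - E| ≤ r - 1 / ((k : ℝ) + 1)
          ∨ r ≤ |hA.eigenvalues i - E| := by
        rcases lt_or_ge (|hA.eigenvalues i - E|) r with h | h
        · have := (tendsto_one_div_add_atTop_nhds_zero_nat (𝕜 := ℝ)).eventually_lt_const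
            (sub_pos.2 h)
          filter_upwards [this] with k hk
          left; linarith
        · exact .of_forall fun _ => .inr h
      filter_upwards [hev] with k hk
      rw [norm_sub_rev]
      exact hφ k _ hk
  have : levelCount hH0 Λ E r = fun ω => ⌊(levelCount hH0 Λ E r ω : ℝ)⌋₊ := by
    funext ω; rw [Nat.floor_natCast]
  rw [this]
  exact Nat.measurable_floor.comp hreal

theorem levelCount_le_sum (hH0 : IsSelfAdjoint H0) (Λ : Finset (Fin d → ℤ)) (E : ℝ) {r : ℝ}
    (hr : 0 < r) (ω : (Fin d → ℤ) → ℝ) :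
    (levelCount hH0 Λ E r ω : ℝ) ≤ ∑ n : Λ, 2 * r * (green H0 ω Λ (spectralPoint E r) n n).im := by
  have hA := finiteVolume_isHermitian hH0 ω Λ
  rw [← Finset.mul_sum]
  change _ ≤ 2 * r * ∑ n, (resolventMatrix _ (spectralPoint E r) n n).im
  rw [← sum_cauchy_eigenvalues hA E hr, levelCount, eigenCount_eq_sum, Finset.mul_sum]
  refine Finset.sum_le_sum fun i _ => ?_
  split_ifs with h
  · rw [mul_assoc]; exact one_le_two_mul_cauchy hr h.le
  · positivity

theorem levelCount_le_update (hH0 : IsSelfAdjoint H0)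
    (Λ : Finset (Fin d → ℤ)) (E r : ℝ) (ω : (Fin d → ℤ) → ℝ) (n : Λ) (τ : ℝ) :
    levelCount hH0 Λ E r ω ≤ levelCount hH0 Λ E r (Function.update ω n τ) + 1 := by
  have hB := finiteVolume_isHermitian hH0 (Function.update ω n τ) Λ
  have e := finiteVolume_update (H0 := H0) ω Λ n τ
  have h := eigenCount_le_add_one (finiteVolume_isHermitian hH0 ω Λ) (e ▸ hB) E r
  rwa [eigenCount_congr _ hB e.symm] at h

theorem lintegral_levelCount_le (hH0 : IsSelfAdjoint H0) {K : ℝ} (hK : WegnerBound H0 μ α K)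
    (Λ : Finset (Fin d → ℤ)) (E : ℝ) {r : ℝ} (hr : 0 < r) :
    ∫⁻ ω, (levelCount hH0 Λ E r ω : ℝ≥0∞) ∂(law d μ)
      ≤ Λ.card * ENNReal.ofReal (2 * K * r ^ α) := by
  calc ∫⁻ ω, (levelCount hH0 Λ E r ω : ℝ≥0∞) ∂(law d μ)
      ≤ ∫⁻ ω, ∑ n : Λ, ENNReal.ofReal (2 * r)
          * ENNReal.ofReal (green H0 ω Λ (spectralPoint E r) n n).im ∂(law d μ) := by
        refine lintegral_mono fun ω => ?_
        rw [← ENNReal.ofReal_natCast]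
        refine (ENNReal.ofReal_le_ofReal (levelCount_le_sum hH0 Λ E hr ω)).trans ?_
        rw [ENNReal.ofReal_sum_of_nonneg fun n _ => mul_nonneg (by positivity)
          (im_green_nonneg hH0 ω Λ hr n)]
        exact Finset.sum_le_sum fun n _ => (ENNReal.ofReal_mul (by positivity)).le
    _ = ∑ n : Λ, ENNReal.ofReal (2 * r)
          * ∫⁻ ω, ENNReal.ofReal (green H0 ω Λ (spectralPoint E r) n n).im ∂(law d μ) := by
        rw [lintegral_finsetSum]
        · refine Finset.sum_congr rfl fun n _ => ?_
          exact lintegral_const_mul _ (measurable_im_green hH0 Λ hr n n).ennreal_ofReal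
        · exact fun n _ => (measurable_im_green hH0 Λ hr n n).ennreal_ofReal.const_mul _
    _ ≤ ∑ n : Λ, ENNReal.ofReal (2 * r) * ENNReal.ofReal (K * r ^ (α - 1)) := by
        gcongr with n
        exact hK.2 Λ n (spectralPoint E r) hr
    _ = Λ.card * ENNReal.ofReal (2 * K * r ^ α) := by
        rw [Finset.sum_const, ← ENNReal.ofReal_mul (by positivity), nsmul_eq_mul,
          Finset.card_univ, Fintype.card_coe]
        congr 2
        rw [Real.rpow_sub_one hr.ne']
        field_simp

/-- The Minami estimate. -/
theorem exists_wegner_minami (hH0 : IsSelfAdjoint H0) (hα1 : α ≤ 1) (hμ : IsUniformlyHolder α μ) :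
    ∃ K : ℝ, WegnerBound H0 μ α K ∧
      ∀ (Λ : Finset (Fin d → ℤ)) (E r : ℝ), 0 < r →
        ∫⁻ ω, (levelCount hH0 Λ E r ω : ℝ≥0∞) * ((levelCount hH0 Λ E r ω - 1 : ℕ) : ℝ≥0∞)
          ∂(law d μ) ≤ (Λ.card * ENNReal.ofReal (2 * K * r ^ α)) ^ 2 := by
  obtain ⟨K, hK, hav⟩ := exists_spectral_averaging (d := d) hH0 hα1 hμ
  have hW := wegnerBound_of_spectral_averaging hH0 hK hav
  refine ⟨K, hW, fun Λ E r hr => ?_⟩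
  set z := spectralPoint E r
  let X : ((Fin d → ℤ) → ℝ) → ℝ≥0∞ := fun ω => (levelCount hH0 Λ E r ω : ℝ≥0∞)
  have hX : Measurable X := measurable_from_top.comp (measurable_levelCount hH0 Λ E hr)
  let F : Λ → ((Fin d → ℤ) → ℝ) → ℝ≥0∞ := fun n ω =>
    ENNReal.ofReal (2 * r) * ENNReal.ofReal (green H0 ω Λ z n n).im
  have hF : ∀ n, Measurable (F n) := fun n =>
    (measurable_im_green hH0 Λ hr n n).ennreal_ofReal.const_mul _
  let Y : Λ → ((Fin d → ℤ) → ℝ) → ℝ≥0∞ := fun n ω => ∫⁻ τ, X (Function.update ω n τ) ∂μ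
  have hY : ∀ n, Measurable (Y n) := fun n => by
    have : Measurable fun p : ((Fin d → ℤ) → ℝ) × ℝ => X (Function.update p.1 n p.2) :=
      hX.comp measurable_update'
    exact this.lintegral_prod_right'
  have hXF : ∀ ω, X ω ≤ ∑ n, F n ω := by
    intro ω
    simp only [X, F]
    rw [← ENNReal.ofReal_natCast]
    refine (ENNReal.ofReal_le_ofReal (levelCount_le_sum hH0 Λ E hr ω)).trans ?_
    rw [ENNReal.ofReal_sum_of_nonneg fun n _ => mul_nonneg (by positivity)
      (im_green_nonneg hH0 ω Λ hr n)]
    exact Finset.sum_le_sum fun n _ => (ENNReal.ofReal_mul (by positivity)).le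
  -- Resampling ω n loses at most one level, so X - 1 is bounded by the resampled average Y n, which
  -- no longer depends on ω n.
  have hXY : ∀ n ω, ((levelCount hH0 Λ E r ω - 1 : ℕ) : ℝ≥0∞) ≤ Y n ω := by
    intro n ω
    calc ((levelCount hH0 Λ E r ω - 1 : ℕ) : ℝ≥0∞)
        = ∫⁻ _, ((levelCount hH0 Λ E r ω - 1 : ℕ) : ℝ≥0∞) ∂μ := by simp
      _ ≤ Y n ω := lintegral_mono fun τ => by
          have := levelCount_le_update hH0 Λ E r ω n τ
          exact Nat.cast_le.2 (by omega)
  have hYinv : ∀ (n : Λ) ω t, Y n (Function.update ω n t) = Y n ω := by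
    intro n ω t
    simp only [Y, Function.update_idem]
  set W := ENNReal.ofReal (2 * K * r ^ α) with hWdef
  have hFW : ∀ (n : Λ) ω, ∫⁻ t, F n (Function.update ω n t) ∂μ ≤ W := by
    intro n ω
    simp only [F]
    rw [lintegral_const_mul' _ _ ENNReal.ofReal_ne_top]
    calc _ ≤ ENNReal.ofReal (2 * r) * ENNReal.ofReal (K * r ^ (α - 1)) := by
          gcongr; exact hav Λ n z hr ω
      _ = W := by
          rw [← ENNReal.ofReal_mul (by positivity), hWdef]
          congr 1
          rw [Real.rpow_sub_one hr.ne']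
          field_simp
  have hEX : ∫⁻ ω, X ω ∂(law d μ) ≤ Λ.card * W := lintegral_levelCount_le hH0 hW Λ E hr
  calc ∫⁻ ω, (levelCount hH0 Λ E r ω : ℝ≥0∞) * ((levelCount hH0 Λ E r ω - 1 : ℕ) : ℝ≥0∞)
        ∂(law d μ)
      ≤ ∫⁻ ω, ∑ n, F n ω * Y n ω ∂(law d μ) := by
        refine lintegral_mono fun ω => ?_
        refine (mul_le_mul_left (hXF ω) _).trans ?_
        rw [Finset.sum_mul]
        exact Finset.sum_le_sum fun n _ => mul_le_mul_right (hXY n ω) _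
    _ = ∑ n, ∫⁻ ω, F n ω * Y n ω ∂(law d μ) :=
        lintegral_finsetSum _ fun n _ => (hF n).mul (hY n)
    -- Integrating ω n first acts on F n alone and costs W by spectral averaging; what remains is
    -- the mean of Y n, equal to the mean of X.
    _ ≤ ∑ _n : Λ, W * (Λ.card * W) := by
        refine Finset.sum_le_sum fun n _ => ?_
        rw [law, ← lintegral_update_infinitePi (f := fun ω => F n ω * Y n ω) (n : Fin d → ℤ)
          ((hF n).mul (hY n))]
        calc _ ≤ ∫⁻ ω, W * Y n ω ∂(law d μ) := by
              refine lintegral_mono fun ω => ?_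
              simp only [hYinv]
              rw [lintegral_mul_const (f := fun t => F n (Function.update ω n t)) _
                ((hF n).comp (measurable_update _))]
              exact mul_le_mul_left (hFW n ω) _
          _ = W * ∫⁻ ω, X ω ∂(law d μ) := by
              rw [lintegral_const_mul _ (hY n)]
              simp only [Y]
              rw [law, lintegral_update_infinitePi (n : Fin d → ℤ) hX]
          _ ≤ _ := mul_le_mul_right hEX _
    _ = (Λ.card * W) ^ 2 := by
        rw [Finset.sum_const, nsmul_eq_mul, Finset.card_univ, Fintype.card_coe]
        ring

end FiniteVolume

/-! ### Consequences of localization -/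

section Localization

variable {d : ℕ} {H0 : L2 d →L[ℂ] L2 d}

theorem summable_exp_neg_mul_norm_int {δ : ℝ} (hδ : 0 < δ) :
    Summable fun j : ℤ => Real.exp (-δ * ‖j‖) := by
  have h : Summable fun n : ℕ => Real.exp (-δ * n) := by
    have := (Real.summable_exp_nat_mul_iff (a := -δ)).2 (by linarith)
    simpa only [mul_comm] using this
  refine summable_int_iff_summable_nat_and_neg.2 ⟨?_, ?_⟩
  · simpa [Int.norm_natCast] using h
  · simpa [Int.norm_natCast] using h

/-- The sup norm dominates the average of the coordinate distances, so the exponential is at most a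
product of one-dimensional ones with rate γ/d. -/
theorem exists_sum_exp_le (d : ℕ) {γ : ℝ} (hγ : 0 < γ) :
    ∃ M : ℝ, 0 ≤ M ∧ ∀ (T : Finset (Fin d → ℤ)) (n : Fin d → ℤ),
      ∑ k ∈ T, Real.exp (-γ * ‖n - k‖) ≤ M := by
  classical
  rcases Nat.eq_zero_or_pos d with rfl | hd
  · refine ⟨1, zero_le_one, fun T n => ?_⟩
    have : T ⊆ {n} := fun k _ => Finset.mem_singleton.2 (Subsingleton.elim _ _)
    refine (Finset.sum_le_sum_of_subset_of_nonneg this fun _ _ _ => (Real.exp_pos _).le).trans ?_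
    rw [Finset.sum_singleton, Real.exp_le_one_iff]
    have : 0 ≤ γ * ‖n - n‖ := by positivity
    linarith
  have hd' : (0 : ℝ) < d := by exact_mod_cast hd
  set δ := γ / d with hδ
  have hδ0 : 0 < δ := by positivity
  have hs := summable_exp_neg_mul_norm_int hδ0
  set S := ∑' j : ℤ, Real.exp (-δ * ‖j‖)
  have hS : 0 ≤ S := tsum_nonneg fun _ => (Real.exp_pos _).le
  refine ⟨S ^ d, by positivity, fun T n => ?_⟩
  have hpt : ∀ k : Fin d → ℤ, Real.exp (-γ * ‖n - k‖) ≤ ∏ i, Real.exp (-δ * ‖n i - k i‖) := by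
    intro k
    rw [← Real.exp_sum, Real.exp_le_exp, ← Finset.mul_sum]
    have h1 : ∑ i, ‖n i - k i‖ ≤ d * ‖n - k‖ := by
      refine (Finset.sum_le_card_nsmul _ _ ‖n - k‖ fun i _ => ?_).trans (by simp)
      exact norm_le_pi_norm (n - k) i
    have h2 : δ * ∑ i, ‖n i - k i‖ ≤ γ * ‖n - k‖ := by
      calc _ ≤ δ * (d * ‖n - k‖) := by gcongr
        _ = _ := by rw [hδ]; field_simp
    linarith
  have hsub : T ⊆ Fintype.piFinset fun i => T.image fun k => k i := fun k hk =>
    Fintype.mem_piFinset.2 fun i => Finset.mem_image_of_mem (fun k : Fin d → ℤ => k i) hk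
  calc ∑ k ∈ T, Real.exp (-γ * ‖n - k‖) ≤ ∑ k ∈ T, ∏ i, Real.exp (-δ * ‖n i - k i‖) :=
        Finset.sum_le_sum fun k _ => hpt k
    _ ≤ ∑ k ∈ Fintype.piFinset fun i => T.image fun k => k i, ∏ i, Real.exp (-δ * ‖n i - k i‖) :=
        Finset.sum_le_sum_of_subset_of_nonneg hsub fun _ _ _ =>
          Finset.prod_nonneg fun _ _ => (Real.exp_pos _).le
    _ = ∏ i, ∑ j ∈ T.image fun k => k i, Real.exp (-δ * ‖n i - j‖) :=
        (Finset.prod_univ_sum _ fun i j => Real.exp (-δ * ‖n i - j‖)).symm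
    _ ≤ ∏ _i : Fin d, S := by
        refine Finset.prod_le_prod (fun _ _ => Finset.sum_nonneg fun _ _ => (Real.exp_pos _).le)
          fun i _ => ?_
        have hs' : Summable fun j : ℤ => Real.exp (-δ * ‖n i - j‖) :=
          ((Equiv.subLeft (n i)).summable_iff (f := fun j : ℤ => Real.exp (-δ * ‖j‖))).2 hs
        refine (hs'.sum_le_tsum _ fun _ _ => (Real.exp_pos _).le).trans (le_of_eq ?_)
        exact (Equiv.subLeft (n i)).tsum_eq fun j : ℤ => Real.exp (-δ * ‖j‖)
    _ = S ^ d := by simp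

/-- A Hölder inequality in additive form: with a threshold δ to be optimized, it passes from a
moment of order p to the first moment. -/
theorem le_add_mul_rpow {A δ p : ℝ} (hA : 0 ≤ A) (hδ : 0 < δ) (hp : 1 ≤ p) :
    A ≤ δ + δ ^ (1 - p) * A ^ p := by
  rcases le_or_gt A δ with h | h
  · have : 0 ≤ δ ^ (1 - p) * A ^ p := by positivity
    linarith
  · have hA' : 0 < A := hδ.trans h
    calc A = A ^ (1 - p) * A ^ p := by
          rw [← Real.rpow_add hA', sub_add_cancel, Real.rpow_one]
      _ ≤ δ ^ (1 - p) * A ^ p := by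
          exact mul_le_mul_of_nonneg_right
            (Real.rpow_le_rpow_of_nonpos hδ h.le (sub_nonpos.2 hp)) (by positivity)
      _ ≤ _ := le_add_of_nonneg_left hδ.le

/-- The deterministic bound |G| Im z ≤ 1 converts decay of the s-th moment into decay of the first
moment, for s on either side of 1, at the price of a factor 1/Im z and a smaller rate. The price is
harmless because Im z will be only polynomially small in L. -/
theorem exists_green_decay (hH0 : IsSelfAdjoint H0) {μ : Measure ℝ} [IsProbabilityMeasure μ]
    {a b : ℝ} (hloc : FractionalMomentDecay H0 μ a b) :
    ∃ (C γ : ℝ) (ℓ₀ : ℕ), 0 ≤ C ∧ 0 < γ ∧ ∀ (c : Fin d → ℤ) (ℓ : ℕ), ℓ₀ ≤ ℓ →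
      ∀ n m : cube c ℓ, ∀ z : ℂ, 0 < z.im → z.im ≤ 1 → z.re ∈ Set.Icc a b →
        ∫⁻ ω, ENNReal.ofReal ‖green H0 ω (cube c ℓ) z n m‖ ∂(law d μ)
          ≤ ENNReal.ofReal
            (C / z.im * Real.exp (-γ * ‖(n : Fin d → ℤ) - (m : Fin d → ℤ)‖)) := by
  obtain ⟨s, C, γ, ℓ₀, hs, hγ, h⟩ := hloc
  set p := max s 1 with hp
  have hp1 : 1 ≤ p := le_max_right _ _
  have hp0 : 0 < p := by linarith
  refine ⟨1 + |C|, γ / p, ℓ₀, by positivity, by positivity, fun c ℓ hℓ n m z hz hz1 hzre => ?_⟩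
  set R := ‖(n : Fin d → ℤ) - (m : Fin d → ℤ)‖ with hR
  -- The threshold that balances the two terms: δ^(1-p) exp(-γR) = δ.
  set δ := Real.exp (-(γ / p) * R) with hδ
  have hδ0 : 0 < δ := Real.exp_pos _
  have hpt : ∀ ω, ‖green H0 ω (cube c ℓ) z n m‖
      ≤ z.im⁻¹ * δ + z.im⁻¹ * δ ^ (1 - p) * ‖green H0 ω (cube c ℓ) z n m‖ ^ s := by
    intro ω
    have h1 := norm_green_le hH0 ω (cube c ℓ) hz n m
    set g := ‖green H0 ω (cube c ℓ) z n m‖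
    have hg0 : 0 ≤ g := norm_nonneg _
    have hgz : g * z.im ≤ 1 := by rwa [le_div_iff₀ hz] at h1
    have hgz0 : 0 ≤ g * z.im := by positivity
    have h2 := le_add_mul_rpow hgz0 hδ0 hp1
    have h3 : (g * z.im) ^ p ≤ g ^ s := by
      rcases hgz0.eq_or_lt with h0 | h0
      · rw [← h0, Real.zero_rpow hp0.ne']; positivity
      · calc (g * z.im) ^ p ≤ (g * z.im) ^ s :=
              Real.rpow_le_rpow_of_exponent_ge h0 hgz (le_max_left _ _)
          _ ≤ g ^ s := Real.rpow_le_rpow hgz0 (mul_le_of_le_one_right hg0 hz1) hs.le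
    have h4 : g * z.im ≤ δ + δ ^ (1 - p) * g ^ s :=
      h2.trans (by gcongr)
    calc g = z.im⁻¹ * (g * z.im) := by field_simp
      _ ≤ z.im⁻¹ * (δ + δ ^ (1 - p) * g ^ s) := by gcongr
      _ = _ := by ring
  have hnn : 0 ≤ z.im⁻¹ * δ ^ (1 - p) := by positivity
  calc ∫⁻ ω, ENNReal.ofReal ‖green H0 ω (cube c ℓ) z n m‖ ∂(law d μ)
      ≤ ∫⁻ ω, (ENNReal.ofReal (z.im⁻¹ * δ) + ENNReal.ofReal (z.im⁻¹ * δ ^ (1 - p))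
          * ENNReal.ofReal (‖green H0 ω (cube c ℓ) z n m‖ ^ s)) ∂(law d μ) := by
        refine lintegral_mono fun ω => (ENNReal.ofReal_le_ofReal (hpt ω)).trans ?_
        rw [← ENNReal.ofReal_mul hnn, ENNReal.ofReal_add (by positivity) (by positivity)]
    _ = ENNReal.ofReal (z.im⁻¹ * δ) + ENNReal.ofReal (z.im⁻¹ * δ ^ (1 - p))
          * ∫⁻ ω, ENNReal.ofReal (‖green H0 ω (cube c ℓ) z n m‖ ^ s) ∂(law d μ) := by
        rw [lintegral_add_left measurable_const, lintegral_const, measure_univ, mul_one,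
          lintegral_const_mul' _ _ ENNReal.ofReal_ne_top]
    _ ≤ ENNReal.ofReal (z.im⁻¹ * δ) + ENNReal.ofReal (z.im⁻¹ * δ ^ (1 - p))
          * ENNReal.ofReal (|C| * Real.exp (-γ * R)) := by
        gcongr
        refine (h c ℓ hℓ n m z hz hzre).trans (ENNReal.ofReal_le_ofReal ?_)
        gcongr
        exact le_abs_self C
    _ = ENNReal.ofReal ((1 + |C|) / z.im * δ) := by
        rw [← ENNReal.ofReal_mul hnn, ← ENNReal.ofReal_add (by positivity) (by positivity)]
        congr 1
        have e : δ ^ (1 - p) * Real.exp (-γ * R) = δ := by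
          rw [hδ, ← Real.exp_mul, ← Real.exp_add]
          congr 1
          field_simp
          ring
        calc _ = z.im⁻¹ * δ + z.im⁻¹ * |C| * (δ ^ (1 - p) * Real.exp (-γ * R)) := by ring
          _ = _ := by rw [e]; field_simp

/-- The entries of `H^ω - z`. -/
noncomputable def shiftedEntry (H0 : L2 d →L[ℂ] L2 d) (ω : (Fin d → ℤ) → ℝ) (z : ℂ)
    (k l : Fin d → ℤ) : ℂ :=
  inner ℂ (delta k) (H0 (delta l)) + if k = l then (ω k : ℂ) - z else 0

theorem finiteVolume_sub_apply (ω : (Fin d → ℤ) → ℝ) (Λ : Finset (Fin d → ℤ)) (z : ℂ) (k l : Λ) :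
    (finiteVolume H0 ω Λ - z • (1 : Matrix Λ Λ ℂ)) k l = shiftedEntry H0 ω z k l := by
  rw [Matrix.sub_apply, finiteVolume_apply, Matrix.smul_apply, Matrix.one_apply, shiftedEntry,
    add_sub_assoc]
  congr 1
  by_cases h : k = l
  · simp [h]
  · have : (k : Fin d → ℤ) ≠ l := fun e => h (Subtype.ext e)
    simp [h, this]

theorem norm_delta (m : Fin d → ℤ) : ‖(delta m : L2 d)‖ = 1 := by
  rw [delta, lp.norm_single (by norm_num), norm_one]

theorem norm_inner_delta_le (k l : Fin d → ℤ) :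
    ‖(inner ℂ (delta k) (H0 (delta l)) : ℂ)‖ ≤ ‖H0‖ := by
  refine (norm_inner_le_norm _ _).trans ?_
  rw [norm_delta, one_mul]
  exact (H0.le_opNorm _).trans (by rw [norm_delta, mul_one])

/-- The extension by zero of a column of the finite volume Green function. -/
noncomputable def greenColumn (H0 : L2 d →L[ℂ] L2 d) (ω : (Fin d → ℤ) → ℝ)
    (S : Finset (Fin d → ℤ)) (z : ℂ) (n : S) (k : Fin d → ℤ) : ℂ :=
  if h : k ∈ S then green H0 ω S z ⟨k, h⟩ n else 0

theorem sum_shiftedEntry_mul_greenColumn (hH0 : IsSelfAdjoint H0) (ω : (Fin d → ℤ) → ℝ)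
    {S Λ : Finset (Fin d → ℤ)} (hS : S ⊆ Λ) {z : ℂ} (hz : 0 < z.im) (n : S) {k : Fin d → ℤ}
    (hk : k ∈ S) :
    ∑ l ∈ Λ, shiftedEntry H0 ω z k l * greenColumn H0 ω S z n l = if k = n then 1 else 0 := by
  rw [← Finset.sum_subset hS, ← Finset.sum_coe_sort]
  · have h := congrFun (congrFun (sub_mul_resolventMatrix (finiteVolume_isHermitian hH0 ω S) hz)
      ⟨k, hk⟩) n
    rw [Matrix.mul_apply, Matrix.one_apply] at h
    simp only [finiteVolume_sub_apply] at h
    simp only [Subtype.ext_iff] at h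
    rw [← h]
    refine Finset.sum_congr rfl fun l _ => ?_
    rw [greenColumn, dif_pos l.2]
    rfl
  · intro l _ hl
    rw [greenColumn, dif_neg hl, mul_zero]

/-- Extend the S-column of the Green function by zero and apply H_Λ - z. The result is δ_n on S, and
at a site outside S it is a sum over S of hopping terms, each at most ‖H0‖/Im z. Applying the
resolvent of Λ gives the difference. The hopping has no finite range, so every site of Λ outside S
contributes. -/
theorem norm_green_sub_green_le (hH0 : IsSelfAdjoint H0) (ω : (Fin d → ℤ) → ℝ)
    {S Λ : Finset (Fin d → ℤ)} (hS : S ⊆ Λ) {z : ℂ} (hz : 0 < z.im) (n : S) :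
    ‖green H0 ω S z n n - green H0 ω Λ z ⟨n, hS n.2⟩ ⟨n, hS n.2⟩‖
      ≤ S.card * (‖H0‖ / z.im)
        * ∑ k ∈ (Finset.univ : Finset Λ).filter (fun k : Λ => (k : Fin d → ℤ) ∉ S),
          ‖green H0 ω Λ z ⟨n, hS n.2⟩ k‖ := by
  set n' : Λ := ⟨n, hS n.2⟩ with hn'
  set u : Λ → ℂ := fun k => greenColumn H0 ω S z n k with hu
  set w : Λ → ℂ := fun k => ∑ l ∈ Λ, shiftedEntry H0 ω z k l * greenColumn H0 ω S z n l with hw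
  have h1 : (finiteVolume H0 ω Λ - z • (1 : Matrix Λ Λ ℂ)).mulVec u = w := by
    funext k
    rw [Matrix.mulVec, dotProduct, hw]
    simp only [finiteVolume_sub_apply, hu]
    exact Finset.sum_coe_sort Λ fun l => shiftedEntry H0 ω z k l * greenColumn H0 ω S z n l
  have h2 : u = (resolventMatrix (finiteVolume H0 ω Λ) z).mulVec w := by
    rw [← h1, Matrix.mulVec_mulVec,
      resolventMatrix_mul_sub (finiteVolume_isHermitian hH0 ω Λ) hz, Matrix.one_mulVec]
  have h3 : green H0 ω S z n n = ∑ k : Λ, green H0 ω Λ z n' k * w k := by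
    have := congrFun h2 n'
    rw [hu] at this
    simp only [greenColumn, hn', n.2, dite_true] at this
    exact this
  have hwS : ∀ k : Λ, (k : Fin d → ℤ) ∈ S → w k = if k = n' then 1 else 0 := by
    intro k hk
    rw [hw]
    simp only [sum_shiftedEntry_mul_greenColumn hH0 ω hS hz n hk, Subtype.ext_iff, hn']
  have hwN : ∀ k : Λ, (k : Fin d → ℤ) ∉ S → ‖w k‖ ≤ S.card * (‖H0‖ / z.im) := by
    intro k hk
    have e : w k = ∑ l ∈ S, shiftedEntry H0 ω z k l * greenColumn H0 ω S z n l := by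
      rw [hw]
      refine (Finset.sum_subset hS fun l _ hl => ?_).symm
      rw [greenColumn, dif_neg hl, mul_zero]
    rw [e]
    refine (norm_sum_le _ _).trans ((Finset.sum_le_card_nsmul _ _ (‖H0‖ / z.im)
      fun l hl => ?_).trans (by rw [nsmul_eq_mul]))
    have hkl : (k : Fin d → ℤ) ≠ l := fun h => hk (h ▸ hl)
    rw [norm_mul, shiftedEntry, if_neg hkl, add_zero, greenColumn, dif_pos hl, div_eq_mul_one_div]
    exact mul_le_mul (norm_inner_delta_le _ _) (norm_green_le hH0 ω S hz _ _) (norm_nonneg _)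
      (norm_nonneg _)
  have h4 : green H0 ω S z n n - green H0 ω Λ z n' n'
      = ∑ k ∈ (Finset.univ : Finset Λ).filter (fun k : Λ => (k : Fin d → ℤ) ∉ S),
        green H0 ω Λ z n' k * w k := by
    rw [h3, ← Finset.sum_filter_not_add_sum_filter _ (fun k : Λ => (k : Fin d → ℤ) ∉ S),
      add_sub_right_comm, add_eq_right, sub_eq_zero]
    rw [Finset.sum_eq_single n']
    · rw [hwS n' n.2, if_pos rfl, mul_one]
    · intro k hk hkn
      rw [hwS k (not_not.1 (Finset.mem_filter.1 hk).2), if_neg hkn, mul_zero]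
    · intro h
      exact absurd (by simp [hn']) h
  rw [h4, Finset.mul_sum]
  refine (norm_sum_le _ _).trans (Finset.sum_le_sum fun k hk => ?_)
  rw [norm_mul, mul_comm]
  exact mul_le_mul_of_nonneg_right (hwN k (Finset.mem_filter.1 hk).2) (norm_nonneg _)

/-- In the localized regime the diagonal of the Green function of a large cube is well approximated
by that of a subset containing a large neighbourhood of the site. -/
theorem exists_green_comparison (hH0 : IsSelfAdjoint H0) {μ : Measure ℝ} [IsProbabilityMeasure μ]
    {a b : ℝ} (hloc : FractionalMomentDecay H0 μ a b) :
    ∃ (C γ : ℝ) (ℓ₀ : ℕ), 0 ≤ C ∧ 0 < γ ∧ ∀ (c : Fin d → ℤ) (ℓ : ℕ), ℓ₀ ≤ ℓ →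
      ∀ (S : Finset (Fin d → ℤ)) (hS : S ⊆ cube c ℓ) (n : S) (D : ℝ),
        (∀ k ∉ S, D ≤ ‖(n : Fin d → ℤ) - k‖) →
        ∀ z : ℂ, 0 < z.im → z.im ≤ 1 → z.re ∈ Set.Icc a b →
          ∫ ω, |(green H0 ω S z n n).im
              - (green H0 ω (cube c ℓ) z ⟨n, hS n.2⟩ ⟨n, hS n.2⟩).im| ∂(law d μ)
            ≤ C * S.card / z.im ^ 2 * Real.exp (-γ * D) := by
  obtain ⟨C, γ, ℓ₀, hC, hγ, h⟩ := exists_green_decay hH0 hloc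
  -- Half of the decay rate produces exp(-γD/2), the other half makes the sum over sites outside S
  -- bounded.
  obtain ⟨M, hM, hMsum⟩ := exists_sum_exp_le d (γ := γ / 2) (by positivity)
  refine ⟨‖H0‖ * C * M, γ / 2, ℓ₀, by positivity, by positivity,
    fun c ℓ hℓ S hS n D hD z hz hz1 hzre => ?_⟩
  set Λ := cube c ℓ with hΛ
  set n' : Λ := ⟨n, hS n.2⟩ with hn'
  set F := (Finset.univ : Finset Λ).filter (fun k : Λ => (k : Fin d → ℤ) ∉ S) with hF
  have hint : ∀ k, Integrable (fun ω => ‖green H0 ω Λ z n' k‖) (law d μ) := fun k =>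
    .of_bound (measurable_green hH0 Λ hz n' k).norm.aestronglyMeasurable (1 / z.im)
      (.of_forall fun ω => by rw [norm_norm]; exact norm_green_le hH0 ω Λ hz n' k)
  have hE : ∀ k, ∫ ω, ‖green H0 ω Λ z n' k‖ ∂(law d μ)
      ≤ C / z.im * Real.exp (-γ * ‖(n : Fin d → ℤ) - k‖) := by
    intro k
    have := h c ℓ hℓ n' k z hz hz1 hzre
    rw [← ofReal_integral_eq_lintegral_ofReal (hint k) (.of_forall fun ω => norm_nonneg _)] at this
    exact (ENNReal.ofReal_le_ofReal_iff (by positivity)).1 this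
  calc ∫ ω, |(green H0 ω S z n n).im - (green H0 ω Λ z n' n').im| ∂(law d μ)
      ≤ ∫ ω, S.card * (‖H0‖ / z.im) * ∑ k ∈ F, ‖green H0 ω Λ z n' k‖ ∂(law d μ) := by
        refine integral_mono_of_nonneg (.of_forall fun ω => abs_nonneg _)
          ((integrable_finsetSum _ fun k _ => hint k).const_mul _) (.of_forall fun ω => ?_)
        dsimp only
        rw [← Complex.sub_im]
        exact (Complex.abs_im_le_norm _).trans (norm_green_sub_green_le hH0 ω hS hz n)
    _ = S.card * (‖H0‖ / z.im) * ∑ k ∈ F, ∫ ω, ‖green H0 ω Λ z n' k‖ ∂(law d μ) := by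
        rw [integral_const_mul, integral_finsetSum _ fun k _ => hint k]
    _ ≤ S.card * (‖H0‖ / z.im) * ∑ k ∈ F, C / z.im * (Real.exp (-(γ / 2) * D)
          * Real.exp (-(γ / 2) * ‖(n : Fin d → ℤ) - k‖)) := by
        gcongr with k hk
        refine (hE k).trans ?_
        gcongr
        rw [← Real.exp_add, Real.exp_le_exp]
        have := hD k (Finset.mem_filter.1 hk).2
        nlinarith
    _ = S.card * (‖H0‖ / z.im) * (C / z.im * (Real.exp (-(γ / 2) * D)
          * ∑ k ∈ F, Real.exp (-(γ / 2) * ‖(n : Fin d → ℤ) - k‖))) := by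
        simp only [Finset.mul_sum]
    _ ≤ S.card * (‖H0‖ / z.im) * (C / z.im * (Real.exp (-(γ / 2) * D) * M)) := by
        gcongr
        have e : ∑ k ∈ F, Real.exp (-(γ / 2) * ‖(n : Fin d → ℤ) - k‖)
            = ∑ k ∈ F.map (Function.Embedding.subtype _),
              Real.exp (-(γ / 2) * ‖(n : Fin d → ℤ) - k‖) := by
          rw [Finset.sum_map]; rfl
        rw [e]
        exact hMsum _ _
    _ = _ := by field_simp

end Localization

/-! ### Infinite volume -/

section InfiniteVolume

variable {d : ℕ} {H0 : L2 d →L[ℂ] L2 d}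

theorem inner_delta (k : Fin d → ℤ) (f : L2 d) : (inner ℂ (delta k) f : ℂ) = f k := by
  rw [delta, lp.inner_single_left]
  simp

theorem mem_cube {c k : Fin d → ℤ} {ℓ : ℕ} : k ∈ cube c ℓ ↔ ∀ i, c i ≤ k i ∧ k i < c i + ℓ := by
  simp [cube]

theorem mem_box {L : ℕ} {k : Fin d → ℤ} : k ∈ box d L ↔ ∀ i, -(L : ℤ) ≤ k i ∧ k i ≤ L := by
  rw [box, mem_cube]
  refine forall_congr' fun i => and_congr Iff.rfl ?_
  push_cast
  constructor <;> intro h <;> linarith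

theorem zero_mem_box (d L : ℕ) : (0 : Fin d → ℤ) ∈ box d L :=
  mem_box.2 fun i => by simp

theorem eventually_mem_box (k : Fin d → ℤ) : ∀ᶠ L : ℕ in atTop, k ∈ box d L := by
  have h : ∀ i, ∀ᶠ L : ℕ in atTop, -(L : ℤ) ≤ k i ∧ k i ≤ L := fun i => by
    filter_upwards [eventually_ge_atTop (k i).natAbs] with L hL
    omega
  filter_upwards [eventually_all.2 h] with L hL
  exact mem_box.2 hL

/-- Bounded sequences in a Hilbert space have weak limits along ultrafilters. -/
theorem exists_weak_limit {V : Type*} [NormedAddCommGroup V] [InnerProductSpace ℂ V]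
    [CompleteSpace V] {f : ℕ → V} {R : ℝ} (hf : ∀ n, ‖f n‖ ≤ R) (U : Ultrafilter ℕ) :
    ∃ g : V, ∀ x : V, Tendsto (fun n => inner ℂ x (f n)) U (𝓝 (inner ℂ x g)) := by
  let F : ℕ → WeakDual ℂ V := fun n => StrongDual.toWeakDual (InnerProductSpace.toDual ℂ V (f n))
  have hc := WeakDual.isCompact_closedBall (𝕜 := ℂ) (0 : StrongDual ℂ V) R
  have hF : ∀ n, F n ∈ WeakDual.toStrongDual ⁻¹' Metric.closedBall (0 : StrongDual ℂ V) R := by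
    intro n
    rw [Set.mem_preimage, mem_closedBall_zero_iff]
    change ‖InnerProductSpace.toDual ℂ V (f n)‖ ≤ R
    rw [LinearIsometryEquiv.norm_map]
    exact hf n
  obtain ⟨G, -, hG⟩ := hc.ultrafilter_le_nhds (U.map F)
    (by rw [Ultrafilter.coe_map, le_principal_iff]; exact Filter.mem_map.2 (Eventually.of_forall hF))
  refine ⟨(InnerProductSpace.toDual ℂ V).symm (WeakDual.toStrongDual G), fun x => ?_⟩
  have h1 : Tendsto (fun n => F n x) U (𝓝 (G x)) :=
    ((WeakDual.eval_continuous x).tendsto G).comp hG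
  have h2 : ∀ n, F n x = inner ℂ (f n) x := fun n => InnerProductSpace.toDual_apply_apply
  have h3 : G x = inner ℂ ((InnerProductSpace.toDual ℂ V).symm (WeakDual.toStrongDual G)) x :=
    (InnerProductSpace.toDual_symm_apply (y := WeakDual.toStrongDual G)).symm
  rw [h3] at h1
  simp only [h2] at h1
  simpa only [Function.comp_def, inner_conj_symm] using
    (Complex.continuous_conj.tendsto _).comp h1

/-- `φ` solves `(H^ω - z) φ = δ₀` coordinatewise. -/
def IsResolventSolution (H0 : L2 d →L[ℂ] L2 d) (ω : (Fin d → ℤ) → ℝ) (z : ℂ) (φ : L2 d) : Prop :=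
  ∀ k, H0 φ k + ((ω k : ℂ) - z) * φ k = delta (0 : Fin d → ℤ) k

/-- For a difference χ of solutions, ⟨χ, H0 χ⟩ is real, while the equation makes its imaginary part
Im z · ‖χ‖². Only the bounded operator H0 is paired, so the domain of the potential plays no role.
-/
theorem IsResolventSolution.unique (hH0 : IsSelfAdjoint H0) {ω : (Fin d → ℤ) → ℝ} {z : ℂ}
    (hz : 0 < z.im) {φ ψ : L2 d} (hφ : IsResolventSolution H0 ω z φ)
    (hψ : IsResolventSolution H0 ω z ψ) : φ = ψ := by
  set χ := φ - ψ with hχ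
  have h1 : ∀ k, H0 χ k + ((ω k : ℂ) - z) * χ k = 0 := fun k => by
    have e1 : H0 χ k = H0 φ k - H0 ψ k := by rw [hχ, map_sub]; rfl
    have e2 : χ k = φ k - ψ k := rfl
    rw [e1, e2]
    linear_combination hφ k - hψ k
  have h2 : ∀ k, (inner ℂ (χ k) (H0 χ k) : ℂ).im = z.im * ‖χ k‖ ^ 2 := fun k => by
    have e : H0 χ k = (z - ω k) * χ k := by linear_combination h1 k
    rw [e, RCLike.inner_apply, mul_assoc, Complex.mul_conj, Complex.im_mul_ofReal,
      Complex.normSq_eq_norm_sq]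
    simp
  have h3 : (inner ℂ χ (H0 χ) : ℂ).im = 0 := by
    have e : (starRingEnd ℂ) (inner ℂ χ (H0 χ)) = inner ℂ χ (H0 χ) := by
      rw [inner_conj_symm, ← ContinuousLinearMap.adjoint_inner_right,
        ContinuousLinearMap.isSelfAdjoint_iff'.1 hH0]
    exact Complex.conj_eq_iff_im.1 e
  have h4 : HasSum (fun k => z.im * ‖χ k‖ ^ 2) 0 := by
    rw [← h3]
    have := Complex.hasSum_im (lp.hasSum_inner χ (H0 χ))
    exact this.congr_fun fun k => (h2 k).symm
  have h5 : ∀ k, χ k = 0 := fun k => by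
    have := (hasSum_zero_iff_of_nonneg fun k => by positivity).1 h4
    have := congrFun this k
    simpa [hz.ne'] using this
  have : χ = 0 := by ext k; exact h5 k
  exact sub_eq_zero.1 this

/-- The column of the finite volume Green function as a vector of `ℓ²`. -/
noncomputable def greenVector (H0 : L2 d →L[ℂ] L2 d) (ω : (Fin d → ℤ) → ℝ) (z : ℂ) (L : ℕ) :
    L2 d :=
  ∑ k ∈ box d L, lp.single 2 k (greenColumn H0 ω (box d L) z ⟨0, zero_mem_box d L⟩ k)

theorem greenVector_apply (ω : (Fin d → ℤ) → ℝ) (z : ℂ) (L : ℕ) (k : Fin d → ℤ) :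
    greenVector H0 ω z L k = greenColumn H0 ω (box d L) z ⟨0, zero_mem_box d L⟩ k := by
  rw [← inner_delta, greenVector, inner_sum]
  simp only [inner_delta, lp.single_apply]
  rw [Finset.sum_eq_single k]
  · simp
  · intro l _ hl
    simp [Ne.symm hl]
  · intro hk
    simp [greenColumn, hk]

theorem norm_greenVector_le (hH0 : IsSelfAdjoint H0) (ω : (Fin d → ℤ) → ℝ) {z : ℂ} (hz : 0 < z.im)
    (L : ℕ) : ‖greenVector H0 ω z L‖ ≤ 1 / z.im := by
  have h := lp.norm_sum_single (p := 2) (E := fun _ : Fin d → ℤ => ℂ) (by norm_num)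
    (fun k => greenColumn H0 ω (box d L) z ⟨0, zero_mem_box d L⟩ k) (box d L)
  simp only [ENNReal.toReal_ofNat, Real.rpow_ofNat] at h
  refine le_of_sq_le_sq ?_ (by positivity)
  rw [greenVector, h, ← Finset.sum_coe_sort]
  refine le_trans (le_of_eq (Finset.sum_congr rfl fun k _ => ?_))
    (sum_norm_resolventMatrix_sq_le (finiteVolume_isHermitian hH0 ω (box d L)) hz
      ⟨0, zero_mem_box d L⟩)
  rw [greenColumn, dif_pos k.2]
  rfl

theorem apply_greenVector (ω : (Fin d → ℤ) → ℝ) (z : ℂ) (L : ℕ) (k : Fin d → ℤ) :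
    H0 (greenVector H0 ω z L) k = ∑ l ∈ box d L, inner ℂ (delta k) (H0 (delta l))
      * greenColumn H0 ω (box d L) z ⟨0, zero_mem_box d L⟩ l := by
  rw [← inner_delta, greenVector, map_sum, inner_sum]
  refine Finset.sum_congr rfl fun l _ => ?_
  have : (lp.single 2 l (greenColumn H0 ω (box d L) z ⟨0, zero_mem_box d L⟩ l) : L2 d)
      = greenColumn H0 ω (box d L) z ⟨0, zero_mem_box d L⟩ l • delta l := by
    rw [delta, ← lp.single_smul]; simp
  rw [this, map_smul, inner_smul_right, mul_comm]

theorem greenVector_equation (hH0 : IsSelfAdjoint H0) (ω : (Fin d → ℤ) → ℝ) {z : ℂ}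
    (hz : 0 < z.im) {L : ℕ} {k : Fin d → ℤ} (hk : k ∈ box d L) :
    H0 (greenVector H0 ω z L) k + ((ω k : ℂ) - z) * greenVector H0 ω z L k
      = delta (0 : Fin d → ℤ) k := by
  have h := sum_shiftedEntry_mul_greenColumn hH0 ω (Finset.Subset.refl (box d L)) hz
    ⟨0, zero_mem_box d L⟩ hk
  simp only [shiftedEntry, add_mul, ite_mul, zero_mul, Finset.sum_add_distrib, Finset.sum_ite_eq,
    hk, if_true] at h
  rw [apply_greenVector, greenVector_apply, h, delta, lp.single_apply, Pi.single_apply]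

/-- The finite volume columns are bounded by 1/Im z and satisfy the equation at k as soon as the box
contains k; a weak limit satisfies it everywhere. -/
theorem exists_resolventSolution_of_ultrafilter (hH0 : IsSelfAdjoint H0) (ω : (Fin d → ℤ) → ℝ)
    {z : ℂ} (hz : 0 < z.im) (U : Ultrafilter ℕ) (hU : (U : Filter ℕ) ≤ atTop) :
    ∃ φ, IsResolventSolution H0 ω z φ ∧
      Tendsto (fun L => greenVector H0 ω z L 0) U (𝓝 (φ 0)) := by
  obtain ⟨φ, hφ⟩ := exists_weak_limit (norm_greenVector_le hH0 ω hz) U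
  have hcoord : ∀ k, Tendsto (fun L => greenVector H0 ω z L k) U (𝓝 (φ k)) := fun k => by
    simpa only [inner_delta] using hφ (delta k)
  refine ⟨φ, fun k => ?_, hcoord 0⟩
  -- Weak continuity of H0: move it onto the test vector δ_k.
  have h1 : Tendsto (fun L => H0 (greenVector H0 ω z L) k) U (𝓝 (H0 φ k)) := by
    have := hφ (ContinuousLinearMap.adjoint H0 (delta k))
    simpa only [ContinuousLinearMap.adjoint_inner_left, inner_delta] using this
  have h2 := h1.add ((hcoord k).const_mul ((ω k : ℂ) - z))
  refine tendsto_nhds_unique h2 (tendsto_const_nhds.congr' ?_)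
  filter_upwards [hU (eventually_mem_box k)] with L hL
  exact (greenVector_equation hH0 ω hz hL).symm

theorem greenVector_zero (ω : (Fin d → ℤ) → ℝ) (z : ℂ) (L : ℕ) :
    greenVector H0 ω z L 0
      = green H0 ω (box d L) z ⟨0, zero_mem_box d L⟩ ⟨0, zero_mem_box d L⟩ := by
  rw [greenVector_apply, greenColumn, dif_pos (zero_mem_box d L)]

/-- All ultrafilter limits solve the same equation, whose solution is unique; hence the whole
sequence converges. -/
theorem exists_resolventSolution (hH0 : IsSelfAdjoint H0) (ω : (Fin d → ℤ) → ℝ)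
    {z : ℂ} (hz : 0 < z.im) :
    ∃ φ, IsResolventSolution H0 ω z φ ∧ Tendsto (fun L => green H0 ω (box d L) z
      ⟨0, zero_mem_box d L⟩ ⟨0, zero_mem_box d L⟩) atTop (𝓝 (φ 0)) := by
  obtain ⟨φ, hφ, -⟩ := exists_resolventSolution_of_ultrafilter hH0 ω hz (Ultrafilter.of atTop)
    (Ultrafilter.of_le _)
  refine ⟨φ, hφ, ?_⟩
  rw [tendsto_iff_ultrafilter]
  intro U hU
  obtain ⟨ψ, hψ, hlim⟩ := exists_resolventSolution_of_ultrafilter hH0 ω hz U hU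
  rw [hφ.unique hH0 hz hψ]
  simpa only [greenVector_zero] using hlim

theorem isResolventSolution_of_domain {ω : (Fin d → ℤ) → ℝ} {z : ℂ}
    {φ : (hamiltonian H0 ω).domain}
    (h : hamiltonian H0 ω φ - z • (φ : L2 d) = delta 0) :
    IsResolventSolution H0 ω z (φ : L2 d) := by
  intro k
  rw [← h]
  change _ = H0 (φ : L2 d) k + (ω k : ℂ) * (φ : L2 d) k - z * (φ : L2 d) k
  ring

/-- A coordinatewise solution automatically lies in the maximal domain: the equation expresses ω φ
as δ₀ + zφ - H0 φ, which is in ℓ². -/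
theorem IsResolventSolution.exists_domain {ω : (Fin d → ℤ) → ℝ} {z : ℂ} {φ : L2 d}
    (h : IsResolventSolution H0 ω z φ) : ∃ ψ : (hamiltonian H0 ω).domain,
      (ψ : L2 d) = φ ∧ hamiltonian H0 ω ψ - z • (ψ : L2 d) = delta 0 := by
  have hmem : φ ∈ (hamiltonian H0 ω).domain := by
    change Memℓp (fun n => (ω n : ℂ) * φ n) 2
    have e : (fun n => (ω n : ℂ) * φ n) = ((delta 0 + z • φ - H0 φ : L2 d) : (Fin d → ℤ) → ℂ) := by
      funext k
      change _ = (delta (0 : Fin d → ℤ) : L2 d) k + z * φ k - H0 φ k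
      linear_combination h k
    rw [e]
    exact lp.memℓp _
  refine ⟨⟨φ, hmem⟩, rfl, ?_⟩
  ext k
  change H0 φ k + (ω k : ℂ) * φ k - z * φ k = _
  linear_combination h k

/-! ### Spectral measures -/

/-- The spectral measure of a Hermitian matrix at a site. -/
noncomputable def eigenMeasure {ι : Type*} [Fintype ι] [DecidableEq ι] {A : Matrix ι ι ℂ}
    (hA : A.IsHermitian) (n : ι) : Measure ℝ :=
  ∑ i, ENNReal.ofReal (eigenWeight hA n i) • Measure.dirac (hA.eigenvalues i)

section EigenMeasure

variable {ι : Type*} [Fintype ι] [DecidableEq ι] {A : Matrix ι ι ℂ}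

instance (hA : A.IsHermitian) (n : ι) : IsProbabilityMeasure (eigenMeasure hA n) where
  measure_univ := by
    rw [eigenMeasure, Measure.finsetSum_apply]
    simp only [Measure.smul_apply, measure_univ, smul_eq_mul, mul_one]
    rw [← ENNReal.ofReal_sum_of_nonneg fun i _ => eigenWeight_nonneg hA n i, sum_eigenWeight,
      ENNReal.ofReal_one]

theorem integral_eigenMeasure (hA : A.IsHermitian) (n : ι) (f : ℝ → ℂ) :
    ∫ x, f x ∂(eigenMeasure hA n) = ∑ i, (eigenWeight hA n i : ℂ) * f (hA.eigenvalues i) := by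
  rw [eigenMeasure, integral_finsetSum_measure]
  · refine Finset.sum_congr rfl fun i _ => ?_
    rw [integral_smul_measure, integral_dirac, ENNReal.toReal_ofReal (eigenWeight_nonneg hA n i)]
    rfl
  · intro i _
    exact (integrable_dirac (by simp)).smul_measure ENNReal.ofReal_ne_top

theorem eigenMeasure_compl_closedBall_le (hA : A.IsHermitian) (n : ι) {R : ℝ} (hR : 0 < R) :
    eigenMeasure hA n (Metric.closedBall 0 R)ᶜ
      ≤ ENNReal.ofReal ((∑ m, ‖A m n‖ ^ 2) / R ^ 2) := by
  rw [eigenMeasure, Measure.finsetSum_apply, ← sum_eigenWeight_mul_sq hA, Finset.sum_div,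
    ENNReal.ofReal_sum_of_nonneg fun i _ => by have := eigenWeight_nonneg hA n i; positivity]
  refine Finset.sum_le_sum fun i _ => ?_
  rw [Measure.smul_apply, Measure.dirac_apply' _ Metric.isClosed_closedBall.measurableSet.compl,
    mul_div_assoc, ENNReal.ofReal_mul (eigenWeight_nonneg hA n i), smul_eq_mul]
  gcongr
  by_cases h : hA.eigenvalues i ∈ (Metric.closedBall (0 : ℝ) R)ᶜ
  · rw [Set.indicator_of_mem h, Pi.one_apply, ENNReal.one_le_ofReal, one_le_div (by positivity)]
    rw [Set.mem_compl_iff, mem_closedBall_zero_iff, not_le, Real.norm_eq_abs] at h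
    rw [← sq_abs (hA.eigenvalues i)]
    exact pow_le_pow_left₀ hR.le h.le 2
  · rw [Set.indicator_of_notMem h]; exact zero_le

end EigenMeasure

/-- The column at n is part of the ℓ² vector H0 δ_n plus a single value of the potential, whence a
bound uniform in Λ even for unbounded ω. -/
theorem sum_norm_finiteVolume_sq_le (ω : (Fin d → ℤ) → ℝ) (Λ : Finset (Fin d → ℤ)) (n : Λ) :
    ∑ m, ‖finiteVolume H0 ω Λ m n‖ ^ 2 ≤ 2 * ‖H0‖ ^ 2 + 2 * |ω n| ^ 2 := by
  have h1 : ∀ m : Λ, ‖finiteVolume H0 ω Λ m n‖ ^ 2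
      ≤ 2 * ‖H0 (delta (n : Fin d → ℤ)) m‖ ^ 2 + 2 * (if m = n then |ω n| ^ 2 else 0) := by
    intro m
    rw [finiteVolume_apply, inner_delta]
    by_cases h : m = n
    · rw [if_pos h, if_pos h, h]
      have : ‖H0 (delta (n : Fin d → ℤ)) n + (ω n : ℂ)‖
          ≤ ‖H0 (delta (n : Fin d → ℤ)) n‖ + |ω n| :=
        (norm_add_le _ _).trans (by rw [Complex.norm_real, Real.norm_eq_abs])
      nlinarith [sq_nonneg (‖H0 (delta (n : Fin d → ℤ)) n‖ - |ω n|), norm_nonneg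
        (H0 (delta (n : Fin d → ℤ)) n + (ω n : ℂ)), pow_le_pow_left₀ (norm_nonneg _) this 2]
    · rw [if_neg h, if_neg h, add_zero, mul_zero, add_zero]
      nlinarith [sq_nonneg ‖H0 (delta (n : Fin d → ℤ)) m‖]
  refine (Finset.sum_le_sum fun m _ => h1 m).trans ?_
  rw [Finset.sum_add_distrib, ← Finset.mul_sum, ← Finset.mul_sum, Finset.sum_ite_eq',
    if_pos (Finset.mem_univ n)]
  gcongr
  have h2 := lp.sum_rpow_le_norm_rpow (p := 2) (by norm_num) (H0 (delta (n : Fin d → ℤ))) Λ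
  simp only [ENNReal.toReal_ofNat, Real.rpow_ofNat] at h2
  rw [Finset.sum_coe_sort Λ fun m => ‖H0 (delta (n : Fin d → ℤ)) m‖ ^ 2]
  refine h2.trans (pow_le_pow_left₀ (norm_nonneg _) ?_ 2)
  exact (H0.le_opNorm _).trans (by rw [norm_delta, mul_one])

/-- The Stieltjes kernel as a bounded continuous function. -/
noncomputable def stieltjesKernel {z : ℂ} (hz : 0 < z.im) : BoundedContinuousFunction ℝ ℂ :=
  BoundedContinuousFunction.ofNormedAddCommGroup (fun x : ℝ => ((x : ℂ) - z)⁻¹)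
    ((Complex.continuous_ofReal.sub continuous_const).inv₀ (ofReal_sub_ne_zero hz)) (1 / z.im)
    fun x => by
      rw [norm_inv, ← one_div]
      refine one_div_le_one_div_of_le hz ?_
      have := Complex.abs_im_le_norm ((x : ℂ) - z)
      simp only [Complex.sub_im, Complex.ofReal_im, zero_sub, abs_neg] at this
      exact (le_abs_self _).trans this

/-- The spectral measures of the boxes at the origin have second moments bounded uniformly in L,
hence are tight. A weak limit has as Stieltjes transform the limit of the Green functions, which is
the infinite volume resolvent. -/
theorem exists_isSpectralMeasure (hH0 : IsSelfAdjoint H0) (ω : (Fin d → ℤ) → ℝ) :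
    ∃ ν : Measure ℝ, IsSpectralMeasure (hamiltonian H0 ω) (delta 0) ν := by
  have hA := fun L => finiteVolume_isHermitian hH0 ω (box d L)
  let o : ∀ L, box d L := fun L => ⟨0, zero_mem_box d L⟩
  let N : ℕ → ProbabilityMeasure ℝ := fun L => ⟨eigenMeasure (hA L) (o L), inferInstance⟩
  have htight : IsTightMeasureSet {((κ : ProbabilityMeasure ℝ) : Measure ℝ) | κ ∈ Set.range N} := by
    rw [isTightMeasureSet_iff_exists_isCompact_measure_compl_le]
    intro ε hε
    set B := 2 * ‖H0‖ ^ 2 + 2 * |ω 0| ^ 2 with hB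
    have hlim : Tendsto (fun R : ℝ => ENNReal.ofReal (B / R ^ 2)) atTop (𝓝 0) := by
      have h1 : Tendsto (fun R : ℝ => B / R ^ 2) atTop (𝓝 0) :=
        tendsto_const_nhds.div_atTop (tendsto_pow_atTop two_ne_zero)
      rw [← ENNReal.ofReal_zero]
      exact (ENNReal.continuous_ofReal.tendsto 0).comp h1
    obtain ⟨R, hR, hR0⟩ := ((hlim.eventually_le_const hε).and (eventually_gt_atTop 0)).exists
    refine ⟨Metric.closedBall 0 R, isCompact_closedBall _ _, ?_⟩
    rintro _ ⟨_, ⟨L, rfl⟩, rfl⟩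
    refine (eigenMeasure_compl_closedBall_le (hA L) (o L) hR0).trans (le_trans ?_ hR)
    gcongr
    exact sum_norm_finiteVolume_sq_le ω (box d L) (o L)
  set U := Ultrafilter.of (atTop : Filter ℕ)
  obtain ⟨ν, -, hν⟩ := (isCompact_closure_of_isTightMeasureSet htight).ultrafilter_le_nhds (U.map N)
    (by
      rw [Ultrafilter.coe_map, le_principal_iff]
      exact Filter.mem_map.2 (Eventually.of_forall fun L => subset_closure ⟨L, rfl⟩))
  have hν' : Tendsto N U (𝓝 ν) := hν
  rw [ProbabilityMeasure.tendsto_iff_forall_integral_rclike_tendsto ℂ] at hν'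
  refine ⟨ν, inferInstance, fun z hz => ?_⟩
  obtain ⟨φ, hφ, hlim⟩ := exists_resolventSolution hH0 ω hz
  obtain ⟨ψ, hψ, hψeq⟩ := hφ.exists_domain
  refine ⟨ψ, hψeq, ?_⟩
  rw [hψ, inner_delta]
  refine tendsto_nhds_unique (hlim.mono_left (Ultrafilter.of_le _)) ?_
  refine (hν' (stieltjesKernel hz)).congr fun L => ?_
  change ∫ x : ℝ, ((x : ℂ) - z)⁻¹ ∂(eigenMeasure (hA L) (o L)) = _
  rw [integral_eigenMeasure]
  exact (resolventMatrix_diag (hA L) hz (o L)).symm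

theorem isSpectralMeasure_spectralMeasure (hH0 : IsSelfAdjoint H0) (ω : (Fin d → ℤ) → ℝ) :
    IsSpectralMeasure (hamiltonian H0 ω) (delta 0)
      (spectralMeasure (hamiltonian H0 ω) (delta 0)) := by
  rw [spectralMeasure, dif_pos (exists_isSpectralMeasure hH0 ω)]
  exact (exists_isSpectralMeasure hH0 ω).choose_spec

theorem isFiniteMeasure_spectralMeasure (hH0 : IsSelfAdjoint H0) (ω : (Fin d → ℤ) → ℝ) :
    IsFiniteMeasure (spectralMeasure (hamiltonian H0 ω) (delta 0)) :=
  (isSpectralMeasure_spectralMeasure hH0 ω).1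

/-- Rests only on the resolvent identity defining spectral measures and on uniqueness of the
resolvent solution, so it holds for whichever measure was chosen. -/
theorem tendsto_im_green (hH0 : IsSelfAdjoint H0) (ω : (Fin d → ℤ) → ℝ) {z : ℂ} (hz : 0 < z.im) :
    Tendsto (fun L => (green H0 ω (box d L) z ⟨0, zero_mem_box d L⟩ ⟨0, zero_mem_box d L⟩).im) atTop
      (𝓝 (∫ x : ℝ, z.im / ((x - z.re) ^ 2 + z.im ^ 2)
        ∂(spectralMeasure (hamiltonian H0 ω) (delta 0)))) := by
  obtain ⟨φ, hφ, hlim⟩ := exists_resolventSolution hH0 ω hz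
  obtain ⟨hfin, h⟩ := isSpectralMeasure_spectralMeasure hH0 ω
  obtain ⟨ψ, hψ, hint⟩ := h z hz
  rw [(isResolventSolution_of_domain hψ).unique hH0 hz hφ, inner_delta] at hint
  rw [hint] at hlim
  have h2 := (Complex.continuous_im.tendsto _).comp hlim
  have h3 := integral_im (μ := spectralMeasure (hamiltonian H0 ω) (delta 0))
    (BoundedContinuousFunction.integrable _ (stieltjesKernel hz))
  have h4 : ∀ x, RCLike.im (stieltjesKernel hz x) = z.im / ((x - z.re) ^ 2 + z.im ^ 2) :=
    fun x => im_inv_ofReal_sub x z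
  simp only [h4] at h3
  rw [h3]
  exact h2

end InfiniteVolume

/-! ### Approximating the mass of an interval by Cauchy transforms -/

section CauchyTransform

/-- The imaginary part of the Stieltjes transform of a measure. -/
noncomputable def cauchyTransform (ν : Measure ℝ) (z : ℂ) : ℝ :=
  ∫ x : ℝ, z.im / ((x - z.re) ^ 2 + z.im ^ 2) ∂ν

/-- The linear combination of Cauchy transforms at scale `β` approximating the mass of
`(E - c/β, E + c/β)`. -/
noncomputable def cauchySum (β E : ℝ) {m : ℕ} (t a : Fin m → ℝ) (g : ℂ → ℝ) : ℝ :=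
  ∑ j, a j * (β⁻¹ * g (spectralPoint E (t j / β)))

/-- The error in the approximation by `cauchySum`. -/
noncomputable def cauchyError (β E c κ : ℝ) (g : ℂ → ℝ) : ℝ :=
  κ * (β⁻¹ * g (spectralPoint E (1 / β)))
    + 2 * (κ * (β⁻¹ * g (spectralPoint (E + c / β) (κ / β)))
      + κ * (β⁻¹ * g (spectralPoint (E - c / β) (κ / β))))

/-- Abbreviation for the conclusion of `exists_cauchy_approx`. -/
def IsCauchyApprox (c κ : ℝ) {m : ℕ} (t a : Fin m → ℝ) : Prop :=
  ∀ x : ℝ, |(if |x| < c then (1 : ℝ) else 0) - ∑ j, a j * (t j / (x ^ 2 + t j ^ 2))|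
    ≤ approxError c κ x

theorem continuous_cauchyKernel (e : ℝ) {t : ℝ} (ht : 0 < t) :
    Continuous fun x : ℝ => t / ((x - e) ^ 2 + t ^ 2) :=
  continuous_const.div (by fun_prop) fun x => by positivity

theorem cauchyKernel_nonneg (e x : ℝ) {t : ℝ} (ht : 0 < t) : 0 ≤ t / ((x - e) ^ 2 + t ^ 2) := by
  positivity

theorem cauchyKernel_le (e x : ℝ) {t : ℝ} (ht : 0 < t) : t / ((x - e) ^ 2 + t ^ 2) ≤ 1 / t := by
  rw [div_le_div_iff₀ (by positivity) ht]
  nlinarith [sq_nonneg (x - e)]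

theorem integrable_cauchyKernel (ν : Measure ℝ) [IsFiniteMeasure ν] (e : ℝ) {t : ℝ} (ht : 0 < t) :
    Integrable (fun x : ℝ => t / ((x - e) ^ 2 + t ^ 2)) ν :=
  .of_bound (continuous_cauchyKernel e ht).aestronglyMeasurable (1 / t) (.of_forall fun x => by
    rw [Real.norm_eq_abs, abs_of_nonneg (cauchyKernel_nonneg e x ht)]
    exact cauchyKernel_le e x ht)

theorem scaled_cauchyKernel {β : ℝ} (hβ : 0 < β) (e y x t : ℝ) (ht : 0 < t) :
    t / ((β * (x - e) - y) ^ 2 + t ^ 2)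
      = β⁻¹ * (t / β / ((x - (e + y / β)) ^ 2 + (t / β) ^ 2)) := by
  have h : (x - (e + y / β)) ^ 2 + (t / β) ^ 2
      = ((β * (x - e) - y) ^ 2 + t ^ 2) / β ^ 2 := by field_simp; ring
  rw [h]
  field_simp

theorem integral_error_combination {X : Type*} [MeasurableSpace X] {P : Measure X} {f g h : X → ℝ}
    (hf : Integrable f P) (hg : Integrable g P) (hh : Integrable h P) (κ b : ℝ) :
    Integrable (fun x => κ * (b * f x) + 2 * (κ * (b * g x) + κ * (b * h x))) P ∧
      ∫ x, (κ * (b * f x) + 2 * (κ * (b * g x) + κ * (b * h x))) ∂P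
        = κ * (b * ∫ x, f x ∂P) + 2 * (κ * (b * ∫ x, g x ∂P) + κ * (b * ∫ x, h x ∂P)) := by
  have h1 : Integrable (fun x => κ * (b * f x)) P := (hf.const_mul b).const_mul κ
  have h2 : Integrable (fun x => κ * (b * g x)) P := (hg.const_mul b).const_mul κ
  have h3 : Integrable (fun x => κ * (b * h x)) P := (hh.const_mul b).const_mul κ
  have h23 : Integrable (fun x => κ * (b * g x) + κ * (b * h x)) P := h2.add h3
  have h4 : Integrable (fun x => 2 * (κ * (b * g x) + κ * (b * h x))) P := h23.const_mul 2
  refine ⟨h1.add h4, ?_⟩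
  rw [integral_add h1 h4, integral_const_mul 2, integral_add h2 h3]
  simp only [integral_const_mul]

/-- The pointwise approximation is evaluated at β(x - E) and integrated. The kernels at ±c become
kernels of width κ/β at the endpoints E ± c/β. -/
theorem abs_measureReal_sub_cauchySum_le (ν : Measure ℝ) [IsFiniteMeasure ν] {β c κ : ℝ}
    (hβ : 0 < β) (hκ : 0 < κ) (E : ℝ) {m : ℕ} {t a : Fin m → ℝ} (ht : ∀ j, 0 < t j)
    (h : IsCauchyApprox c κ t a) :
    |ν.real (Set.Ioo (E - c / β) (E + c / β)) - cauchySum β E t a (cauchyTransform ν)|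
      ≤ cauchyError β E c κ (cauchyTransform ν) := by
  have hint : ∀ e {s : ℝ}, 0 < s → Integrable (fun x : ℝ => s / ((x - e) ^ 2 + s ^ 2)) ν :=
    fun e s hs => integrable_cauchyKernel ν e hs
  have hind : Integrable ((Set.Ioo (E - c / β) (E + c / β)).indicator fun _ => (1 : ℝ)) ν :=
    (integrable_const _).indicator measurableSet_Ioo
  have htj : ∀ j, 0 < t j / β := fun j => div_pos (ht j) hβ
  have hsumint : Integrable (fun x : ℝ => ∑ j, a j * (β⁻¹ * (t j / β
      / ((x - E) ^ 2 + (t j / β) ^ 2)))) ν :=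
    integrable_finsetSum _ fun j _ => ((hint E (htj j)).const_mul _).const_mul _
  have e1 : ν.real (Set.Ioo (E - c / β) (E + c / β)) - cauchySum β E t a (cauchyTransform ν)
      = ∫ x, ((Set.Ioo (E - c / β) (E + c / β)).indicator (fun _ => (1 : ℝ)) x
        - ∑ j, a j * (β⁻¹ * (t j / β / ((x - E) ^ 2 + (t j / β) ^ 2)))) ∂ν := by
    rw [integral_sub hind hsumint, integral_indicator_const _ measurableSet_Ioo, smul_eq_mul,
      mul_one, integral_finsetSum _ fun j _ => ((hint E (htj j)).const_mul _).const_mul _]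
    simp only [integral_const_mul]
    rfl
  have e2 : cauchyError β E c κ (cauchyTransform ν)
      = ∫ x, (κ * (β⁻¹ * (1 / β / ((x - E) ^ 2 + (1 / β) ^ 2)))
        + 2 * (κ * (β⁻¹ * (κ / β / ((x - (E + c / β)) ^ 2 + (κ / β) ^ 2)))
          + κ * (β⁻¹ * (κ / β / ((x - (E - c / β)) ^ 2 + (κ / β) ^ 2))))) ∂ν := by
    exact (integral_error_combination (hint E (one_div_pos.2 hβ))
      (hint (E + c / β) (div_pos hκ hβ)) (hint (E - c / β) (div_pos hκ hβ)) κ β⁻¹).2.symm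
  rw [e1, e2, ← Real.norm_eq_abs]
  refine norm_integral_le_of_norm_le ?_ (.of_forall fun x => ?_)
  · exact (((hint E (one_div_pos.2 hβ)).const_mul β⁻¹).const_mul κ).add
      (((((hint (E + c / β) (div_pos hκ hβ)).const_mul β⁻¹).const_mul κ).add
        (((hint (E - c / β) (div_pos hκ hβ)).const_mul β⁻¹).const_mul κ)).const_mul 2)
  · have hx := h (β * (x - E))
    have i1 : (Set.Ioo (E - c / β) (E + c / β)).indicator (fun _ => (1 : ℝ)) x
        = if |β * (x - E)| < c then (1 : ℝ) else 0 := by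
      rw [Set.indicator_apply]
      congr 1
      rw [abs_mul, abs_of_pos hβ, mul_comm, ← lt_div_iff₀ hβ, abs_lt, Set.mem_Ioo]
      exact propext ⟨fun h => ⟨by linarith [h.1], by linarith [h.2]⟩,
        fun h => ⟨by linarith [h.1], by linarith [h.2]⟩⟩
    have i2 : ∀ s, 0 < s → s / ((β * (x - E)) ^ 2 + s ^ 2)
        = β⁻¹ * (s / β / ((x - E) ^ 2 + (s / β) ^ 2)) := fun s hs => by
      simpa using scaled_cauchyKernel hβ E 0 x s hs
    have i3 := scaled_cauchyKernel hβ E c x κ hκ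
    have i4 := scaled_cauchyKernel hβ E (-c) x κ hκ
    rw [sub_neg_eq_add, neg_div, ← sub_eq_add_neg] at i4
    rw [approxError, i2 1 one_pos, i3, i4] at hx
    rw [Real.norm_eq_abs, i1]
    simp only [i2 _ (ht _)] at hx
    exact hx

end CauchyTransform

/-! ### Disorder averages of Green functions and Cauchy transforms -/

section Averages

variable {d : ℕ} {H0 : L2 d →L[ℂ] L2 d}

/-- The imaginary part of the diagonal of the finite volume Green function, extended by zero. -/
noncomputable def imGreenDiag (H0 : L2 d →L[ℂ] L2 d) (ω : (Fin d → ℤ) → ℝ)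
    (S : Finset (Fin d → ℤ)) (z : ℂ) (n : Fin d → ℤ) : ℝ :=
  if h : n ∈ S then (green H0 ω S z ⟨n, h⟩ ⟨n, h⟩).im else 0

theorem imGreenDiag_nonneg (hH0 : IsSelfAdjoint H0) (ω : (Fin d → ℤ) → ℝ)
    (S : Finset (Fin d → ℤ)) {z : ℂ} (hz : 0 < z.im) (n : Fin d → ℤ) :
    0 ≤ imGreenDiag H0 ω S z n := by
  unfold imGreenDiag
  split_ifs with h
  · exact im_green_nonneg hH0 ω S hz _
  · exact le_rfl

theorem imGreenDiag_le (hH0 : IsSelfAdjoint H0) (ω : (Fin d → ℤ) → ℝ)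
    (S : Finset (Fin d → ℤ)) {z : ℂ} (hz : 0 < z.im) (n : Fin d → ℤ) :
    imGreenDiag H0 ω S z n ≤ 1 / z.im := by
  unfold imGreenDiag
  split_ifs with h
  · exact (le_abs_self _).trans ((Complex.abs_im_le_norm _).trans (norm_green_le hH0 ω S hz _ _))
  · positivity

theorem measurable_imGreenDiag (hH0 : IsSelfAdjoint H0) (S : Finset (Fin d → ℤ)) {z : ℂ}
    (hz : 0 < z.im) (n : Fin d → ℤ) : Measurable fun ω => imGreenDiag H0 ω S z n := by
  unfold imGreenDiag
  split_ifs with h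
  · exact measurable_im_green hH0 S hz _ _
  · exact measurable_const

theorem integrable_imGreenDiag (hH0 : IsSelfAdjoint H0) (μ : Measure ℝ) [IsProbabilityMeasure μ]
    (S : Finset (Fin d → ℤ)) {z : ℂ} (hz : 0 < z.im) (n : Fin d → ℤ) :
    Integrable (fun ω => imGreenDiag H0 ω S z n) (law d μ) :=
  .of_bound (measurable_imGreenDiag hH0 S hz n).aestronglyMeasurable (1 / z.im)
    (.of_forall fun ω => by
      rw [Real.norm_eq_abs, abs_of_nonneg (imGreenDiag_nonneg hH0 ω S hz n)]
      exact imGreenDiag_le hH0 ω S hz n)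

theorem integral_imGreenDiag_le (hH0 : IsSelfAdjoint H0) {μ : Measure ℝ} [IsProbabilityMeasure μ]
    {α K : ℝ} (hK : WegnerBound H0 μ α K) (S : Finset (Fin d → ℤ)) {z : ℂ} (hz : 0 < z.im)
    (n : Fin d → ℤ) : ∫ ω, imGreenDiag H0 ω S z n ∂(law d μ) ≤ K * z.im ^ (α - 1) := by
  by_cases h : n ∈ S
  · simp only [imGreenDiag, h, dite_true]
    exact hK.integral_le hH0 S ⟨n, h⟩ hz
  · simp only [imGreenDiag, h, dite_false, integral_zero]
    exact mul_nonneg hK.1 (Real.rpow_nonneg hz.le _)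

/-- The spectral measure of `H^ω` at the origin. -/
noncomputable abbrev originMeasure (H0 : L2 d →L[ℂ] L2 d) (ω : (Fin d → ℤ) → ℝ) : Measure ℝ :=
  spectralMeasure (hamiltonian H0 ω) (delta 0)

theorem tendsto_imGreenDiag (hH0 : IsSelfAdjoint H0) (ω : (Fin d → ℤ) → ℝ) {z : ℂ}
    (hz : 0 < z.im) : Tendsto (fun L => imGreenDiag H0 ω (box d L) z 0) atTop
      (𝓝 (cauchyTransform (originMeasure H0 ω) z)) := by
  refine (tendsto_im_green hH0 ω hz).congr fun L => ?_
  rw [imGreenDiag, dif_pos (zero_mem_box d L)]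

/-- The spectral measure is obtained by choice for each ω separately; its Cauchy transform is
nevertheless measurable, as a limit of finite volume Green functions. -/
theorem measurable_cauchyTransform (hH0 : IsSelfAdjoint H0) {z : ℂ} (hz : 0 < z.im) :
    Measurable fun ω => cauchyTransform (originMeasure H0 ω) z :=
  measurable_of_tendsto_metrizable (fun L => measurable_imGreenDiag hH0 (box d L) hz 0)
    (tendsto_pi_nhds.2 fun ω => tendsto_imGreenDiag hH0 ω hz)

theorem cauchyTransform_nonneg (hH0 : IsSelfAdjoint H0) (ω : (Fin d → ℤ) → ℝ) {z : ℂ}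
    (hz : 0 < z.im) : 0 ≤ cauchyTransform (originMeasure H0 ω) z :=
  ge_of_tendsto' (tendsto_imGreenDiag hH0 ω hz) fun _ => imGreenDiag_nonneg hH0 ω _ hz 0

theorem cauchyTransform_le (hH0 : IsSelfAdjoint H0) (ω : (Fin d → ℤ) → ℝ) {z : ℂ}
    (hz : 0 < z.im) : cauchyTransform (originMeasure H0 ω) z ≤ 1 / z.im :=
  le_of_tendsto' (tendsto_imGreenDiag hH0 ω hz) fun _ => imGreenDiag_le hH0 ω _ hz 0

theorem integrable_cauchyTransform (hH0 : IsSelfAdjoint H0) (μ : Measure ℝ)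
    [IsProbabilityMeasure μ] {z : ℂ} (hz : 0 < z.im) :
    Integrable (fun ω => cauchyTransform (originMeasure H0 ω) z) (law d μ) :=
  .of_bound (measurable_cauchyTransform hH0 hz).aestronglyMeasurable (1 / z.im)
    (.of_forall fun ω => by
      rw [Real.norm_eq_abs, abs_of_nonneg (cauchyTransform_nonneg hH0 ω hz)]
      exact cauchyTransform_le hH0 ω hz)

/-- The averaged Cauchy transform, i.e. that of the integrated density of states. -/
noncomputable def meanCauchy (H0 : L2 d →L[ℂ] L2 d) (μ : Measure ℝ) (z : ℂ) : ℝ :=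
  ∫ ω, cauchyTransform (originMeasure H0 ω) z ∂(law d μ)

theorem tendsto_integral_imGreenDiag (hH0 : IsSelfAdjoint H0) (μ : Measure ℝ)
    [IsProbabilityMeasure μ] {z : ℂ} (hz : 0 < z.im) :
    Tendsto (fun L => ∫ ω, imGreenDiag H0 ω (box d L) z 0 ∂(law d μ)) atTop
      (𝓝 (meanCauchy H0 μ z)) := by
  refine tendsto_integral_of_dominated_convergence (fun _ => 1 / z.im)
    (fun L => (measurable_imGreenDiag hH0 (box d L) hz 0).aestronglyMeasurable)
    (integrable_const _) (fun L => .of_forall fun ω => ?_)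
    (.of_forall fun ω => tendsto_imGreenDiag hH0 ω hz)
  rw [Real.norm_eq_abs, abs_of_nonneg (imGreenDiag_nonneg hH0 ω _ hz 0)]
  exact imGreenDiag_le hH0 ω _ hz 0

theorem meanCauchy_nonneg (hH0 : IsSelfAdjoint H0) (μ : Measure ℝ) {z : ℂ} (hz : 0 < z.im) :
    0 ≤ meanCauchy H0 μ z :=
  integral_nonneg fun ω => cauchyTransform_nonneg hH0 ω hz

theorem meanCauchy_le (hH0 : IsSelfAdjoint H0) {μ : Measure ℝ} [IsProbabilityMeasure μ]
    {α K : ℝ} (hK : WegnerBound H0 μ α K) {z : ℂ} (hz : 0 < z.im) :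
    meanCauchy H0 μ z ≤ K * z.im ^ (α - 1) :=
  le_of_tendsto' (tendsto_integral_imGreenDiag hH0 μ hz) fun L =>
    integral_imGreenDiag_le hH0 hK (box d L) hz 0

/-! ### Translation covariance -/

theorem translate_delta (k m : Fin d → ℤ) : translate k (delta m : L2 d) = delta (m + k) := by
  ext n
  change (delta m : L2 d) (n - k) = (delta (m + k) : L2 d) n
  simp only [delta, lp.single_apply, Pi.single_apply, sub_eq_iff_eq_add]

theorem inner_delta_add (htrans : CommutesWithTranslations H0) (k n m : Fin d → ℤ) :
    (inner ℂ (delta (n + k)) (H0 (delta (m + k))) : ℂ) = inner ℂ (delta n) (H0 (delta m)) := by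
  rw [inner_delta, inner_delta, ← translate_delta, htrans]
  change H0 (delta m) (n + k - k) = _
  rw [add_sub_cancel_right]

theorem imGreenDiag_shift (htrans : CommutesWithTranslations H0) (ω : (Fin d → ℤ) → ℝ) (L : ℕ)
    (z : ℂ) (k : Fin d → ℤ) :
    imGreenDiag H0 ω (cube (fun i => k i - L) (2 * L + 1)) z k
      = imGreenDiag H0 (fun n => ω (n + k)) (box d L) z 0 := by
  set S := cube (fun i => k i - (L : ℤ)) (2 * L + 1) with hS
  have hmem : ∀ n, n ∈ box d L ↔ n + k ∈ S := by
    intro n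
    rw [mem_box, hS, mem_cube]
    refine forall_congr' fun i => ?_
    rw [Pi.add_apply]
    push_cast
    constructor <;> rintro ⟨h1, h2⟩ <;> constructor <;> linarith
  let e : box d L ≃ S := (Equiv.addRight k).subtypeEquiv hmem
  have hA : finiteVolume H0 (fun n => ω (n + k)) (box d L)
      = (finiteVolume H0 ω S).submatrix e e := by
    ext n m
    rw [Matrix.submatrix_apply, finiteVolume_apply, finiteVolume_apply]
    have h1 : ((e n : S) : Fin d → ℤ) = n + k := rfl
    have h2 : ((e m : S) : Fin d → ℤ) = m + k := rfl
    rw [h1, h2, inner_delta_add htrans]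
    by_cases h : n = m
    · simp [h]
    · rw [if_neg h, if_neg (e.injective.ne h)]
  have hB : finiteVolume H0 (fun n => ω (n + k)) (box d L) - z • (1 : Matrix _ _ ℂ)
      = (finiteVolume H0 ω S - z • (1 : Matrix S S ℂ)).submatrix e e := by
    rw [hA]
    ext n m
    simp only [Matrix.submatrix_apply, Matrix.sub_apply, Matrix.smul_apply, Matrix.one_apply]
    by_cases h : n = m
    · simp [h]
    · rw [if_neg h, if_neg (e.injective.ne h)]
  have h0 : k ∈ S := by simpa using (hmem 0).1 (zero_mem_box d L)
  rw [imGreenDiag, dif_pos h0, imGreenDiag, dif_pos (zero_mem_box d L), green, green, hB,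
    Matrix.inv_submatrix_equiv, Matrix.submatrix_apply]
  have : e ⟨0, zero_mem_box d L⟩ = ⟨k, h0⟩ := Subtype.ext (zero_add k)
  rw [this]

theorem integral_imGreenDiag_shift (hH0 : IsSelfAdjoint H0) (htrans : CommutesWithTranslations H0)
    (μ : Measure ℝ) [IsProbabilityMeasure μ] (L : ℕ) {z : ℂ} (hz : 0 < z.im) (k : Fin d → ℤ) :
    ∫ ω, imGreenDiag H0 ω (cube (fun i => k i - L) (2 * L + 1)) z k ∂(law d μ)
      = ∫ ω, imGreenDiag H0 ω (box d L) z 0 ∂(law d μ) := by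
  simp only [imGreenDiag_shift htrans]
  exact integral_comp_infinitePi (add_left_injective k) (measurable_imGreenDiag hH0 (box d L) hz 0)

theorem eventually_subset_cube (S : Finset (Fin d → ℤ)) (k : Fin d → ℤ) :
    ∀ᶠ L : ℕ in atTop, S ⊆ cube (fun i => k i - L) (2 * L + 1) := by
  have h : ∀ n ∈ S, ∀ᶠ L : ℕ in atTop, n - k ∈ box d L := fun n _ => eventually_mem_box _
  filter_upwards [(Finset.eventually_all S).2 h] with L hL n hn
  have := mem_box.1 (hL n hn)
  refine mem_cube.2 fun i => ?_
  have h := this i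
  rw [Pi.sub_apply] at h
  push_cast
  constructor <;> linarith [h.1, h.2]

/-- Comparison of the Green functions of two volumes, and of the infinite volume. -/
theorem exists_volume_comparison (hH0 : IsSelfAdjoint H0) (htrans : CommutesWithTranslations H0)
    {μ : Measure ℝ} [IsProbabilityMeasure μ] {a b : ℝ} (hloc : FractionalMomentDecay H0 μ a b) :
    ∃ (C γ : ℝ) (ℓ₀ : ℕ), 0 ≤ C ∧ 0 < γ ∧ ∀ (S : Finset (Fin d → ℤ)), ∀ n ∈ S, ∀ (D : ℝ),
      (∀ k ∉ S, D ≤ ‖n - k‖) → ∀ z : ℂ, 0 < z.im → z.im ≤ 1 → z.re ∈ Set.Icc a b →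
        (∀ (c : Fin d → ℤ) (ℓ : ℕ), ℓ₀ ≤ ℓ → S ⊆ cube c ℓ →
          ∫ ω, |imGreenDiag H0 ω (cube c ℓ) z n - imGreenDiag H0 ω S z n| ∂(law d μ)
            ≤ C * S.card / z.im ^ 2 * Real.exp (-γ * D)) ∧
        |meanCauchy H0 μ z - ∫ ω, imGreenDiag H0 ω S z n ∂(law d μ)|
            ≤ C * S.card / z.im ^ 2 * Real.exp (-γ * D) := by
  obtain ⟨C, γ, ℓ₀, hC, hγ, h⟩ := exists_green_comparison hH0 hloc
  refine ⟨C, γ, ℓ₀, hC, hγ, fun S n hn D hD z hz hz1 hzre => ?_⟩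
  have hfin : ∀ (c : Fin d → ℤ) (ℓ : ℕ), ℓ₀ ≤ ℓ → S ⊆ cube c ℓ →
      ∫ ω, |imGreenDiag H0 ω (cube c ℓ) z n - imGreenDiag H0 ω S z n| ∂(law d μ)
        ≤ C * S.card / z.im ^ 2 * Real.exp (-γ * D) := by
    intro c ℓ hℓ hS
    refine le_trans (le_of_eq ?_) (h c ℓ hℓ S hS ⟨n, hn⟩ D hD z hz hz1 hzre)
    refine integral_congr_ae (.of_forall fun ω => ?_)
    simp only [imGreenDiag, hS hn, hn, dite_true]
    exact abs_sub_comm _ _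
  refine ⟨hfin, ?_⟩
  have hlim := ((tendsto_integral_imGreenDiag hH0 μ hz).sub_const
    (∫ ω, imGreenDiag H0 ω S z n ∂(law d μ))).abs
  refine le_of_tendsto hlim ?_
  -- By stationarity the mean at the centre of a box around the origin equals that at n in the cube
  -- of the same size around n, and this cube eventually contains S. The finite volume bound then
  -- passes to the limit.
  filter_upwards [eventually_subset_cube S n, eventually_ge_atTop ℓ₀] with L hL hL0
  rw [← integral_imGreenDiag_shift hH0 htrans μ L hz n,
    ← integral_sub (integrable_imGreenDiag hH0 μ _ hz n) (integrable_imGreenDiag hH0 μ _ hz n)]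
  exact abs_integral_le_integral_abs.trans (hfin _ _ (by omega) hL)

/-! ### Counting levels and the density of states through Cauchy transforms -/

/-- The measure estimate, applied to the sum of Dirac masses at the eigenvalues, whose Cauchy
transform is the trace of the imaginary part of the resolvent. -/
theorem abs_levelCount_sub_cauchySum_le (hH0 : IsSelfAdjoint H0) (S : Finset (Fin d → ℤ))
    (ω : (Fin d → ℤ) → ℝ) {β c κ : ℝ} (hβ : 0 < β) (hκ : 0 < κ) (E : ℝ) {m : ℕ} {t a : Fin m → ℝ}
    (ht : ∀ j, 0 < t j) (h : IsCauchyApprox c κ t a) :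
    |(levelCount hH0 S E (c / β) ω : ℝ)
        - cauchySum β E t a fun z => ∑ n ∈ S, imGreenDiag H0 ω S z n|
      ≤ cauchyError β E c κ fun z => ∑ n ∈ S, imGreenDiag H0 ω S z n := by
  have hA := finiteVolume_isHermitian hH0 ω S
  set ν : Measure ℝ := ∑ i, Measure.dirac (hA.eigenvalues i) with hν
  have hfin : IsFiniteMeasure ν := by
    constructor
    rw [hν, Measure.finsetSum_apply]
    simp
  have h1 : ν.real (Set.Ioo (E - c / β) (E + c / β)) = levelCount hH0 S E (c / β) ω := by
    rw [levelCount, eigenCount_eq_sum, Measure.real, hν, Measure.finsetSum_apply,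
      ENNReal.toReal_sum fun i _ => measure_ne_top _ _]
    refine Finset.sum_congr rfl fun i _ => ?_
    rw [Measure.dirac_apply' _ measurableSet_Ioo, Set.indicator_apply]
    have : hA.eigenvalues i ∈ Set.Ioo (E - c / β) (E + c / β) ↔ |hA.eigenvalues i - E| < c / β := by
      rw [abs_lt, Set.mem_Ioo]
      exact ⟨fun h => ⟨by linarith [h.1], by linarith [h.2]⟩,
        fun h => ⟨by linarith [h.1], by linarith [h.2]⟩⟩
    simp only [this]
    split_ifs <;> simp
  have h2 : ∀ z : ℂ, 0 < z.im →
      cauchyTransform ν z = ∑ n ∈ S, imGreenDiag H0 ω S z n := by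
    intro z hz
    rw [cauchyTransform, hν, integral_finsetSum_measure
      (f := fun x : ℝ => z.im / ((x - z.re) ^ 2 + z.im ^ 2))
      fun i _ => integrable_cauchyKernel (Measure.dirac (hA.eigenvalues i)) z.re hz]
    simp only [integral_dirac]
    rw [← sum_im_resolventMatrix_diag hA hz,
      ← Finset.sum_coe_sort S fun n => imGreenDiag H0 ω S z n]
    refine Finset.sum_congr rfl fun n _ => ?_
    rw [imGreenDiag, dif_pos n.2]
    rfl
  have h3 := abs_measureReal_sub_cauchySum_le ν hβ hκ E ht h
  have h4 : cauchySum β E t a (cauchyTransform ν)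
      = cauchySum β E t a fun z => ∑ n ∈ S, imGreenDiag H0 ω S z n := by
    unfold cauchySum
    refine Finset.sum_congr rfl fun j _ => ?_
    rw [h2 (spectralPoint E (t j / β)) (div_pos (ht j) hβ)]
  have h5 : cauchyError β E c κ (cauchyTransform ν)
      = cauchyError β E c κ fun z => ∑ n ∈ S, imGreenDiag H0 ω S z n := by
    unfold cauchyError
    rw [h2 (spectralPoint E (1 / β)) (one_div_pos.2 hβ),
      h2 (spectralPoint (E + c / β) (κ / β)) (div_pos hκ hβ),
      h2 (spectralPoint (E - c / β) (κ / β)) (div_pos hκ hβ)]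
  rwa [h1, h4, h5] at h3

theorem integral_cauchySum {Ω : Type*} [MeasurableSpace Ω] (P : Measure Ω) {g : Ω → ℂ → ℝ}
    (hg : ∀ z : ℂ, 0 < z.im → Integrable (fun ω => g ω z) P) {β : ℝ} (hβ : 0 < β) (E : ℝ)
    {m : ℕ} {t a : Fin m → ℝ} (ht : ∀ j, 0 < t j) :
    Integrable (fun ω => cauchySum β E t a (g ω)) P ∧
      ∫ ω, cauchySum β E t a (g ω) ∂P = cauchySum β E t a fun z => ∫ ω, g ω z ∂P := by
  have h : ∀ j, Integrable (fun ω => a j * (β⁻¹ * g ω (spectralPoint E (t j / β)))) P := fun j =>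
    ((hg (spectralPoint E (t j / β)) (div_pos (ht j) hβ)).const_mul _).const_mul _
  refine ⟨integrable_finsetSum _ fun j _ => h j, ?_⟩
  unfold cauchySum
  rw [integral_finsetSum _ fun j _ => h j]
  simp only [integral_const_mul]

theorem integral_cauchyError {Ω : Type*} [MeasurableSpace Ω] (P : Measure Ω) {g : Ω → ℂ → ℝ}
    (hg : ∀ z : ℂ, 0 < z.im → Integrable (fun ω => g ω z) P) {β κ : ℝ} (hβ : 0 < β) (hκ : 0 < κ)
    (E c : ℝ) : Integrable (fun ω => cauchyError β E c κ (g ω)) P ∧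
      ∫ ω, cauchyError β E c κ (g ω) ∂P = cauchyError β E c κ fun z => ∫ ω, g ω z ∂P :=
  integral_error_combination (hg (spectralPoint E (1 / β)) (one_div_pos.2 hβ))
    (hg (spectralPoint (E + c / β) (κ / β)) (div_pos hκ hβ))
    (hg (spectralPoint (E - c / β) (κ / β)) (div_pos hκ hβ)) κ β⁻¹

/-- The bound for the mean of `cauchyError` given by the Wegner estimate. -/
noncomputable def errorBound (K α κ : ℝ) : ℝ := K * (κ + 4 * κ ^ α)

/-- Scaling: β⁻¹ (s/β)^(α-1) = s^(α-1) β^(-α). The endpoint terms carry a factor κ, which turns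
κ^(α-1) into κ^α; for α > 0 this vanishes with κ. -/
theorem cauchyError_le {β κ K α : ℝ} (hβ : 0 < β) (hκ : 0 < κ) (E c : ℝ) {g : ℂ → ℝ} {N : ℝ}
    (hg : ∀ z : ℂ, 0 < z.im → g z ≤ N * (K * z.im ^ (α - 1))) :
    cauchyError β E c κ g ≤ N * (errorBound K α κ * β ^ (-α)) := by
  have key : ∀ e s : ℝ, 0 < s → β⁻¹ * g (spectralPoint e (s / β))
      ≤ N * (K * s ^ (α - 1) * β ^ (-α)) := by
    intro e s hs
    have h1 := hg (spectralPoint e (s / β)) (div_pos hs hβ)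
    calc β⁻¹ * g (spectralPoint e (s / β)) ≤ β⁻¹ * (N * (K * (s / β) ^ (α - 1))) := by gcongr
      _ = _ := by
        rw [Real.div_rpow hs.le hβ.le, Real.rpow_neg hβ.le, Real.rpow_sub_one hβ.ne']
        field_simp
  have k1 := key E 1 one_pos
  have k2 := key (E + c / β) κ hκ
  have k3 := key (E - c / β) κ hκ
  have k4 : κ * κ ^ (α - 1) = κ ^ α := by rw [Real.rpow_sub_one hκ.ne']; field_simp
  rw [Real.one_rpow, mul_one] at k1
  calc cauchyError β E c κ g ≤ κ * (N * (K * β ^ (-α)))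
        + 2 * (κ * (N * (K * κ ^ (α - 1) * β ^ (-α))) + κ * (N * (K * κ ^ (α - 1) * β ^ (-α)))) := by
        unfold cauchyError
        gcongr
    _ = N * (K * (κ + 4 * (κ * κ ^ (α - 1))) * β ^ (-α)) := by ring
    _ = _ := by rw [k4, errorBound]

/-- F is not assumed measurable: it will be the random spectral mass of an interval. -/
theorem ofReal_integral_le_lintegral {Ω : Type*} [MeasurableSpace Ω] {P : Measure Ω} {f : Ω → ℝ}
    (hf : Integrable f P) {F : Ω → ℝ≥0∞} (h : ∀ ω, ENNReal.ofReal (f ω) ≤ F ω) :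
    ENNReal.ofReal (∫ ω, f ω ∂P) ≤ ∫⁻ ω, F ω ∂P := by
  calc ENNReal.ofReal (∫ ω, f ω ∂P) ≤ ENNReal.ofReal (∫ ω, max (f ω) 0 ∂P) :=
        ENNReal.ofReal_le_ofReal (integral_mono hf hf.pos_part fun ω => le_max_left _ _)
    _ = ∫⁻ ω, ENNReal.ofReal (max (f ω) 0) ∂P :=
        ofReal_integral_eq_lintegral_ofReal hf.pos_part (.of_forall fun ω => le_max_right _ _)
    _ ≤ ∫⁻ ω, F ω ∂P := lintegral_mono fun ω => by
        rw [ENNReal.ofReal_max, ENNReal.ofReal_zero, max_eq_left zero_le]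
        exact h ω

/-- The density of states of an interval is approximated by `cauchySum`. -/
theorem abs_ids_sub_cauchySum_le (hH0 : IsSelfAdjoint H0) (μ : Measure ℝ) [IsProbabilityMeasure μ]
    {β c κ : ℝ} (hβ : 0 < β) (hκ : 0 < κ) (E : ℝ) {m : ℕ} {t a : Fin m → ℝ}
    (ht : ∀ j, 0 < t j) (h : IsCauchyApprox c κ t a) :
    |(ids H0 μ (Set.Ioo (E - c / β) (E + c / β))).toReal - cauchySum β E t a (meanCauchy H0 μ)|
      ≤ cauchyError β E c κ (meanCauchy H0 μ) := by
  set J := Set.Ioo (E - c / β) (E + c / β)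
  have hfin := fun ω => isFiniteMeasure_spectralMeasure hH0 ω
  have hg : ∀ z : ℂ, 0 < z.im →
      Integrable (fun ω => cauchyTransform (originMeasure H0 ω) z) (law d μ) :=
    fun z hz => integrable_cauchyTransform hH0 μ hz
  obtain ⟨i1, e1⟩ := integral_cauchySum (law d μ) hg hβ E (a := a) ht
  obtain ⟨i2, e2⟩ := integral_cauchyError (law d μ) hg hβ hκ E c
  have hpt : ∀ ω, |(originMeasure H0 ω).real J
      - cauchySum β E t a (cauchyTransform (originMeasure H0 ω))|
      ≤ cauchyError β E c κ (cauchyTransform (originMeasure H0 ω)) := fun ω =>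
    abs_measureReal_sub_cauchySum_le (originMeasure H0 ω) hβ hκ E ht h
  have hreal : ∀ ω, originMeasure H0 ω J = ENNReal.ofReal ((originMeasure H0 ω).real J) := fun ω =>
    (ofReal_measureReal (measure_ne_top _ _)).symm
  -- Measurability of ω ↦ originMeasure H0 ω J is not used: the lower integral of this mass is
  -- squeezed between integrals of measurable combinations of Cauchy transforms.
  have hup : ids H0 μ J ≤ ENNReal.ofReal
      (cauchySum β E t a (meanCauchy H0 μ) + cauchyError β E c κ (meanCauchy H0 μ)) := by
    have : cauchySum β E t a (meanCauchy H0 μ) + cauchyError β E c κ (meanCauchy H0 μ)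
        = ∫ ω, (cauchySum β E t a (cauchyTransform (originMeasure H0 ω))
          + cauchyError β E c κ (cauchyTransform (originMeasure H0 ω))) ∂(law d μ) := by
      rw [integral_add i1 i2, e1, e2]
      rfl
    have i12 : Integrable (fun ω => cauchySum β E t a (cauchyTransform (originMeasure H0 ω))
        + cauchyError β E c κ (cauchyTransform (originMeasure H0 ω))) (law d μ) := i1.add i2
    rw [this, ofReal_integral_eq_lintegral_ofReal i12]
    · refine lintegral_mono fun ω => ?_
      change originMeasure H0 ω J ≤ _
      rw [hreal]
      refine ENNReal.ofReal_le_ofReal ?_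
      have := (abs_le.1 (hpt ω)).2
      linarith
    · refine .of_forall fun ω => ?_
      have := (abs_le.1 (hpt ω)).2
      have h0 : 0 ≤ (originMeasure H0 ω).real J := measureReal_nonneg
      simp only [Pi.zero_apply]
      linarith
  have hlow : ENNReal.ofReal
      (cauchySum β E t a (meanCauchy H0 μ) - cauchyError β E c κ (meanCauchy H0 μ))
        ≤ ids H0 μ J := by
    have : cauchySum β E t a (meanCauchy H0 μ) - cauchyError β E c κ (meanCauchy H0 μ)
        = ∫ ω, (cauchySum β E t a (cauchyTransform (originMeasure H0 ω))
          - cauchyError β E c κ (cauchyTransform (originMeasure H0 ω))) ∂(law d μ) := by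
      rw [integral_sub i1 i2, e1, e2]
      rfl
    rw [this]
    have i12 : Integrable (fun ω => cauchySum β E t a (cauchyTransform (originMeasure H0 ω))
        - cauchyError β E c κ (cauchyTransform (originMeasure H0 ω))) (law d μ) := i1.sub i2
    refine ofReal_integral_le_lintegral i12 fun ω => ?_
    change _ ≤ originMeasure H0 ω J
    rw [hreal]
    refine ENNReal.ofReal_le_ofReal ?_
    have := (abs_le.1 (hpt ω)).1
    linarith
  have hE0 : 0 ≤ cauchyError β E c κ (meanCauchy H0 μ) := by
    have : cauchyError β E c κ (meanCauchy H0 μ)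
        = ∫ ω, cauchyError β E c κ (cauchyTransform (originMeasure H0 ω)) ∂(law d μ) := e2.symm
    rw [this]
    exact integral_nonneg fun ω => (abs_nonneg _).trans (hpt ω)
  have hne : ids H0 μ J ≠ ⊤ := (hup.trans_lt ENNReal.ofReal_lt_top).ne
  have h1 := (ENNReal.ofReal_le_iff_le_toReal hne).1 hlow
  have hS : 0 ≤ cauchySum β E t a (meanCauchy H0 μ) + cauchyError β E c κ (meanCauchy H0 μ) := by
    have : cauchySum β E t a (meanCauchy H0 μ) + cauchyError β E c κ (meanCauchy H0 μ)
        = ∫ ω, (cauchySum β E t a (cauchyTransform (originMeasure H0 ω))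
          + cauchyError β E c κ (cauchyTransform (originMeasure H0 ω))) ∂(law d μ) := by
      rw [integral_add i1 i2, e1, e2]
      rfl
    rw [this]
    refine integral_nonneg fun ω => ?_
    have := (abs_le.1 (hpt ω)).2
    have h0 : 0 ≤ (originMeasure H0 ω).real J := measureReal_nonneg
    simp only [Pi.zero_apply]
    linarith
  have h2 := ENNReal.toReal_le_of_le_ofReal hS hup
  rw [abs_le]
  constructor <;> linarith

end Averages

variable {d : ℕ}

/-! ### Decomposition of a box into blocks -/

theorem card_cube (c : Fin d → ℤ) (ℓ : ℕ) : (cube c ℓ).card = ℓ ^ d := by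
  simp [cube, Fintype.card_piFinset]

/-- Side length of the blocks in which `Λ_L` is decomposed. -/
def blockSide (L : ℕ) : ℕ := Nat.sqrt (2 * L + 1)

/-- Distance of the core of a block to the complement of the block. -/
def blockDepth (L : ℕ) : ℕ := Nat.sqrt (blockSide L)

/-- The blocks of `Λ_L`. -/
noncomputable def block (L : ℕ) (p : Fin d → Fin (blockSide L)) : Finset (Fin d → ℤ) :=
  cube (fun i => -(L : ℤ) + (p i : ℕ) * (blockSide L : ℕ)) (blockSide L)

/-- The points of a block that are far from its complement. -/
noncomputable def core (L : ℕ) (p : Fin d → Fin (blockSide L)) : Finset (Fin d → ℤ) :=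
  cube (fun i => -(L : ℤ) + (p i : ℕ) * (blockSide L : ℕ) + (blockDepth L : ℕ))
    (blockSide L - 2 * blockDepth L)

theorem blockSide_mul_self_le (L : ℕ) : blockSide L * blockSide L ≤ 2 * L + 1 := Nat.sqrt_le _

theorem block_subset_box (L : ℕ) (p : Fin d → Fin (blockSide L)) : block L p ⊆ box d L := by
  intro k hk
  rw [block, mem_cube] at hk
  rw [mem_box]
  intro i
  obtain ⟨h1, h2⟩ := hk i
  have h3 : ((p i : ℕ) + 1) * blockSide L ≤ 2 * L + 1 :=
    (Nat.mul_le_mul_right _ (p i).2).trans (blockSide_mul_self_le L)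
  have h4 : (((p i : ℕ) : ℤ) + 1) * (blockSide L : ℤ) ≤ 2 * L + 1 := by exact_mod_cast h3
  have h5 : (0 : ℤ) ≤ ((p i : ℕ) : ℤ) * (blockSide L : ℤ) := by positivity
  constructor <;> linarith

theorem core_subset_block (L : ℕ) (p : Fin d → Fin (blockSide L)) : core L p ⊆ block L p := by
  intro k hk
  rw [core, mem_cube] at hk
  rw [block, mem_cube]
  intro i
  have := hk i
  omega

theorem pairwise_disjoint_block (L : ℕ) :
    Pairwise (Function.onFun Disjoint (block (d := d) L)) := by
  intro p p' hpp
  rw [Function.onFun, Finset.disjoint_left]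
  intro k hk hk'
  rw [block, mem_cube] at hk hk'
  refine hpp (funext fun i => Fin.ext ?_)
  obtain ⟨h1, h2⟩ := hk i
  obtain ⟨h3, h4⟩ := hk' i
  have h5 : ((p i : ℕ) : ℤ) < (p' i : ℕ) + 1 := by
    by_contra! h
    nlinarith
  have h6 : ((p' i : ℕ) : ℤ) < (p i : ℕ) + 1 := by
    by_contra! h
    nlinarith
  omega

theorem blockDepth_le_norm_sub {L : ℕ} {p : Fin d → Fin (blockSide L)} {n k : Fin d → ℤ}
    (hn : n ∈ core L p) (hk : k ∉ block L p) : (blockDepth L : ℝ) ≤ ‖n - k‖ := by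
  rw [core, mem_cube] at hn
  rw [block, mem_cube] at hk
  push Not at hk
  obtain ⟨i, hi⟩ := hk
  refine le_trans ?_ (norm_le_pi_norm (n - k) i)
  have h : (blockDepth L : ℤ) ≤ |n i - k i| := by
    have := hn i
    rw [le_abs]
    by_cases h : -(L : ℤ) + (p i : ℕ) * (blockSide L : ℕ) ≤ k i
    · have := hi h
      omega
    · omega
  rw [Pi.sub_apply, Int.norm_eq_abs]
  exact_mod_cast h

/-- Number of points of `Λ_L` that do not belong to the core of any block. -/
def blockDefect (d L : ℕ) : ℝ :=
  (2 * (L : ℝ) + 1) ^ d - ((blockSide L * (blockSide L - 2 * blockDepth L) : ℕ) : ℝ) ^ d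

theorem card_box (d L : ℕ) : ((box d L).card : ℝ) = (2 * (L : ℝ) + 1) ^ d := by
  rw [box, card_cube]
  push_cast
  rfl

theorem sum_card_core (d L : ℕ) : ((∑ p, (core (d := d) L p).card : ℕ) : ℝ)
    = ((blockSide L * (blockSide L - 2 * blockDepth L) : ℕ) : ℝ) ^ d := by
  simp only [core, card_cube, Finset.sum_const, Finset.card_univ, Fintype.card_fun,
    Fintype.card_fin, smul_eq_mul]
  push_cast
  rw [mul_pow]

theorem pairwiseDisjoint_core (L : ℕ) :
    (Set.univ : Set (Fin d → Fin (blockSide L))).PairwiseDisjoint (core L) :=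
  fun _ _ _ _ h => (pairwise_disjoint_block L h).mono (core_subset_block L _)
    (core_subset_block L _)

theorem sum_card_block_le (d L : ℕ) : ((∑ p, (block (d := d) L p).card : ℕ) : ℝ)
    ≤ (2 * (L : ℝ) + 1) ^ d := by
  rw [← card_box, ← Finset.card_biUnion fun p _ p' _ h => pairwise_disjoint_block L h]
  exact_mod_cast Finset.card_le_card (Finset.biUnion_subset.2 fun p _ => block_subset_box L p)

/-- Comparison in mean of a sum over a box with the sum over its blocks. -/
theorem integral_abs_sum_box_sub_le {Ω : Type*} [MeasurableSpace Ω] {P : Measure Ω} {L : ℕ}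
    {u : (Fin d → ℤ) → Ω → ℝ} {v : (Fin d → Fin (blockSide L)) → (Fin d → ℤ) → Ω → ℝ}
    (hu : ∀ n, Integrable (u n) P) (hv : ∀ p n, Integrable (v p n) P) {δ w : ℝ} (hδ : 0 ≤ δ)
    (hw : 0 ≤ w) (h : ∀ p, ∀ n ∈ core L p, ∫ ω, |u n ω - v p n ω| ∂P ≤ δ)
    (huw : ∀ n, ∫ ω, |u n ω| ∂P ≤ w) (hvw : ∀ p n, ∫ ω, |v p n ω| ∂P ≤ w) :
    ∫ ω, |∑ n ∈ box d L, u n ω - ∑ p, ∑ n ∈ block L p, v p n ω| ∂P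
      ≤ (2 * (L : ℝ) + 1) ^ d * δ + 2 * w * blockDefect d L := by
  classical
  set R : Finset (Fin d → ℤ) := Finset.univ.biUnion fun p => core L p
  have hR : R ⊆ box d L := Finset.biUnion_subset.2 fun p _ =>
    (core_subset_block L p).trans (block_subset_box L p)
  have hRcard : (R.card : ℝ) = ((∑ p, (core (d := d) L p).card : ℕ) : ℝ) := by
    rw [Finset.card_biUnion fun p _ p' _ h => pairwiseDisjoint_core L trivial trivial h]
  -- Three errors: box against block on the cores, box sites in no core, and block sites outside the
  -- core. The last two are estimated by size and number alone.
  have hpt : ∀ ω, |∑ n ∈ box d L, u n ω - ∑ p, ∑ n ∈ block L p, v p n ω|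
      ≤ ∑ p, ∑ n ∈ core L p, |u n ω - v p n ω| + ∑ n ∈ box d L \ R, |u n ω|
        + ∑ p, ∑ n ∈ block L p \ core L p, |v p n ω| := by
    intro ω
    have e1 : ∑ n ∈ box d L, u n ω
        = ∑ p, ∑ n ∈ core L p, u n ω + ∑ n ∈ box d L \ R, u n ω := by
      rw [← Finset.sum_sdiff hR, add_comm, Finset.sum_biUnion fun p _ p' _ h =>
        pairwiseDisjoint_core L trivial trivial h]
    have e2 : ∑ p, ∑ n ∈ block L p, v p n ω
        = ∑ p, ∑ n ∈ core L p, v p n ω + ∑ p, ∑ n ∈ block L p \ core L p, v p n ω := by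
      rw [← Finset.sum_add_distrib]
      refine Finset.sum_congr rfl fun p _ => ?_
      rw [← Finset.sum_sdiff (core_subset_block L p), add_comm]
    have e3 : ∑ n ∈ box d L, u n ω - ∑ p, ∑ n ∈ block L p, v p n ω
        = ∑ p, ∑ n ∈ core L p, (u n ω - v p n ω) + ∑ n ∈ box d L \ R, u n ω
          - ∑ p, ∑ n ∈ block L p \ core L p, v p n ω := by
      simp only [Finset.sum_sub_distrib]
      rw [e1, e2]
      ring
    rw [e3]
    refine (abs_sub _ _).trans (add_le_add ((abs_add_le _ _).trans (add_le_add ?_ ?_)) ?_)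
    · exact (Finset.abs_sum_le_sum_abs _ _).trans
        (Finset.sum_le_sum fun p _ => Finset.abs_sum_le_sum_abs _ _)
    · exact Finset.abs_sum_le_sum_abs _ _
    · exact (Finset.abs_sum_le_sum_abs _ _).trans
        (Finset.sum_le_sum fun p _ => Finset.abs_sum_le_sum_abs _ _)
  have i1 : ∀ p n, Integrable (fun ω => |u n ω - v p n ω|) P := fun p n => ((hu n).sub (hv p n)).abs
  have j1 : Integrable (fun ω => ∑ p, ∑ n ∈ core L p, |u n ω - v p n ω|) P :=
    integrable_finsetSum _ fun p _ => integrable_finsetSum _ fun n _ => i1 p n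
  have j2 : Integrable (fun ω => ∑ n ∈ box d L \ R, |u n ω|) P :=
    integrable_finsetSum _ fun n _ => (hu n).abs
  have j3 : Integrable (fun ω => ∑ p, ∑ n ∈ block L p \ core L p, |v p n ω|) P :=
    integrable_finsetSum _ fun p _ => integrable_finsetSum _ fun n _ => (hv p n).abs
  have j12 : Integrable (fun ω => ∑ p, ∑ n ∈ core L p, |u n ω - v p n ω|
      + ∑ n ∈ box d L \ R, |u n ω|) P := j1.add j2
  have b1 : ∫ ω, ∑ p, ∑ n ∈ core L p, |u n ω - v p n ω| ∂P ≤ (2 * (L : ℝ) + 1) ^ d * δ := by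
    rw [integral_finsetSum _ fun p _ => integrable_finsetSum _ fun n _ => i1 p n]
    calc ∑ p, ∫ ω, ∑ n ∈ core L p, |u n ω - v p n ω| ∂P
        = ∑ p, ∑ n ∈ core L p, ∫ ω, |u n ω - v p n ω| ∂P :=
          Finset.sum_congr rfl fun p _ => integral_finsetSum _ fun n _ => i1 p n
      _ ≤ ∑ p, ∑ _n ∈ core L p, δ :=
          Finset.sum_le_sum fun p _ => Finset.sum_le_sum fun n hn => h p n hn
      _ = R.card * δ := by
          rw [hRcard]
          simp only [Finset.sum_const, nsmul_eq_mul, ← Finset.sum_mul]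
          push_cast
          rfl
      _ ≤ _ := by
          refine mul_le_mul_of_nonneg_right ?_ hδ
          rw [← card_box]
          exact_mod_cast Finset.card_le_card hR
  have b2 : ∫ ω, ∑ n ∈ box d L \ R, |u n ω| ∂P ≤ w * blockDefect d L := by
    rw [integral_finsetSum _ fun n _ => (hu n).abs]
    calc ∑ n ∈ box d L \ R, ∫ ω, |u n ω| ∂P ≤ ∑ _n ∈ box d L \ R, w :=
          Finset.sum_le_sum fun n _ => huw n
      _ = w * ((box d L \ R).card : ℝ) := by
          rw [Finset.sum_const, nsmul_eq_mul, mul_comm]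
      _ = _ := by
          rw [Finset.cast_card_sdiff hR, hRcard, sum_card_core, card_box, blockDefect]
  -- The blocks are disjoint subsets of the box, so their sites outside the cores number at most the
  -- defect as well.
  have b3 : ∫ ω, ∑ p, ∑ n ∈ block L p \ core L p, |v p n ω| ∂P ≤ w * blockDefect d L := by
    rw [integral_finsetSum _ fun p _ => integrable_finsetSum _ fun n _ => (hv p n).abs]
    calc ∑ p, ∫ ω, ∑ n ∈ block L p \ core L p, |v p n ω| ∂P
        = ∑ p, ∑ n ∈ block L p \ core L p, ∫ ω, |v p n ω| ∂P :=
          Finset.sum_congr rfl fun p _ => integral_finsetSum _ fun n _ => (hv p n).abs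
      _ ≤ ∑ p, ∑ _n ∈ block L p \ core L p, w :=
          Finset.sum_le_sum fun p _ => Finset.sum_le_sum fun n _ => hvw p n
      _ = w * ∑ p, (((block L p).card : ℝ) - (core L p).card) := by
          rw [Finset.mul_sum]
          refine Finset.sum_congr rfl fun p _ => ?_
          rw [Finset.sum_const, nsmul_eq_mul, Finset.cast_card_sdiff (core_subset_block L p),
            mul_comm]
      _ ≤ _ := by
          refine mul_le_mul_of_nonneg_left ?_ hw
          rw [Finset.sum_sub_distrib, blockDefect, ← sum_card_core]
          have := sum_card_block_le d L
          push_cast at this ⊢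
          linarith
  calc _ ≤ ∫ ω, (∑ p, ∑ n ∈ core L p, |u n ω - v p n ω| + ∑ n ∈ box d L \ R, |u n ω|
        + ∑ p, ∑ n ∈ block L p \ core L p, |v p n ω|) ∂P :=
        integral_mono_of_nonneg (.of_forall fun ω => abs_nonneg _) (j12.add j3) (.of_forall hpt)
    _ ≤ _ := by
        rw [integral_add j12 j3, integral_add j1 j2]
        linarith

/-! ### Asymptotics of the block decomposition -/

theorem lt_blockDepth_pow (L : ℕ) : 2 * L + 1 < (blockDepth L + 1) ^ 4 := by
  have h1 : 2 * L + 1 < (blockSide L + 1) * (blockSide L + 1) := Nat.lt_succ_sqrt _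
  have h2 : blockSide L < (blockDepth L + 1) * (blockDepth L + 1) := Nat.lt_succ_sqrt _
  calc 2 * L + 1 < (blockSide L + 1) * (blockSide L + 1) := h1
    _ ≤ ((blockDepth L + 1) * (blockDepth L + 1)) * ((blockDepth L + 1) * (blockDepth L + 1)) :=
      Nat.mul_le_mul h2 h2
    _ = _ := by ring

theorem tendsto_natSqrt_atTop : Tendsto Nat.sqrt atTop atTop :=
  tendsto_atTop.2 fun b => (eventually_ge_atTop (b * b)).mono fun _ h => Nat.le_sqrt.2 h

theorem tendsto_blockSide_atTop : Tendsto blockSide atTop atTop :=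
  tendsto_natSqrt_atTop.comp (tendsto_atTop_mono (fun n => by simp only [id]; omega) tendsto_id)

theorem tendsto_blockDepth_atTop : Tendsto blockDepth atTop atTop :=
  tendsto_natSqrt_atTop.comp tendsto_blockSide_atTop

theorem tendsto_natSqrt_div : Tendsto (fun n : ℕ => (Nat.sqrt n : ℝ) / n) atTop (𝓝 0) := by
  have h : Tendsto (fun n : ℕ => ((Nat.sqrt n : ℕ) : ℝ)⁻¹) atTop (𝓝 0) :=
    tendsto_inv_atTop_zero.comp (tendsto_natCast_atTop_atTop.comp tendsto_natSqrt_atTop)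
  refine squeeze_zero (fun n => by positivity) (fun n => ?_) h
  rcases Nat.eq_zero_or_pos (Nat.sqrt n) with h0 | h0
  · simp [h0]
  · have h1 : (0 : ℝ) < Nat.sqrt n := by exact_mod_cast h0
    have h2 : (Nat.sqrt n : ℝ) * Nat.sqrt n ≤ n := by exact_mod_cast Nat.sqrt_le n
    rw [div_le_iff₀ (by nlinarith), inv_mul_eq_div, le_div_iff₀ h1]
    exact h2

theorem tendsto_blockSide_mul_self_div :
    Tendsto (fun L : ℕ => (blockSide L : ℝ) * blockSide L / (2 * (L : ℝ) + 1)) atTop (𝓝 1) := by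
  have hn : Tendsto (fun L : ℕ => 2 * L + 1) atTop atTop :=
    tendsto_atTop_mono (fun n => by simp only [id]; omega) tendsto_id
  have h1 : Tendsto (fun L : ℕ => 1 - 2 * ((Nat.sqrt (2 * L + 1) : ℝ) / ((2 * L + 1 : ℕ) : ℝ)))
      atTop (𝓝 1) := by
    simpa using ((tendsto_natSqrt_div.comp hn).const_mul 2).const_sub 1
  refine tendsto_of_tendsto_of_tendsto_of_le_of_le h1 tendsto_const_nhds (fun L => ?_) fun L => ?_
  · have h3 : 2 * L + 1 ≤ blockSide L * blockSide L + blockSide L + blockSide L :=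
      Nat.sqrt_le_add _
    have h4 : 2 * (L : ℝ) + 1 ≤ blockSide L * blockSide L + blockSide L + blockSide L := by
      exact_mod_cast h3
    have h5 : (0 : ℝ) < 2 * L + 1 := by positivity
    have e : ((Nat.sqrt (2 * L + 1) : ℕ) : ℝ) = blockSide L := rfl
    simp only [e]
    push_cast
    rw [le_div_iff₀ h5, sub_mul, mul_assoc, div_mul_cancel₀ _ h5.ne']
    linarith
  · have h5 : (0 : ℝ) < 2 * L + 1 := by positivity
    have h4 : (blockSide L : ℝ) * blockSide L ≤ 2 * (L : ℝ) + 1 := by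
      exact_mod_cast blockSide_mul_self_le L
    exact (div_le_one h5).2 h4

theorem tendsto_blockDefect_div (d : ℕ) :
    Tendsto (fun L : ℕ => blockDefect d L / (2 * (L : ℝ) + 1) ^ d) atTop (𝓝 0) := by
  have h1 : Tendsto (fun L : ℕ => 1 - 2 * ((blockDepth L : ℝ) / blockSide L)) atTop (𝓝 1) := by
    have := ((tendsto_natSqrt_div.comp tendsto_blockSide_atTop).const_mul 2).const_sub 1
    rwa [mul_zero, sub_zero] at this
  have h2 := (tendsto_blockSide_mul_self_div.mul h1).pow d
  rw [mul_one, one_pow] at h2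
  have h3 := h2.const_sub 1
  rw [sub_self] at h3
  have hpos : ∀ᶠ L in atTop, 4 ≤ blockDepth L := tendsto_blockDepth_atTop.eventually_ge_atTop 4
  refine h3.congr' (hpos.mono fun L hL => ?_)
  have hD : blockDepth L * blockDepth L ≤ blockSide L := Nat.sqrt_le _
  have h4 : 2 * blockDepth L ≤ blockSide L := by nlinarith
  have h5 : (0 : ℝ) < 2 * L + 1 := by positivity
  have h6 : (0 : ℝ) < blockSide L := by
    have : 0 < blockSide L := by omega
    exact_mod_cast this
  change _ = blockDefect d L / (2 * (L : ℝ) + 1) ^ d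
  rw [blockDefect, sub_div, div_self (by positivity), ← div_pow, Nat.cast_mul, Nat.cast_sub h4]
  push_cast
  congr 2
  field_simp

variable {d : ℕ} {H0 : L2 d →L[ℂ] L2 d}

/-! ### Limits along the sequence of boxes -/

theorem scale_pos (d : ℕ) (α : ℝ) (L : ℕ) : 0 < scale d α L :=
  Real.rpow_pos_of_pos (by positivity) _

theorem scale_rpow (d : ℕ) {α : ℝ} (hα : 0 < α) (L : ℕ) :
    scale d α L ^ α = (2 * (L : ℝ) + 1) ^ d := by
  rw [scale, ← Real.rpow_mul (by positivity), div_mul_cancel₀ _ hα.ne', Real.rpow_natCast]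

theorem scale_rpow_neg (d : ℕ) {α : ℝ} (hα : 0 < α) (L : ℕ) :
    scale d α L ^ (-α) = ((2 * (L : ℝ) + 1) ^ d)⁻¹ := by
  rw [Real.rpow_neg (scale_pos d α L).le, scale_rpow d hα]

theorem tendsto_two_mul_add_one : Tendsto (fun L : ℕ => 2 * (L : ℝ) + 1) atTop atTop :=
  tendsto_atTop_add_const_right _ _ (tendsto_natCast_atTop_atTop.const_mul_atTop two_pos)

theorem tendsto_scale_atTop (hd : 1 ≤ d) {α : ℝ} (hα : 0 < α) :
    Tendsto (scale d α) atTop atTop :=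
  (tendsto_rpow_atTop (div_pos (by exact_mod_cast hd) hα)).comp tendsto_two_mul_add_one

/-- The prefactor is at most (2L+1)^(d/α + 2d), and 2L+1 is at most the fourth power of the depth
plus one; the exponential in the depth beats any such power. The shift by one in the exponent costs
the constant exp γ. -/
theorem tendsto_scale_mul_exp (d : ℕ) {α γ : ℝ} (hα : 0 < α) (hγ : 0 < γ) :
    Tendsto (fun L : ℕ => scale d α L * (2 * (L : ℝ) + 1) ^ d * (blockSide L : ℝ) ^ d
      * Real.exp (-γ * blockDepth L)) atTop (𝓝 0) := by
  set e : ℝ := d / α + 2 * d with he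
  have he0 : 0 ≤ e := by positivity
  have hD : Tendsto (fun L : ℕ => (blockDepth L : ℝ) + 1) atTop atTop :=
    tendsto_atTop_add_const_right _ _ (tendsto_natCast_atTop_atTop.comp tendsto_blockDepth_atTop)
  have h1 := ((tendsto_rpow_mul_exp_neg_mul_atTop_nhds_zero (4 * e) γ hγ).comp hD).const_mul
    (Real.exp γ)
  rw [mul_zero] at h1
  refine squeeze_zero (fun L => ?_) (fun L => ?_) h1
  · have := scale_pos d α L
    positivity
  · have hW : (0 : ℝ) < 2 * L + 1 := by positivity
    have hq : (blockSide L : ℝ) ≤ 2 * L + 1 := by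
      have := Nat.sqrt_le_self (2 * L + 1)
      exact_mod_cast this
    have hDW : 2 * (L : ℝ) + 1 ≤ ((blockDepth L : ℝ) + 1) ^ 4 := by
      exact_mod_cast (lt_blockDepth_pow L).le
    have h2 : scale d α L * (2 * (L : ℝ) + 1) ^ d * (blockSide L : ℝ) ^ d
        ≤ ((blockDepth L : ℝ) + 1) ^ (4 * e) := by
      calc scale d α L * (2 * (L : ℝ) + 1) ^ d * (blockSide L : ℝ) ^ d
          ≤ scale d α L * (2 * (L : ℝ) + 1) ^ d * (2 * (L : ℝ) + 1) ^ d := by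
            have := scale_pos d α L
            gcongr
        _ = (2 * (L : ℝ) + 1) ^ e := by
            rw [he, Real.rpow_add hW, two_mul (d : ℝ), Real.rpow_add hW, Real.rpow_natCast, scale,
              mul_assoc]
        _ ≤ (((blockDepth L : ℝ) + 1) ^ 4) ^ e := Real.rpow_le_rpow hW.le hDW he0
        _ = _ := by
            rw [← Real.rpow_natCast, ← Real.rpow_mul (by positivity)]
            norm_num
    have h3 : Real.exp (-γ * blockDepth L)
        = Real.exp γ * Real.exp (-γ * ((blockDepth L : ℝ) + 1)) := by
      rw [← Real.exp_add]
      congr 1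
      ring
    calc _ ≤ ((blockDepth L : ℝ) + 1) ^ (4 * e)
          * (Real.exp γ * Real.exp (-γ * ((blockDepth L : ℝ) + 1))) := by
          rw [h3]
          gcongr
      _ = _ := by
          simp only [Function.comp_apply]
          ring

/-- At height t/β the factor 1/(Im z)² leaves a net power β¹ in the localization term. In the defect
term β⁻¹ β^(1-α) = β^(-α) = (2L+1)^(-d), exactly the normalization making the defect negligible. -/
theorem tendsto_comparison_bound (d : ℕ) {α γ : ℝ} (hα : 0 < α) (hγ : 0 < γ) (C K : ℝ) {t : ℝ}
    (ht : 0 < t) :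
    Tendsto (fun L : ℕ => (scale d α L)⁻¹ * ((2 * (L : ℝ) + 1) ^ d
        * (C * (blockSide L : ℝ) ^ d / (t / scale d α L) ^ 2 * Real.exp (-γ * blockDepth L))
      + 2 * (K * (t / scale d α L) ^ (α - 1)) * blockDefect d L)) atTop (𝓝 0) := by
  have h1 := ((tendsto_scale_mul_exp d hα hγ).const_mul (C / t ^ 2)).add
    ((tendsto_blockDefect_div d).const_mul (2 * K * t ^ (α - 1)))
  rw [mul_zero, mul_zero, add_zero] at h1
  refine h1.congr fun L => ?_
  have hβ := scale_pos d α L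
  have e1 : (2 * (L : ℝ) + 1) ^ d = scale d α L ^ α := (scale_rpow d hα L).symm
  rw [Real.div_rpow ht.le hβ.le, Real.rpow_sub_one hβ.ne', e1]
  have h0 : 0 < scale d α L ^ α := Real.rpow_pos_of_pos hβ _
  field_simp

/-- The trace of the imaginary part of the finite volume resolvent. -/
noncomputable def imTrace (H0 : L2 d →L[ℂ] L2 d) (ω : (Fin d → ℤ) → ℝ) (S : Finset (Fin d → ℤ))
    (z : ℂ) : ℝ :=
  ∑ n ∈ S, imGreenDiag H0 ω S z n

theorem integrable_imTrace (hH0 : IsSelfAdjoint H0) (μ : Measure ℝ) [IsProbabilityMeasure μ]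
    (S : Finset (Fin d → ℤ)) {z : ℂ} (hz : 0 < z.im) :
    Integrable (fun ω => imTrace H0 ω S z) (law d μ) :=
  integrable_finsetSum _ fun n _ => integrable_imGreenDiag hH0 μ S hz n

theorem integral_imTrace (hH0 : IsSelfAdjoint H0) (μ : Measure ℝ) [IsProbabilityMeasure μ]
    (S : Finset (Fin d → ℤ)) {z : ℂ} (hz : 0 < z.im) :
    ∫ ω, imTrace H0 ω S z ∂(law d μ) = ∑ n ∈ S, ∫ ω, imGreenDiag H0 ω S z n ∂(law d μ) :=
  integral_finsetSum _ fun n _ => integrable_imGreenDiag hH0 μ S hz n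

theorem integral_imTrace_le (hH0 : IsSelfAdjoint H0) {μ : Measure ℝ} [IsProbabilityMeasure μ]
    {α K : ℝ} (hK : WegnerBound H0 μ α K) (S : Finset (Fin d → ℤ)) {z : ℂ} (hz : 0 < z.im) :
    ∫ ω, imTrace H0 ω S z ∂(law d μ) ≤ S.card * (K * z.im ^ (α - 1)) := by
  rw [integral_imTrace hH0 μ S hz, ← nsmul_eq_mul]
  exact Finset.sum_le_card_nsmul _ _ _ fun n _ => integral_imGreenDiag_le hH0 hK S hz n

/-- Localization controls the cores and the Wegner bound all other sites. All spectral parameters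
have real part E, which lies in [a, b]. -/
theorem tendsto_imTrace_comparison (hd : 1 ≤ d) (hH0 : IsSelfAdjoint H0)
    (htrans : CommutesWithTranslations H0) {μ : Measure ℝ} [IsProbabilityMeasure μ]
    {α K : ℝ} (hα : 0 < α) (hK : WegnerBound H0 μ α K) {a b : ℝ}
    (hloc : FractionalMomentDecay H0 μ a b) {E : ℝ} (hE : E ∈ Set.Icc a b) {t : ℝ} (ht : 0 < t) :
    Tendsto (fun L => (scale d α L)⁻¹ * ∫ ω, |imTrace H0 ω (box d L)
        (spectralPoint E (t / scale d α L)) - ∑ p, imTrace H0 ω (block L p)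
          (spectralPoint E (t / scale d α L))| ∂(law d μ)) atTop (𝓝 0) ∧
    Tendsto (fun L => (scale d α L)⁻¹ * |(2 * (L : ℝ) + 1) ^ d
        * meanCauchy H0 μ (spectralPoint E (t / scale d α L)) - ∑ p, ∫ ω, imTrace H0 ω (block L p)
          (spectralPoint E (t / scale d α L)) ∂(law d μ)|) atTop (𝓝 0) := by
  obtain ⟨C, γ, ℓ₀, hC, hγ, h⟩ := exists_volume_comparison hH0 htrans hloc
  have hlim := tendsto_comparison_bound d hα hγ C K ht
  have hev : ∀ᶠ L in atTop, t / scale d α L ≤ 1 := by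
    filter_upwards [(tendsto_scale_atTop hd hα).eventually_ge_atTop t] with L hL
    exact (div_le_one (scale_pos d α L)).2 hL
  have hev' := hev.and (eventually_ge_atTop ℓ₀)
  have hzim : ∀ L, 0 < (spectralPoint E (t / scale d α L)).im := fun L =>
    div_pos ht (scale_pos d α L)
  have hw : ∀ L, 0 ≤ K * (t / scale d α L) ^ (α - 1) := fun L =>
    mul_nonneg hK.1 (Real.rpow_nonneg (div_pos ht (scale_pos d α L)).le _)
  have hδ : ∀ L : ℕ, 0 ≤ C * (blockSide L : ℝ) ^ d / (t / scale d α L) ^ 2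
      * Real.exp (-γ * blockDepth L) := fun L => by positivity
  have hint : ∀ (L : ℕ) (S : Finset (Fin d → ℤ)) n,
      ∫ ω, |imGreenDiag H0 ω S (spectralPoint E (t / scale d α L)) n| ∂(law d μ)
        ≤ K * (t / scale d α L) ^ (α - 1) := by
    intro L S n
    simp only [abs_of_nonneg (imGreenDiag_nonneg hH0 _ _ (hzim L) _)]
    exact integral_imGreenDiag_le hH0 hK S (hzim L) n
  constructor
  · refine squeeze_zero' (.of_forall fun L => mul_nonneg (inv_nonneg.2 (scale_pos d α L).le)
      (integral_nonneg fun _ => abs_nonneg _)) (hev'.mono fun L hL => ?_) hlim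
    refine mul_le_mul_of_nonneg_left ?_ (inv_nonneg.2 (scale_pos d α L).le)
    refine integral_abs_sum_box_sub_le
      (fun n => integrable_imGreenDiag hH0 μ _ (hzim L) n)
      (fun p n => integrable_imGreenDiag hH0 μ _ (hzim L) n) (hδ L) (hw L) (fun p n hn => ?_)
      (fun n => hint L _ n) (fun p n => hint L _ n)
    have := (h (block L p) n (core_subset_block L p hn) (blockDepth L)
      (fun k hk => blockDepth_le_norm_sub hn hk) _ (hzim L) hL.1 hE).1 _ (2 * L + 1)
      (by omega) (block_subset_box L p)
    rwa [block, card_cube, Nat.cast_pow] at this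
  · refine squeeze_zero' (.of_forall fun L => mul_nonneg (inv_nonneg.2 (scale_pos d α L).le)
      (abs_nonneg _)) (hev.mono fun L hL => ?_) hlim
    refine mul_le_mul_of_nonneg_left ?_ (inv_nonneg.2 (scale_pos d α L).le)
    -- The same block estimate for deterministic summands: the infinite volume mean at each box site
    -- against the expected block Green functions.
    have key := integral_abs_sum_box_sub_le (P := law d μ) (L := L)
      (u := fun (_ : Fin d → ℤ) _ => meanCauchy H0 μ (spectralPoint E (t / scale d α L)))
      (v := fun p n _ => ∫ ω, imGreenDiag H0 ω (block L p)
        (spectralPoint E (t / scale d α L)) n ∂(law d μ))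
      (fun _ => integrable_const _) (fun _ _ => integrable_const _) (hδ L) (hw L)
      (fun p n hn => ?_) (fun n => ?_) fun p n => ?_
    · simp only [integral_const, probReal_univ, one_smul, Finset.sum_const, nsmul_eq_mul,
        card_box] at key
      simpa only [integral_imTrace hH0 μ _ (hzim L)] using key
    · simp only [integral_const, probReal_univ, one_smul]
      have := (h (block L p) n (core_subset_block L p hn) (blockDepth L)
        (fun k hk => blockDepth_le_norm_sub hn hk) _ (hzim L) hL hE).2
      rwa [block, card_cube, Nat.cast_pow] at this
    · simp only [integral_const, probReal_univ, one_smul]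
      rw [abs_of_nonneg (meanCauchy_nonneg hH0 μ (hzim L))]
      exact meanCauchy_le hH0 hK (hzim L)
    · simp only [integral_const, probReal_univ, one_smul]
      exact abs_integral_le_integral_abs.trans (hint L _ n)

theorem abs_cauchySum_sub_sum_le {ι : Type*} [Fintype ι] {β : ℝ} (hβ : 0 < β) (E : ℝ) {m : ℕ}
    (t a : Fin m → ℝ) (g : ℂ → ℝ) (f : ι → ℂ → ℝ) :
    |cauchySum β E t a g - ∑ p, cauchySum β E t a (f p)|
      ≤ ∑ j, |a j| * (β⁻¹ * |g (spectralPoint E (t j / β)) - ∑ p, f p (spectralPoint E (t j / β))|)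
      := by
  have e : cauchySum β E t a g - ∑ p, cauchySum β E t a (f p) = ∑ j, a j * (β⁻¹
      * (g (spectralPoint E (t j / β)) - ∑ p, f p (spectralPoint E (t j / β)))) := by
    simp only [cauchySum, mul_sub, Finset.sum_sub_distrib, Finset.mul_sum]
    congr 1
    exact Finset.sum_comm
  rw [e]
  refine (Finset.abs_sum_le_sum_abs _ _).trans (Finset.sum_le_sum fun j _ => ?_)
  rw [abs_mul, abs_mul, abs_of_pos (inv_pos.2 hβ)]

theorem tendsto_errorBound (K : ℝ) {α : ℝ} (hα : 0 < α) :
    Tendsto (errorBound K α) (𝓝[>] 0) (𝓝 0) := by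
  have h : Tendsto (errorBound K α) (𝓝 0) (𝓝 (errorBound K α 0)) := by
    have h1 : Continuous fun κ : ℝ => κ ^ α := Real.continuous_rpow_const hα.le
    have : Continuous (errorBound K α) := by unfold errorBound; fun_prop
    exact this.tendsto 0
  have h0 : errorBound K α 0 = 0 := by simp [errorBound, Real.zero_rpow hα.ne']
  rw [h0] at h
  exact h.mono_left nhdsWithin_le_nhds

/-- Order of limits: L → ∞ with κ fixed, then κ → 0. The error must therefore be uniform in L,
whereas the approximating kernels may depend on κ. -/
theorem tendsto_zero_of_le_errorBound {K α : ℝ} (hα : 0 < α) {f : ℕ → ℝ} (hf : ∀ L, 0 ≤ f L)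
    (h : ∀ κ, 0 < κ → ∃ g : ℕ → ℝ, Tendsto g atTop (𝓝 0) ∧
      ∀ L, f L ≤ g L + 2 * errorBound K α κ) : Tendsto f atTop (𝓝 0) := by
  rw [Metric.tendsto_atTop']
  intro ε hε
  have h1 := (tendsto_errorBound K hα).eventually (gt_mem_nhds (show (0 : ℝ) < ε / 4 by linarith))
  obtain ⟨κ, hκ, hκ0⟩ := (h1.and self_mem_nhdsWithin).exists
  obtain ⟨g, hg, hfg⟩ := h κ hκ0
  obtain ⟨N, hN⟩ := eventually_atTop.1 (hg.eventually (gt_mem_nhds (show (0 : ℝ) < ε / 2 by linarith)))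
  refine ⟨N, fun L hL => ?_⟩
  rw [Real.dist_eq, sub_zero, abs_of_nonneg (hf L)]
  have := hfg L
  have := hN L hL.le
  linarith

variable {d : ℕ} {H0 : L2 d →L[ℂ] L2 d}

/-! ### Level counts of a box, of its blocks, and the density of states -/

theorem integrable_levelCount (hH0 : IsSelfAdjoint H0) (μ : Measure ℝ) [IsProbabilityMeasure μ]
    (Λ : Finset (Fin d → ℤ)) (E : ℝ) {r : ℝ} (hr : 0 < r) :
    Integrable (fun ω => (levelCount hH0 Λ E r ω : ℝ)) (law d μ) := by
  refine .of_bound (measurable_from_nat.comp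
    (measurable_levelCount hH0 Λ E hr)).aestronglyMeasurable Λ.card (.of_forall fun ω => ?_)
  rw [Real.norm_eq_abs, Nat.abs_cast]
  exact_mod_cast levelCount_le_card hH0 Λ E r ω

theorem integral_cauchyError_imTrace_le (hH0 : IsSelfAdjoint H0) {μ : Measure ℝ}
    [IsProbabilityMeasure μ] {α K : ℝ} (hK : WegnerBound H0 μ α K) (S : Finset (Fin d → ℤ))
    {β κ : ℝ} (hβ : 0 < β) (hκ : 0 < κ) (E c : ℝ) :
    ∫ ω, cauchyError β E c κ (imTrace H0 ω S) ∂(law d μ)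
      ≤ S.card * (errorBound K α κ * β ^ (-α)) := by
  rw [(integral_cauchyError (law d μ) (fun z hz => integrable_imTrace hH0 μ S hz) hβ hκ E c).2]
  exact cauchyError_le hβ hκ E c fun z hz => integral_imTrace_le hH0 hK S hz

theorem sum_card_block_mul_le {α K κ : ℝ} (hα : 0 < α) (hK : 0 ≤ K) (hκ : 0 < κ) (L : ℕ) :
    ∑ p, ((block (d := d) L p).card : ℝ) * (errorBound K α κ * scale d α L ^ (-α))
      ≤ errorBound K α κ := by
  have he : 0 ≤ errorBound K α κ := by unfold errorBound; positivity
  have h := sum_card_block_le d L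
  have hV : (0 : ℝ) < (2 * (L : ℝ) + 1) ^ d := by positivity
  push_cast at h
  rw [← Finset.sum_mul, scale_rpow_neg d hα]
  calc _ ≤ (2 * (L : ℝ) + 1) ^ d * (errorBound K α κ * ((2 * (L : ℝ) + 1) ^ d)⁻¹) := by gcongr
    _ = _ := by field_simp

theorem box_card_mul_eq {α K κ : ℝ} (hα : 0 < α) (L : ℕ) :
    (2 * (L : ℝ) + 1) ^ d * (errorBound K α κ * scale d α L ^ (-α)) = errorBound K α κ := by
  have hV : (0 : ℝ) < (2 * (L : ℝ) + 1) ^ d := by positivity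
  rw [scale_rpow_neg d hα]
  field_simp

/-- The levels in a box are, in mean, those in its blocks. -/
theorem tendsto_integral_abs_levelCount_sub (hd : 1 ≤ d) (hH0 : IsSelfAdjoint H0)
    (htrans : CommutesWithTranslations H0) {μ : Measure ℝ} [IsProbabilityMeasure μ]
    {α K : ℝ} (hα : 0 < α) (hK : WegnerBound H0 μ α K) {a b : ℝ}
    (hloc : FractionalMomentDecay H0 μ a b) {E : ℝ} (hE : E ∈ Set.Icc a b) {c : ℝ} (hc : 0 < c) :
    Tendsto (fun L => ∫ ω, |(levelCount hH0 (box d L) E (c / scale d α L) ω : ℝ)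
      - ∑ p, (levelCount hH0 (block L p) E (c / scale d α L) ω : ℝ)| ∂(law d μ)) atTop (𝓝 0) := by
  refine tendsto_zero_of_le_errorBound (K := K) hα (fun L => integral_nonneg fun _ => abs_nonneg _)
    fun κ hκ => ?_
  obtain ⟨m, t, w, ht, happ, -⟩ := exists_cauchy_approx hc hκ
  refine ⟨fun L => ∑ j, |w j| * ((scale d α L)⁻¹ * ∫ ω, |imTrace H0 ω (box d L)
        (spectralPoint E (t j / scale d α L)) - ∑ p, imTrace H0 ω (block L p)
          (spectralPoint E (t j / scale d α L))| ∂(law d μ)), ?_, fun L => ?_⟩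
  · have := tendsto_finsetSum (Finset.univ : Finset (Fin m)) fun j _ =>
      (tendsto_imTrace_comparison hd hH0 htrans hα hK hloc hE (ht j)).1.const_mul |w j|
    simpa using this
  set β := scale d α L with hβdef
  have hβ : 0 < β := scale_pos d α L
  have hz : ∀ j, 0 < (spectralPoint E (t j / β)).im := fun j => div_pos (ht j) hβ
  have hg : ∀ S : Finset (Fin d → ℤ), ∀ z : ℂ, 0 < z.im →
      Integrable (fun ω => imTrace H0 ω S z) (law d μ) := fun S z hz =>
    integrable_imTrace hH0 μ S hz
  have j0 : Integrable (fun ω => cauchyError β E c κ (imTrace H0 ω (box d L))) (law d μ) :=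
    (integral_cauchyError (law d μ) (hg _) hβ hκ E c).1
  have j1 : ∀ p, Integrable (fun ω => cauchyError β E c κ (imTrace H0 ω (block L p))) (law d μ) :=
    fun p => (integral_cauchyError (law d μ) (hg _) hβ hκ E c).1
  have j2 : ∀ j, Integrable (fun ω => |w j| * (β⁻¹ * |imTrace H0 ω (box d L)
      (spectralPoint E (t j / β)) - ∑ p, imTrace H0 ω (block L p) (spectralPoint E (t j / β))|))
      (law d μ) := fun j =>
    (((hg _ _ (hz j)).sub (integrable_finsetSum _ fun p _ => hg _ _ (hz j))).abs.const_mul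
      _).const_mul _
  have k1 : Integrable (fun ω => ∑ p, cauchyError β E c κ (imTrace H0 ω (block L p)))
      (law d μ) := integrable_finsetSum _ fun p _ => j1 p
  have k2 : Integrable (fun ω => ∑ j, |w j| * (β⁻¹ * |imTrace H0 ω (box d L)
      (spectralPoint E (t j / β)) - ∑ p, imTrace H0 ω (block L p) (spectralPoint E (t j / β))|))
      (law d μ) := integrable_finsetSum _ fun j _ => j2 j
  have k02 : Integrable (fun ω => cauchyError β E c κ (imTrace H0 ω (box d L))
      + ∑ j, |w j| * (β⁻¹ * |imTrace H0 ω (box d L) (spectralPoint E (t j / β))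
        - ∑ p, imTrace H0 ω (block L p) (spectralPoint E (t j / β))|)) (law d μ) := j0.add k2
  -- Box count, box Cauchy sum, block Cauchy sums, block counts: only the middle passage relies on
  -- localization, the outer two on the Wegner bound.
  have hpt : ∀ ω, |(levelCount hH0 (box d L) E (c / β) ω : ℝ)
      - ∑ p, (levelCount hH0 (block L p) E (c / β) ω : ℝ)|
      ≤ cauchyError β E c κ (imTrace H0 ω (box d L))
        + ∑ j, |w j| * (β⁻¹ * |imTrace H0 ω (box d L) (spectralPoint E (t j / β))
          - ∑ p, imTrace H0 ω (block L p) (spectralPoint E (t j / β))|)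
        + ∑ p, cauchyError β E c κ (imTrace H0 ω (block L p)) := by
    intro ω
    have h0 := abs_levelCount_sub_cauchySum_le hH0 (box d L) ω hβ hκ E ht happ
    have h1 := abs_cauchySum_sub_sum_le hβ E t w (imTrace H0 ω (box d L))
      fun p => imTrace H0 ω (block L p)
    have h2 : |∑ p, cauchySum β E t w (imTrace H0 ω (block L p))
        - ∑ p, (levelCount hH0 (block L p) E (c / β) ω : ℝ)|
        ≤ ∑ p, cauchyError β E c κ (imTrace H0 ω (block L p)) := by
      rw [← Finset.sum_sub_distrib]
      refine (Finset.abs_sum_le_sum_abs _ _).trans (Finset.sum_le_sum fun p _ => ?_)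
      rw [abs_sub_comm]
      exact abs_levelCount_sub_cauchySum_le hH0 (block L p) ω hβ hκ E ht happ
    exact (abs_sub_le _ (cauchySum β E t w (imTrace H0 ω (box d L))) _).trans
      ((add_le_add h0 ((abs_sub_le _ _ _).trans (add_le_add h1 h2))).trans (add_assoc _ _ _).ge)
  calc _ ≤ ∫ ω, (cauchyError β E c κ (imTrace H0 ω (box d L))
        + ∑ j, |w j| * (β⁻¹ * |imTrace H0 ω (box d L) (spectralPoint E (t j / β))
          - ∑ p, imTrace H0 ω (block L p) (spectralPoint E (t j / β))|)
        + ∑ p, cauchyError β E c κ (imTrace H0 ω (block L p))) ∂(law d μ) :=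
        integral_mono_of_nonneg (.of_forall fun _ => abs_nonneg _) (k02.add k1) (.of_forall hpt)
    _ ≤ errorBound K α κ + ∑ j, |w j| * (β⁻¹ * ∫ ω, |imTrace H0 ω (box d L)
        (spectralPoint E (t j / β)) - ∑ p, imTrace H0 ω (block L p)
          (spectralPoint E (t j / β))| ∂(law d μ)) + errorBound K α κ := by
        rw [integral_add k02 k1, integral_add j0 k2, integral_finsetSum _ fun p _ => j1 p,
          integral_finsetSum _ fun j _ => j2 j]
        simp only [integral_const_mul]
        refine add_le_add (add_le_add ?_ le_rfl) ?_
        · refine (integral_cauchyError_imTrace_le hH0 hK _ hβ hκ E c).trans (le_of_eq ?_)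
          rw [card_box]
          exact box_card_mul_eq hα L
        · exact (Finset.sum_le_sum fun p _ =>
            integral_cauchyError_imTrace_le hH0 hK (block L p) hβ hκ E c).trans
              (sum_card_block_mul_le hα hK.1 hκ L)
    _ = _ := by ring

/-- The mean number of levels in the blocks is given by the density of states. -/
theorem tendsto_abs_sum_integral_levelCount_sub (hd : 1 ≤ d) (hH0 : IsSelfAdjoint H0)
    (htrans : CommutesWithTranslations H0) {μ : Measure ℝ} [IsProbabilityMeasure μ]
    {α K : ℝ} (hα : 0 < α) (hK : WegnerBound H0 μ α K) {a b : ℝ}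
    (hloc : FractionalMomentDecay H0 μ a b) {E : ℝ} (hE : E ∈ Set.Icc a b) {c : ℝ} (hc : 0 < c) :
    Tendsto (fun L : ℕ => |(2 * (L : ℝ) + 1) ^ d
        * (ids H0 μ (Set.Ioo (E - c / scale d α L) (E + c / scale d α L))).toReal
      - ∑ p, ∫ ω, (levelCount hH0 (block L p) E (c / scale d α L) ω : ℝ) ∂(law d μ)|)
      atTop (𝓝 0) := by
  refine tendsto_zero_of_le_errorBound (K := K) hα (fun L => abs_nonneg _) fun κ hκ => ?_
  obtain ⟨m, t, w, ht, happ, -⟩ := exists_cauchy_approx hc hκ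
  refine ⟨fun L => ∑ j, |w j| * ((scale d α L)⁻¹ * |(2 * (L : ℝ) + 1) ^ d
        * meanCauchy H0 μ (spectralPoint E (t j / scale d α L)) - ∑ p, ∫ ω, imTrace H0 ω (block L p)
          (spectralPoint E (t j / scale d α L)) ∂(law d μ)|), ?_, fun L => ?_⟩
  · have := tendsto_finsetSum (Finset.univ : Finset (Fin m)) fun j _ =>
      (tendsto_imTrace_comparison hd hH0 htrans hα hK hloc hE (ht j)).2.const_mul |w j|
    simpa using this
  set β := scale d α L with hβdef
  set V : ℝ := (2 * (L : ℝ) + 1) ^ d with hV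
  have hV0 : 0 ≤ V := by positivity
  have hβ : 0 < β := scale_pos d α L
  have hg : ∀ S : Finset (Fin d → ℤ), ∀ z : ℂ, 0 < z.im →
      Integrable (fun ω => imTrace H0 ω S z) (law d μ) := fun S z hz =>
    integrable_imTrace hH0 μ S hz
  have h0 : |V * (ids H0 μ (Set.Ioo (E - c / β) (E + c / β))).toReal
      - cauchySum β E t w fun z => V * meanCauchy H0 μ z| ≤ errorBound K α κ := by
    have e : (cauchySum β E t w fun z => V * meanCauchy H0 μ z)
        = V * cauchySum β E t w (meanCauchy H0 μ) := by
      unfold cauchySum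
      rw [Finset.mul_sum]
      exact Finset.sum_congr rfl fun j _ => by ring
    rw [e, ← mul_sub, abs_mul, abs_of_nonneg hV0, ← box_card_mul_eq (d := d) (K := K) (κ := κ) hα L]
    refine mul_le_mul_of_nonneg_left ?_ hV0
    refine (abs_ids_sub_cauchySum_le hH0 μ hβ hκ E ht happ).trans ?_
    refine (cauchyError_le (N := 1) hβ hκ E c fun z hz => ?_).trans (one_mul _).le
    rw [one_mul]
    exact meanCauchy_le hH0 hK hz
  have h1 := abs_cauchySum_sub_sum_le hβ E t w (fun z => V * meanCauchy H0 μ z)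
    fun (p : Fin d → Fin (blockSide L)) z => ∫ ω, imTrace H0 ω (block L p) z ∂(law d μ)
  have h2 : |∑ p, (cauchySum β E t w fun z => ∫ ω, imTrace H0 ω (block L p) z ∂(law d μ))
      - ∑ p, ∫ ω, (levelCount hH0 (block L p) E (c / β) ω : ℝ) ∂(law d μ)|
      ≤ errorBound K α κ := by
    rw [← Finset.sum_sub_distrib]
    refine ((Finset.abs_sum_le_sum_abs _ _).trans (Finset.sum_le_sum fun p _ => ?_)).trans
      (sum_card_block_mul_le (d := d) hα hK.1 hκ L)
    obtain ⟨i1, e1⟩ := integral_cauchySum (law d μ) (hg (block L p)) hβ E (a := w) ht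
    have i2 := (integral_cauchyError (law d μ) (hg (block L p)) hβ hκ E c).1
    rw [← e1, ← integral_sub i1 (integrable_levelCount hH0 μ _ E (div_pos hc hβ))]
    refine abs_integral_le_integral_abs.trans (le_trans ?_
      (integral_cauchyError_imTrace_le hH0 hK (block L p) hβ hκ E c))
    refine integral_mono_of_nonneg (.of_forall fun _ => abs_nonneg _) i2 (.of_forall fun ω => ?_)
    simp only
    rw [abs_sub_comm]
    exact abs_levelCount_sub_cauchySum_le hH0 (block L p) ω hβ hκ E ht happ
  refine (abs_sub_le _ (cauchySum β E t w fun z => V * meanCauchy H0 μ z) _).trans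
    ((add_le_add h0 ((abs_sub_le _ _ _).trans (add_le_add h1 h2))).trans (le_of_eq ?_))
  ring

/-! ### Wegner and Minami estimates summed over the blocks -/

theorem tendsto_pow_div (hd : 1 ≤ d) (M : ℝ) :
    Tendsto (fun L : ℕ => (blockSide L : ℝ) ^ d
      * ((blockSide L : ℝ) ^ d * (M / (2 * (L : ℝ) + 1) ^ d)) ^ 2) atTop (𝓝 0) := by
  have h1 : Tendsto (fun L : ℕ => M ^ 2 * ((blockSide L : ℝ) ^ d)⁻¹) atTop (𝓝 0) := by
    have : Tendsto (fun L : ℕ => ((blockSide L : ℝ) ^ d)⁻¹) atTop (𝓝 0) :=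
      tendsto_inv_atTop_zero.comp ((tendsto_pow_atTop (by omega)).comp
        (tendsto_natCast_atTop_atTop.comp tendsto_blockSide_atTop))
    simpa using this.const_mul (M ^ 2)
  refine squeeze_zero' (.of_forall fun L => by positivity) ?_ h1
  filter_upwards [tendsto_blockSide_atTop.eventually_ge_atTop 1] with L hL
  have hq : (0 : ℝ) < (blockSide L : ℝ) ^ d := by
    have : (0 : ℝ) < blockSide L := by exact_mod_cast hL
    positivity
  have hV : (0 : ℝ) < (2 * (L : ℝ) + 1) ^ d := by positivity
  -- The squared side of a block is at most that of the box, so each block has mean O(q^(-d)) with q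
  -- the block side, and the q^d squares add up to O(q^(-d)).
  have hle : (blockSide L : ℝ) ^ d * (blockSide L : ℝ) ^ d ≤ (2 * (L : ℝ) + 1) ^ d := by
    rw [← mul_pow]
    have : (blockSide L : ℝ) * blockSide L ≤ 2 * (L : ℝ) + 1 := by
      exact_mod_cast blockSide_mul_self_le L
    exact pow_le_pow_left₀ (by positivity) this d
  generalize (blockSide L : ℝ) ^ d = q at *
  generalize (2 * (L : ℝ) + 1) ^ d = V at *
  have : q * (q * (M / V)) ^ 2 = M ^ 2 * q⁻¹ * ((q * q) * (q * q) / (V * V)) := by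
    field_simp
  rw [this]
  refine mul_le_of_le_one_right (by positivity) ?_
  rw [div_le_one (by positivity)]
  exact mul_le_mul hle hle (by positivity) hV.le

theorem sum_block_const (d L : ℕ) (x : ℝ) :
    ∑ _p : Fin d → Fin (blockSide L), x = (blockSide L : ℝ) ^ d * x := by
  rw [Finset.sum_const, nsmul_eq_mul, Finset.card_univ, Fintype.card_fun, Fintype.card_fin,
    Fintype.card_fin, Nat.cast_pow]

theorem scaled_radius_rpow (d : ℕ) {α c : ℝ} (hα : 0 < α) (hc : 0 < c) (L : ℕ) :
    (c / scale d α L) ^ α = c ^ α / (2 * (L : ℝ) + 1) ^ d := by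
  rw [Real.div_rpow hc.le (scale_pos d α L).le, scale_rpow d hα]

theorem integral_levelCount_block_le (hH0 : IsSelfAdjoint H0) {μ : Measure ℝ}
    [IsProbabilityMeasure μ] {α K : ℝ} (hα : 0 < α) (hK : WegnerBound H0 μ α K) (E : ℝ) {c : ℝ}
    (hc : 0 < c) (L : ℕ) (p : Fin d → Fin (blockSide L)) :
    ∫ ω, (levelCount hH0 (block L p) E (c / scale d α L) ω : ℝ) ∂(law d μ)
      ≤ (blockSide L : ℝ) ^ d * (2 * K * c ^ α / (2 * (L : ℝ) + 1) ^ d) := by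
  have hK0 := hK.1
  have h := lintegral_levelCount_le hH0 hK (block L p) E (div_pos hc (scale_pos d α L))
  rw [block, card_cube, ← block, scaled_radius_rpow d hα hc, ← mul_div_assoc,
    ← ENNReal.ofReal_natCast, ← ENNReal.ofReal_mul (by positivity)] at h
  rw [← ENNReal.ofReal_le_ofReal_iff (by positivity),
    ofReal_integral_eq_lintegral_ofReal (integrable_levelCount hH0 μ _ E
      (div_pos hc (scale_pos d α L))) (.of_forall fun _ => Nat.cast_nonneg _)]
  simpa only [ENNReal.ofReal_natCast, Nat.cast_pow] using h

theorem tendsto_sum_sq_integral_levelCount (hd : 1 ≤ d) (hH0 : IsSelfAdjoint H0) {μ : Measure ℝ}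
    [IsProbabilityMeasure μ] {α K : ℝ} (hα : 0 < α) (hK : WegnerBound H0 μ α K) (E : ℝ) {c : ℝ}
    (hc : 0 < c) :
    Tendsto (fun L => ∑ p, (∫ ω, (levelCount hH0 (block L p) E (c / scale d α L) ω : ℝ)
      ∂(law d μ)) ^ 2) atTop (𝓝 0) := by
  refine squeeze_zero (fun L => Finset.sum_nonneg fun p _ => sq_nonneg _) (fun L => ?_)
    (tendsto_pow_div hd (2 * K * c ^ α))
  rw [← sum_block_const]
  exact Finset.sum_le_sum fun p _ => pow_le_pow_left₀
    (integral_nonneg fun _ => Nat.cast_nonneg _) (integral_levelCount_block_le hH0 hα hK E hc L p) 2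

/-- Summed over the blocks, the second factorial moments of the numbers of levels vanish in the limit. -/
theorem tendsto_sum_factorial_moment_levelCount (hd : 1 ≤ d) (hH0 : IsSelfAdjoint H0)
    {μ : Measure ℝ} [IsProbabilityMeasure μ] {α K : ℝ} (hα : 0 < α) (hK : 0 ≤ K)
    (hM : ∀ (Λ : Finset (Fin d → ℤ)) (E r : ℝ), 0 < r →
      ∫⁻ ω, (levelCount hH0 Λ E r ω : ℝ≥0∞) * ((levelCount hH0 Λ E r ω - 1 : ℕ) : ℝ≥0∞)
        ∂(law d μ) ≤ (Λ.card * ENNReal.ofReal (2 * K * r ^ α)) ^ 2) (E : ℝ) {c : ℝ} (hc : 0 < c) :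
    Tendsto (fun L => ∑ p, ∫ ω, (levelCount hH0 (block L p) E (c / scale d α L) ω : ℝ)
      * (levelCount hH0 (block L p) E (c / scale d α L) ω - 1) ∂(law d μ)) atTop (𝓝 0) := by
  have hnat : ∀ n : ℕ, (n : ℝ) * (n - 1) = ((n * (n - 1) : ℕ) : ℝ) := fun n => by
    cases n <;> simp
  refine squeeze_zero (fun L => Finset.sum_nonneg fun p _ => integral_nonneg fun ω => ?_)
    (fun L => ?_) (tendsto_pow_div hd (2 * K * c ^ α))
  · simp only [hnat]
    exact Nat.cast_nonneg _
  rw [← sum_block_const]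
  refine Finset.sum_le_sum fun p _ => ?_
  have hr := div_pos hc (scale_pos d α L)
  have hmeas := measurable_levelCount hH0 (block L p) E hr
  have h := hM (block L p) E _ hr
  rw [block, card_cube, ← block, scaled_radius_rpow d hα hc, ← mul_div_assoc,
    ← ENNReal.ofReal_natCast, ← ENNReal.ofReal_mul (by positivity),
    ← ENNReal.ofReal_pow (by positivity)] at h
  simp only [hnat]
  have hint : Integrable (fun ω => ((levelCount hH0 (block L p) E (c / scale d α L) ω
      * (levelCount hH0 (block L p) E (c / scale d α L) ω - 1) : ℕ) : ℝ)) (law d μ) := by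
    refine .of_bound ((measurable_from_nat (f := fun n : ℕ => ((n * (n - 1) : ℕ) : ℝ))).comp
      hmeas).aestronglyMeasurable ((block L p).card * ((block L p).card - 1) : ℕ)
      (.of_forall fun ω => ?_)
    have hle := levelCount_le_card hH0 (block L p) E (c / scale d α L) ω
    rw [Real.norm_eq_abs, Nat.abs_cast]
    exact_mod_cast Nat.mul_le_mul hle (Nat.sub_le_sub_right hle 1)
  rw [← ENNReal.ofReal_le_ofReal_iff (by positivity), ofReal_integral_eq_lintegral_ofReal hint
    (.of_forall fun _ => Nat.cast_nonneg _)]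
  simp only [ENNReal.ofReal_natCast]
  simpa only [Nat.cast_pow, Nat.cast_mul] using h

variable {d : ℕ} {H0 : L2 d →L[ℂ] L2 d}

/-! ### The scaling of the density of states -/

/-- If consecutive terms of a null sequence are asymptotically equal, then the upper
`α`-derivative at `0` of a monotone function is a cluster point of the difference quotients along
that sequence. -/
theorem mapClusterPt_limsup_of_ratio {g : ℝ → ℝ≥0∞} (hg : Monotone g) {α : ℝ}
    {e : ℕ → ℝ} (he : ∀ L, 0 < e L) (he0 : Tendsto e atTop (𝓝 0))
    (hratio : Tendsto (fun L => (e L / e (L + 1)) ^ α) atTop (𝓝 1)) (hα : 0 < α) {D : ℝ≥0∞}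
    (hD : limsup (fun ε : ℝ => g ε / ENNReal.ofReal ((2 * ε) ^ α)) (𝓝[>] (0 : ℝ)) = D)
    (hD0 : 0 < D) (hDtop : D < ∞) :
    MapClusterPt D atTop fun L => g (e L) / ENNReal.ofReal ((2 * e L) ^ α) := by
  set f : ℝ → ℝ≥0∞ := fun ε => g ε / ENNReal.ofReal ((2 * ε) ^ α) with hf
  have hew : Tendsto e atTop (𝓝[>] 0) := tendsto_nhdsWithin_iff.2 ⟨he0, .of_forall he⟩
  have hup : ∀ y, D < y → ∀ᶠ L in atTop, f (e L) < y := fun y hy =>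
    hew.eventually (eventually_lt_of_limsup_lt (hD.trans_lt hy))
  -- If the quotients along e stayed below y < D, monotonicity of g would carry the bound to all
  -- small ε at the cost of a ratio factor tending to 1, contradicting the limsup.
  have hlow : ∀ y, y < D → ∃ᶠ L in atTop, y < f (e L) := by
    intro y hy
    obtain ⟨y', hyy', hy'⟩ := exists_between hy
    have hfreq : ∃ᶠ ε in 𝓝[>] (0 : ℝ), y' < f ε :=
      frequently_lt_of_lt_limsup (h := hy'.trans_eq hD.symm)
    intro hcon
    simp only [not_lt] at hcon
    have h1 : ∀ᶠ L in atTop, y * ENNReal.ofReal ((e L / e (L + 1)) ^ α) < y' := by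
      have h2 := ENNReal.Tendsto.const_mul (a := y) (ENNReal.tendsto_ofReal hratio)
        (Or.inr hyy'.ne_top)
      rw [ENNReal.ofReal_one, mul_one] at h2
      exact h2.eventually (gt_mem_nhds hyy')
    obtain ⟨N, hN⟩ := eventually_atTop.1 (hcon.and h1)
    refine hfreq ?_
    filter_upwards [Ioo_mem_nhdsGT (he N)] with ε hε
    -- The first index M ≥ N with e M ≤ ε: its predecessor L satisfies e (L + 1) ≤ ε < e L, without
    -- any monotonicity of e.
    have hex : ∃ M, N ≤ M ∧ e M ≤ ε :=
      ((eventually_ge_atTop N).and (he0.eventually (ge_mem_nhds hε.1))).exists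
    classical
    obtain ⟨hM1, hM2⟩ := Nat.find_spec hex
    set M := Nat.find hex with hMdef
    have hNM : N < M := by
      refine lt_of_le_of_ne hM1 fun h => ?_
      rw [← h] at hM2
      exact absurd hε.2 (not_lt.2 hM2)
    obtain ⟨L, hLM⟩ : ∃ L, M = L + 1 := ⟨M - 1, by omega⟩
    rw [hLM] at hM2
    have hNL : N ≤ L := by omega
    have hL : ε < e L := by
      have := Nat.find_min hex (m := L) (by omega)
      push Not at this
      exact this hNL
    obtain ⟨h2, h3⟩ := hN L hNL
    have pos : ∀ x : ℝ, 0 < x → 0 < (2 * x) ^ α := fun x hx => Real.rpow_pos_of_pos (by linarith) _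
    have h4 : g (e L) ≤ y * ENNReal.ofReal ((2 * e L) ^ α) :=
      (ENNReal.div_le_iff (ENNReal.ofReal_pos.2 (pos _ (he L))).ne' ENNReal.ofReal_ne_top).1 h2
    rw [not_lt]
    calc f ε ≤ g (e L) / ENNReal.ofReal ((2 * e (L + 1)) ^ α) := by
          refine ENNReal.div_le_div (hg hL.le) (ENNReal.ofReal_le_ofReal ?_)
          exact Real.rpow_le_rpow (by have := he (L + 1); linarith) (by linarith) hα.le
      _ ≤ y * ENNReal.ofReal ((2 * e L) ^ α) / ENNReal.ofReal ((2 * e (L + 1)) ^ α) :=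
          ENNReal.div_le_div_right h4 _
      _ = y * ENNReal.ofReal ((e L / e (L + 1)) ^ α) := by
          rw [mul_div_assoc, ← ENNReal.ofReal_div_of_pos (pos _ (he _)), ← Real.div_rpow
            (by have := he L; linarith) (by have := he (L + 1); linarith),
            mul_div_mul_left _ _ two_ne_zero]
      _ ≤ y' := h3.le
  rw [mapClusterPt_iff_frequently]
  intro s hs
  obtain ⟨l, u, hlu, hsub⟩ := (mem_nhds_iff_exists_Ioo_subset' ⟨0, hD0⟩ ⟨∞, hDtop⟩).1 hs
  exact ((hlow l hlu.1).and_eventually (hup u hlu.2)).mono fun L hL => hsub ⟨hL.1, hL.2⟩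

/-- The power α undoes the exponent d/α of the scale, leaving ((2L+3)/(2L+1))^d. -/
theorem tendsto_scaled_radius_ratio (d : ℕ) {α c : ℝ} (hα : 0 < α) (hc : 0 < c) :
    Tendsto (fun L => (c / scale d α L / (c / scale d α (L + 1))) ^ α) atTop (𝓝 1) := by
  have h1 : Tendsto (fun L : ℕ => 1 + 2 / (2 * (L : ℝ) + 1)) atTop (𝓝 1) := by
    simpa using (tendsto_two_mul_add_one.const_div_atTop 2).const_add 1
  have h2 := h1.pow d
  rw [one_pow] at h2
  refine h2.congr fun L => ?_
  have p1 := scale_pos d α L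
  have p2 := scale_pos d α (L + 1)
  have hV : (0 : ℝ) < (2 * (L : ℝ) + 1) := by positivity
  rw [Real.div_rpow (div_pos hc p1).le (div_pos hc p2).le, scaled_radius_rpow d hα hc,
    scaled_radius_rpow d hα hc]
  have hcα : 0 < c ^ α := Real.rpow_pos_of_pos hc _
  rw [div_div_div_cancel_left' _ _ hcα.ne', ← div_pow]
  congr 1
  push_cast
  field_simp
  ring

/-- Along a subsequence of the boxes, the density of states of the rescaled interval is given by
the upper derivative. -/
theorem exists_subseq_tendsto_ids (hd : 1 ≤ d) {μ : Measure ℝ} {α : ℝ} (hα : 0 < α) {E : ℝ}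
    (hDpos : 0 < upperDerivative H0 μ α E) (hDfin : upperDerivative H0 μ α E < ∞) {c : ℝ}
    (hc : 0 < c) : ∃ L : ℕ → ℕ, StrictMono L ∧ Tendsto (fun n : ℕ => (2 * (L n : ℝ) + 1) ^ d
      * (ids H0 μ (Set.Ioo (E - c / scale d α (L n)) (E + c / scale d α (L n)))).toReal) atTop
      (𝓝 ((upperDerivative H0 μ α E).toReal * (2 * c) ^ α)) := by
  have hmono : Monotone fun ε : ℝ => ids H0 μ (Set.Ioo (E - ε) (E + ε)) := fun x y hxy =>
    lintegral_mono fun ω => measure_mono (Set.Ioo_subset_Ioo (by linarith) (by linarith))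
  have hclus := mapClusterPt_limsup_of_ratio hmono (fun L => div_pos hc (scale_pos d α L))
    ((tendsto_scale_atTop hd hα).const_div_atTop c) (tendsto_scaled_radius_ratio d hα hc) hα
    (D := upperDerivative H0 μ α E) rfl hDpos hDfin
  obtain ⟨L, hL, hlim⟩ := hclus.tendsto_subseq
  refine ⟨L, hL, ?_⟩
  refine (((ENNReal.tendsto_toReal hDfin.ne).comp hlim).mul_const ((2 * c) ^ α)).congr fun n => ?_
  have h1 : (2 * (c / scale d α (L n))) ^ α = (2 * c) ^ α / (2 * (L n : ℝ) + 1) ^ d := by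
    rw [← mul_div_assoc, scaled_radius_rpow d hα (by positivity)]
  have h2 : 0 < (2 * c) ^ α := Real.rpow_pos_of_pos (by positivity) _
  simp only [Function.comp_apply]
  rw [h1, ENNReal.toReal_div, ENNReal.toReal_ofReal (by positivity)]
  field_simp

/-- Matches the normalization (2ε)^α of the upper derivative, so the limiting mean D (2c)^α is D
ℒ_α(I). -/
theorem ell_Ioo {α c : ℝ} (hα : 0 < α) (hc : 0 < c) :
    ell α (Set.Ioo (-c) c) = ENNReal.ofReal ((2 * c) ^ α) := by
  have h1 : ∫ y in Set.Ioo (-c) c, |y| ^ (α - 1) = 2 * (c ^ α / α) := by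
    have e1 : ∫ y in Set.Ioo (-c) c, |y| ^ (α - 1)
        = ∫ y : ℝ, (Set.Iio c).indicator (fun x => x ^ (α - 1)) |y| := by
      rw [← integral_indicator measurableSet_Ioo]
      congr 1
      funext y
      simp only [Set.indicator_apply, Set.mem_Ioo, Set.mem_Iio, abs_lt]
    rw [e1, integral_comp_abs, integral_indicator measurableSet_Iio,
      Measure.restrict_restrict measurableSet_Iio, Set.inter_comm, Set.Ioi_inter_Iio,
      ← integral_Ioc_eq_integral_Ioo, ← intervalIntegral.integral_of_le hc.le,
      integral_rpow (Or.inl (by linarith)), sub_add_cancel, Real.zero_rpow hα.ne', sub_zero]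
  have hcα : 0 < c ^ α := Real.rpow_pos_of_pos hc _
  -- The Bochner integral was just found to be nonzero, which a non-integrable function cannot have.
  have hint : IntegrableOn (fun y : ℝ => |y| ^ (α - 1)) (Set.Ioo (-c) c) := by
    by_contra h
    rw [integral_undef h] at h1
    have : 0 < 2 * (c ^ α / α) := by positivity
    exact this.ne h1
  rw [ell, ← ofReal_integral_eq_lintegral_ofReal hint
    (.of_forall fun y => Real.rpow_nonneg (abs_nonneg y) _), h1,
    ← ENNReal.ofReal_mul (by positivity), Real.mul_rpow zero_le_two hc.le,
    Real.rpow_sub_one two_ne_zero]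
  congr 1
  field_simp

/-! ### Reduction to intervals (-c, c) and independence of the blocks -/

theorem eq_Ioo_of_symmetric {I : Set ℝ} (hIopen : IsOpen I) (hIconn : I.OrdConnected)
    (hIbdd : Bornology.IsBounded I) (hIsymm : ∀ x : ℝ, x ∈ I ↔ -x ∈ I) (hne : I.Nonempty) :
    ∃ c, 0 < c ∧ I = Set.Ioo (-c) c := by
  have hb := hIbdd.bddAbove
  have hlt : ∀ x ∈ I, x < sSup I := by
    intro x hx
    obtain ⟨ε, hε, hball⟩ := Metric.isOpen_iff.1 hIopen x hx
    have h : x + ε / 2 ∈ I := hball (by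
      rw [Metric.mem_ball, Real.dist_eq, add_sub_cancel_left, abs_of_pos (by linarith)]
      linarith)
    have := le_csSup hb h
    linarith
  refine ⟨sSup I, ?_, Set.Subset.antisymm (fun x hx => ?_) fun x hx => ?_⟩
  · obtain ⟨x, hx⟩ := hne
    have h1 := hlt x hx
    have h2 := hlt (-x) ((hIsymm x).1 hx)
    linarith
  · have h2 := hlt (-x) ((hIsymm x).1 hx)
    exact ⟨by linarith, hlt x hx⟩
  · have hxs : |x| < sSup I := abs_lt.2 hx
    obtain ⟨y, hy, hxy⟩ := exists_lt_of_lt_csSup hne hxs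
    exact hIconn.out ((hIsymm y).1 hy) hy ⟨(abs_lt.1 hxy).1.le, (abs_lt.1 hxy).2.le⟩

theorem xi_Ioo (hH0 : IsSelfAdjoint H0) (α E c : ℝ) (L : ℕ) :
    xi hH0 α E L (Set.Ioo (-c) c) = levelCount hH0 (box d L) E (c / scale d α L) := by
  funext ω
  unfold xi levelCount eigenCount
  congr 1
  refine congrArg _ (funext fun i => propext ?_)
  have hβ := scale_pos d α L
  rw [Set.mem_Ioo, ← abs_lt, abs_mul, abs_of_pos hβ, lt_div_iff₀ hβ, mul_comm]

theorem iIndepFun_levelCount_block (hH0 : IsSelfAdjoint H0) (μ : Measure ℝ)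
    [IsProbabilityMeasure μ] (E : ℝ) {r : ℝ} (hr : 0 < r) (L : ℕ) :
    ProbabilityTheory.iIndepFun (fun (p : Fin d → Fin (blockSide L)) =>
      levelCount hH0 (block L p) E r) (law d μ) :=
  iIndepFun_of_dependsOn (pairwise_disjoint_block L)
    (fun p => measurable_levelCount hH0 (block L p) E hr)
    fun _ _ _ h => levelCount_congr hH0 E r h

end Anderson

/-! ### The main theorem -/

open Anderson in
theorem mainTheorem2 (d : ℕ) (hd : 1 ≤ d)
    (H0 : Anderson.L2 d →L[ℂ] Anderson.L2 d) (hH0 : IsSelfAdjoint H0)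
    (htrans : Anderson.CommutesWithTranslations H0)
    (α : ℝ) (hα0 : 0 < α) (hα1 : α ≤ 1)
    (μ : Measure ℝ) [IsProbabilityMeasure μ] (hμ : Anderson.IsUniformlyHolder α μ)
    (a b : ℝ) (hloc : Anderson.FractionalMomentDecay H0 μ a b)
    (E : ℝ) (hE : E ∈ Set.Icc a b)
    (hDpos : 0 < Anderson.upperDerivative H0 μ α E)
    (hDfin : Anderson.upperDerivative H0 μ α E < ∞)
    (I : Set ℝ) (hIopen : IsOpen I) (hIconn : I.OrdConnected)
    (hIbdd : Bornology.IsBounded I) (hIsymm : ∀ x : ℝ, x ∈ I ↔ -x ∈ I) :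
    ∃ r : ℝ≥0, (r : ℝ≥0∞) = Anderson.upperDerivative H0 μ α E * Anderson.ell α I ∧
      ∃ L : ℕ → ℕ, StrictMono L ∧
        TendstoInDistribution (fun n : ℕ => Anderson.xi hH0 α E (L n) I) atTop
          (id : ℕ → ℕ) (fun _ => Anderson.law d μ) (ProbabilityTheory.poissonMeasure r) := by
  -- The empty interval is admitted; its count is 0, a Poisson variable of parameter 0, obtained
  -- from arrays with no entries.
  rcases I.eq_empty_or_nonempty with rfl | hne
  · refine ⟨0, by simp [ell], id, strictMono_id, ?_⟩
    have h0 : ∀ n, xi hH0 α E n ∅ = fun _ => 0 := fun n => by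
      funext ω
      simp [xi]
    simp only [id, h0]
    exact tendstoInDistribution_poisson_of_array (ι := fun _ => Empty) (X := fun _ _ _ => 0)
      (B := 0) (fun _ _ => measurable_const) (fun _ => measurable_const) (fun _ _ _ => le_rfl)
      (fun _ _ => le_rfl) (fun _ => ProbabilityTheory.iIndepFun.of_subsingleton) (by simp)
      (by simp) (by simp) (by simp)
  obtain ⟨c, hc, rfl⟩ := eq_Ioo_of_symmetric hIopen hIconn hIbdd hIsymm hne
  obtain ⟨K, hK, hM⟩ := exists_wegner_minami hH0 hα1 hμ
  obtain ⟨L, hL, hids⟩ := exists_subseq_tendsto_ids hd hα0 hDpos hDfin hc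
  have hr : upperDerivative H0 μ α E * ell α (Set.Ioo (-c) c) ≠ ∞ := by
    rw [ell_Ioo hα0 hc]
    exact ENNReal.mul_ne_top hDfin.ne ENNReal.ofReal_ne_top
  refine ⟨_, ENNReal.coe_toNNReal hr, L, hL, ?_⟩
  simp only [xi_Ioo]
  have hpos : ∀ n, 0 < c / scale d α (L n) := fun n => div_pos hc (scale_pos d α (L n))
  refine tendstoInDistribution_poisson_of_array
    (X := fun n p => levelCount hH0 (block (L n) p) E (c / scale d α (L n)))
    (B := fun n => (box d (L n)).card)
    (fun n p => measurable_levelCount hH0 _ E (hpos n))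
    (fun n => measurable_levelCount hH0 _ E (hpos n))
    (fun n p ω => (levelCount_le_card hH0 _ E _ ω).trans
      (Finset.card_le_card (block_subset_box (L n) p)))
    (fun n ω => levelCount_le_card hH0 _ E _ ω)
    (fun n => iIndepFun_levelCount_block hH0 μ E (hpos n) (L n)) ?_
    ((tendsto_sum_factorial_moment_levelCount hd hH0 hα0 hK.1 hM E hc).comp hL.tendsto_atTop)
    ((tendsto_sum_sq_integral_levelCount hd hH0 hα0 hK E hc).comp hL.tendsto_atTop)
    ((tendsto_integral_abs_levelCount_sub hd hH0 htrans hα0 hK hloc hE hc).comp hL.tendsto_atTop)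
  -- The total block mean differs from the scaled density of states by a null sequence, and the
  -- latter converges along the chosen subsequence.
  have hdiff := (tendsto_zero_iff_abs_tendsto_zero _).2
    ((tendsto_abs_sum_integral_levelCount_sub hd hH0 htrans hα0 hK hloc hE hc).comp
      hL.tendsto_atTop)
  have hlim := hids.sub hdiff
  rw [sub_zero] at hlim
  have hrr : ((upperDerivative H0 μ α E * ell α (Set.Ioo (-c) c)).toNNReal : ℝ)
      = (upperDerivative H0 μ α E).toReal * (2 * c) ^ α := by
    rw [ENNReal.coe_toNNReal_eq_toReal, ENNReal.toReal_mul, ell_Ioo hα0 hc,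
      ENNReal.toReal_ofReal (by positivity)]
  rw [hrr]
  refine hlim.congr fun n => ?_
  simp only [sub_sub_cancel]
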